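/- Let $\alpha>-1$, let $\mathbb{H}$ be the quaternions with unit ball $\mathbb{D}$, let $i\in\mathbb{H}$ be an imaginary unit ($\operatorname{Re} i=0$, $|i|=1$), $\mathbb{C}_i=\mathbb{R}+i\mathbb{R}$ and $\mathbb{D}_i=\mathbb{D}\cap\mathbb{C}_i$, and let $m_i$ be Lebesgue measure on $\mathbb{C}_i$. Put $$dA_{\alpha,i}(z)=\tfrac{\alpha+1}{\pi}(1-|z|^2)^\alpha\,dm_i(z),\qquad d\mu_i(z)=\frac{1}{\pi(1-|z|^2)^2}\,dm_i(z)\qquad\text{on }\mathbb{D}_i .$$ The weighted slice Bergman space $\mathcal{A}=\mathcal{A}^2_{\alpha,i}(\mathbb{D})$ is the quaternionic right Hilbert space of all left slice hyperholomorphic functions $f:\mathbb{D}\to\mathbb{H}$ with $\int_{\mathbb{D}_i}|f|^2\,dA_{\alpha,i}<\infty$, with scalar product $\langle f,g\rangle=\int_{\mathbb{D}_i}\overline{f(z)}\,g(z)\,dA_{\alpha,i}(z)$. It has a reproducing kernel: $f(w)=\langle K_w,f\rangle$ for all $f\in\mathcal{A}$, $w\in\mathbb{D}$. Let $k_w=K_w/\sqrt{K_w(w)}$.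 The Berezin transform of a bounded right linear operator $T$ on $\mathcal{A}$ is $\widetilde T(z)=\langle k_z,Tk_z\rangle$, $z\in\mathbb{D}_i$. For a unitary anti-selfadjoint operator $J$ on $\mathcal{A}$ let $\mathcal{B}_J(\mathcal{A})$ be the set of bounded right linear operators that commute with $J$, and let the trace class $S_1(J)$ be the set of compact $T\in\mathcal{B}_J(\mathcal{A})$ whose singular values (the eigenvalues of $|T|=\sqrt{T^*T}$ in decreasing order, counted with multiplicity) are summable. For $T\in S_1(J)$ let $\operatorname{Tr}_{Ji}(T)=\sum_n\langle e_n,Te_n\rangle$, where $(e_n)$ is any orthonormal basis of the complex Hilbert space $\mathcal{A}_+^{Ji}=\{f\in\mathcal{A}: Jf=fi\}$ over $\mathbb{C}_i$. 1. Let $J$ be any unitary anti-selfadjoint operator on $\mathcal{A}$. A positive operator $T\in\mathcal{B}_J(\mathcal{A})$ belongs to $S_1(J)$ if and only if $\widetilde T\in L^1(\mathbb{D}_i,d\mu_i)$. 2. Let $J$ be the unitary anti-selfadjoint operator that maps $f\in\mathcal{A}$ to the unique left slice hyperholomorphic function $Jf$ on $\mathbb{D}$ with $(Jf)(z)=i\,f(z)$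 for $z\in\mathbb{D}_i$. If $T\in S_1(J)$, then $\widetilde T\in L^1(\mathbb{D}_i,d\mu_i)$ and $$\operatorname{Tr}_{Ji}(T)=(\alpha+1)\int_{\mathbb{D}_i}\widetilde T(z)\,d\mu_i(z).$$ -/

import Mathlib

open MeasureTheory Quaternion
open scoped MulOpposite

noncomputable section

namespace SliceBergman

/-! ### Quaternionic right Hilbert spaces and their bounded right linear operators

A right vector space over `ℍ` is a module over `ℍᵐᵒᵖ`; the vector `x a` is `MulOpposite.op a • x`. -/

/-- A quaternion-valued scalar product on a right `ℍ`-vector space, right linear in its second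
argument, which induces the given norm. -/
class QuaternionicInner (H : Type*) [NormedAddCommGroup H] [Module ℍᵐᵒᵖ H] where
  qinner : H → H → ℍ
  qinner_self : ∀ x, qinner x x = ((‖x‖ ^ 2 : ℝ) : ℍ)
  qinner_add_right : ∀ x y z, qinner x (y + z) = qinner x y + qinner x z
  qinner_smul_right : ∀ x y (a : ℍ), qinner x (MulOpposite.op a • y) = qinner x y * a
  star_qinner : ∀ x y, star (qinner y x) = qinner x y

open QuaternionicInner

section Operators

variable {H : Type*} [NormedAddCommGroup H] [Module ℍᵐᵒᵖ H] [QuaternionicInner H]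

/-- `A` is the adjoint of `T`: `⟨A x, y⟩ = ⟨x, T y⟩` for all `x`, `y`. -/
def IsAdjoint (A T : H →L[ℍᵐᵒᵖ] H) : Prop :=
  ∀ x y, qinner (A x) y = qinner x (T y)

/-- `T* = -T`. -/
def IsAntiSelfAdjoint (T : H →L[ℍᵐᵒᵖ] H) : Prop :=
  ∀ x y, qinner (-(T x)) y = qinner x (T y)

/-- `T* = T⁻¹`. -/
def IsUnitary (T : H →L[ℍᵐᵒᵖ] H) : Prop :=
  ∃ A : H →L[ℍᵐᵒᵖ] H, IsAdjoint A T ∧ (∀ x, A (T x) = x) ∧ ∀ x, T (A x) = x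

/-- `⟨x, T x⟩` is a nonnegative real number for every `x`. -/
def IsPositive (T : H →L[ℍᵐᵒᵖ] H) : Prop :=
  ∀ x, ∃ r : ℝ, 0 ≤ r ∧ qinner x (T x) = (r : ℍ)

/-- `[T, J] = 0`, that is, `T` belongs to `B_J(H)`. -/
def CommutesWith (J T : H →L[ℍᵐᵒᵖ] H) : Prop :=
  ∀ x, T (J x) = J (T x)

/-- `P = |T| = √(T* T)`: `P` is positive and `P² = T* T`. -/
def IsAbs (P T : H →L[ℍᵐᵒᵖ] H) : Prop :=
  IsPositive P ∧ ∃ A : H →L[ℍᵐᵒᵖ] H, IsAdjoint A T ∧ ∀ x, P (P x) = A (T x)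

/-- `s` is the sequence of singular values of `T`, i.e. of the eigenvalues of `|T|` in decreasing
order and counted with multiplicity: `|T| x = ∑ₙ eₙ sₙ ⟨eₙ, x⟩`, where the vectors `eₙ` that
belong to nonzero `sₙ` are orthonormal. (The other `eₙ` do not matter; they are left free so that
finite dimensional spaces, where `s` is eventually zero, are covered.) -/
def IsSingularValueSeq (T : H →L[ℍᵐᵒᵖ] H) (s : ℕ → ℝ) : Prop :=
  Antitone s ∧ (∀ n, 0 ≤ s n) ∧
    ∃ P : H →L[ℍᵐᵒᵖ] H, IsAbs P T ∧ ∃ e : ℕ → H,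
      (∀ m n, s m ≠ 0 → s n ≠ 0 → qinner (e m) (e n) = if m = n then 1 else 0) ∧
      ∀ x, HasSum (fun n => MulOpposite.op ((s n : ℍ) * qinner (e n) x) • e n) (P x)

/-- The trace class `S₁(J)`: compact operators that commute with `J` and whose sequence of
singular values is summable. -/
def MemTraceClass (J T : H →L[ℍᵐᵒᵖ] H) : Prop :=
  IsCompactOperator T ∧ CommutesWith J T ∧ ∃ s, IsSingularValueSeq T s ∧ Summable s

/-- The subspace `H₊^{Ji} = {x | J x = x i}`. -/
def plusSpace (J : H →L[ℍᵐᵒᵖ] H) (i : ℍ) : Set H :=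
  {x | J x = MulOpposite.op i • x}

/-- `b` is an orthonormal basis of the complex Hilbert space `H₊^{Ji}` over `ℂ_i`. -/
def IsPlusBasis (J : H →L[ℍᵐᵒᵖ] H) (i : ℍ) (b : Set H) : Prop :=
  b ⊆ plusSpace J i ∧
    (∀ e ∈ b, qinner e e = 1) ∧
    (∀ e ∈ b, ∀ e' ∈ b, e ≠ e' → qinner e e' = 0) ∧
    ∀ x ∈ plusSpace J i, HasSum (fun e : b => MulOpposite.op (qinner (e : H) x) • (e : H)) x

/-- `Tr_{Ji}(T) = t`, where `Tr_{Ji}(T)` is the trace of the complex linear operator induced by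
`T` on `H₊^{Ji}`: there are orthonormal bases of `H₊^{Ji}`, and for each of them the series
`∑ ⟨e, T e⟩` converges to `t`. -/
def HasTrace (J : H →L[ℍᵐᵒᵖ] H) (i : ℍ) (T : H →L[ℍᵐᵒᵖ] H) (t : ℍ) : Prop :=
  (∃ b : Set H, IsPlusBasis J i b) ∧
    ∀ b : Set H, IsPlusBasis J i b → HasSum (fun e : b => qinner (e : H) (T (e : H))) t

end Operators

/-! ### Slice hyperholomorphic functions -/

/-- The sphere `𝕊` of imaginary units. -/
abbrev ImagUnit : Type := {i : ℍ // i.re = 0 ∧ ‖i‖ = 1}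

/-- The identification `x₀ + √-1 x₁ ↦ x₀ + i x₁` of `ℂ` with the plane `ℂ_i`. Points, subsets,
functions and measures on `ℂ_i` are written as such on `ℂ`. -/
def slicePt (i : ImagUnit) (z : ℂ) : ℍ := (z.re : ℍ) + (i : ℍ) * (z.im : ℍ)

/-- `f` is left slice hyperholomorphic on the axially symmetric open set `U`: it is real
differentiable and `f (x₀ + i x₁) = a(x₀, x₁) + i b(x₀, x₁)` with `a` even and `b` odd in `x₁` and
`∂₀ a = ∂₁ b`, `∂₀ b = -∂₁ a`. -/
def IsLeftSliceHyperholomorphicOn (f : ℍ → ℍ) (U : Set ℍ) : Prop :=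
  DifferentiableOn ℝ f U ∧ ∃ a b : ℝ → ℝ → ℍ, ∀ (i : ImagUnit) (x y : ℝ), slicePt i ⟨x, y⟩ ∈ U →
    f (slicePt i ⟨x, y⟩) = a x y + (i : ℍ) * b x y ∧
    a x (-y) = a x y ∧ b x (-y) = -b x y ∧
    ∃ c d : ℍ, HasDerivAt (fun s => a s y) c x ∧ HasDerivAt (fun t => b x t) c y ∧
      HasDerivAt (fun s => b s y) d x ∧ HasDerivAt (fun t => a x t) (-d) y

/-- The open unit ball `𝔻` of `ℍ`. -/
def unitBall : Set ℍ := Metric.ball 0 1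

/-- The measure `dA_{α,i}(z) = (α+1)/π (1-|z|²)^α dm_i(z)` on `𝔻_i`. -/
def areaMeasure (α : ℝ) : Measure ℂ :=
  (volume.restrict (Metric.ball (0 : ℂ) 1)).withDensity
    fun z => ENNReal.ofReal ((α + 1) / Real.pi * (1 - ‖z‖ ^ 2) ^ α)

/-- The Möbius invariant measure `dμ_i(z) = 1/(π (1-|z|²)²) dm_i(z)` on `𝔻_i`. -/
def invMeasure : Measure ℂ :=
  (volume.restrict (Metric.ball (0 : ℂ) 1)).withDensity
    fun z => ENNReal.ofReal (1 / (Real.pi * (1 - ‖z‖ ^ 2) ^ 2))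

theorem slicePt_mem (i : ImagUnit) (z : ℂ) : slicePt i z ∈ unitBall ↔ ‖z‖ < 1 := by
  have h : ‖slicePt i z‖ = ‖z‖ := by
    obtain ⟨i, h0, h1⟩ := i
    have h2 : normSq i = 1 := by rw [normSq_eq_norm_mul_self, h1, one_mul]
    rw [normSq_def', h0] at h2
    rw [← sq_eq_sq₀ (norm_nonneg _) (norm_nonneg _), sq, ← normSq_eq_norm_mul_self, normSq_def',
      Complex.sq_norm, Complex.normSq_apply]
    simp [slicePt, h0]
    linear_combination (z.im ^ 2) * h2
  simp [unitBall, h]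

theorem continuous_slicePt (i : ImagUnit) : Continuous (slicePt i) := by
  unfold slicePt
  have : Continuous (fun r : ℝ => (r : ℍ)) := Quaternion.continuous_coe
  fun_prop

open Classical in
/-- The imaginary unit `i_x` with `x = x₀ + i_x x₁`, `x₁ = |x - x₀| ≥ 0`, where `i_x = i` if `x` is
real. -/
def unitOf (i : ImagUnit) (x : ℍ) : ImagUnit :=
  if h : x.im = 0 then i else
    ⟨‖x.im‖⁻¹ • x.im, by simp, by
      rw [norm_smul, norm_inv, norm_norm, inv_mul_cancel₀ (norm_ne_zero_iff.2 h)]⟩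

/-- The coordinates `(x₀, x₁)` with `x = x₀ + i_x x₁`. -/
def sliceCoord (x : ℍ) : ℂ := ⟨x.re, ‖x.im‖⟩

theorem slicePt_unitOf (i : ImagUnit) (x : ℍ) : slicePt (unitOf i x) (sliceCoord x) = x := by
  unfold unitOf slicePt sliceCoord
  split_ifs with h
  · conv_rhs => rw [← Quaternion.re_add_im x, h]
    simp [h]
  · have : ‖x.im‖ ≠ 0 := norm_ne_zero_iff.2 h
    conv_rhs => rw [← Quaternion.re_add_im x]
    rw [Quaternion.mul_coe_eq_smul, smul_smul, mul_inv_cancel₀ this, one_smul]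

/-- The left slice extension of a function `g` on a subset of `ℂ_i` that is symmetric with respect
to the real axis: `ext(g)(x) = ½ (1 - i_x i) g(x₀ + i x₁) + ½ (1 + i_x i) g(x₀ - i x₁)`. -/
def sliceExt (i : ImagUnit) (g : ℂ → ℍ) (x : ℍ) : ℍ :=
  (2⁻¹ : ℝ) • ((1 - (unitOf i x : ℍ) * (i : ℍ)) * g (sliceCoord x)) +
    (2⁻¹ : ℝ) • ((1 + (unitOf i x : ℍ) * (i : ℍ)) * g (star (sliceCoord x)))

/-! ### The weighted slice Bergman space -/

/-- The weighted slice Bergman space `A²_{α,i}(𝔻)` as a right vector space: left slice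
hyperholomorphic functions on `𝔻` (extended by zero outside of `𝔻`) whose restriction to `𝔻_i` is
square integrable with respect to `dA_{α,i}`. -/
def bergmanSubmodule (α : ℝ) (i : ImagUnit) : Submodule ℍᵐᵒᵖ (ℍ → ℍ) where
  carrier := {f | IsLeftSliceHyperholomorphicOn f unitBall ∧ (∀ x, x ∉ unitBall → f x = 0) ∧
    MemLp (fun z => f (slicePt i z)) 2 (areaMeasure α)}
  zero_mem' := by
    refine ⟨⟨differentiableOn_const 0, 0, 0, fun j x y _ => ⟨by simp, by simp, by simp, 0, 0, ?_⟩⟩,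
      fun x _ => rfl, MemLp.zero⟩
    simpa using ⟨hasDerivAt_const x (0 : ℍ), hasDerivAt_const y (0 : ℍ), hasDerivAt_const x (0 : ℍ),
      hasDerivAt_const y (0 : ℍ)⟩
  add_mem' := by
    rintro f g ⟨⟨hf, a, b, h⟩, hf0, hfm⟩ ⟨⟨hg, a', b', h'⟩, hg0, hgm⟩
    refine ⟨⟨hf.add hg, a + a', b + b', fun j x y hxy => ?_⟩, fun x hx => ?_, hfm.add hgm⟩
    · obtain ⟨h1, h2, h3, c, d, h4, h5, h6, h7⟩ := h j x y hxy
      obtain ⟨k1, k2, k3, c', d', k4, k5, k6, k7⟩ := h' j x y hxy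
      refine ⟨?_, ?_, ?_, c + c', d + d', h4.add k4, h5.add k5, h6.add k6, ?_⟩
      · simp only [Pi.add_apply, h1, k1, mul_add]; abel
      · simp only [Pi.add_apply, h2, k2]
      · simp only [Pi.add_apply, h3, k3]; abel
      · rw [neg_add]; exact h7.add k7
    · simp [hf0 x hx, hg0 x hx]
  smul_mem' := by
    rintro q f ⟨⟨hf, a, b, h⟩, hf0, hfm⟩
    refine ⟨⟨fun x hx => (hf x hx).mul_const q.unop, fun x y => a x y * q.unop,
      fun x y => b x y * q.unop, fun j x y hxy => ?_⟩, fun x hx => ?_, ?_⟩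
    · obtain ⟨h1, h2, h3, c, d, h4, h5, h6, h7⟩ := h j x y hxy
      refine ⟨?_, ?_, ?_, c * q.unop, d * q.unop, h4.mul_const _, h5.mul_const _,
        h6.mul_const _, ?_⟩
      · simp only [Pi.smul_apply, MulOpposite.smul_eq_mul_unop, h1, add_mul, mul_assoc]
      · simp only [h2]
      · simp only [h3, neg_mul]
      · rw [← neg_mul]; exact h7.mul_const _
    · simp [hf0 x hx]
    · exact hfm.mul_const q.unop

/-- The weighted slice Bergman space `A²_{α,i}(𝔻)`, for `α > -1`. -/
def Bergman {α : ℝ} (_hα : -1 < α) (i : ImagUnit) : Type := bergmanSubmodule α i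

section Bergman

variable {α : ℝ} {hα : -1 < α} {i : ImagUnit}

instance : AddCommGroup (Bergman hα i) := inferInstanceAs (AddCommGroup (bergmanSubmodule α i))

instance : Module ℍᵐᵒᵖ (Bergman hα i) := inferInstanceAs (Module ℍᵐᵒᵖ (bergmanSubmodule α i))

/-- Elements of the Bergman space are functions. -/
instance : CoeFun (Bergman hα i) fun _ => ℍ → ℍ := ⟨fun f => f.1⟩


theorem Bergman.slice (f : Bergman hα i) : IsLeftSliceHyperholomorphicOn f unitBall := f.2.1

theorem Bergman.eq_zero_of_notMem (f : Bergman hα i) {x : ℍ} (hx : x ∉ unitBall) : f x = 0 :=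
  f.2.2.1 x hx

theorem Bergman.memLp (f : Bergman hα i) :
    MemLp (fun z => f (slicePt i z)) 2 (areaMeasure α) := f.2.2.2

theorem Bergman.ext {f g : Bergman hα i} (h : ∀ x, f x = g x) : f = g :=
  Subtype.ext (funext h)

theorem Bergman.continuousOn (f : Bergman hα i) :
    ContinuousOn (fun z => f (slicePt i z)) (Metric.ball (0 : ℂ) 1) :=
  f.slice.1.continuousOn.comp (continuous_slicePt i).continuousOn fun z hz =>
    (slicePt_mem i z).2 (by simpa using hz)

/-- A function in the Bergman space is determined by its restriction to `𝔻_i`. -/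
theorem Bergman.eq_zero_of_slice (f : Bergman hα i)
    (h : ∀ z : ℂ, ‖z‖ < 1 → f (slicePt i z) = 0) : f = 0 := by
  refine Bergman.ext fun x => ?_
  change f x = 0
  by_cases hx : x ∈ unitBall
  · obtain ⟨_, a, b, hab⟩ := f.slice
    rw [← slicePt_unitOf i x] at hx ⊢
    set j := unitOf i x
    set z := sliceCoord x
    have hz := (slicePt_mem j z).1 hx
    have hz' : ‖star z‖ < 1 := by simpa using hz
    have h1 := hab i z.re z.im ((slicePt_mem i z).2 hz)
    have h2 := (hab i z.re (-z.im) ((slicePt_mem i (star z)).2 hz')).1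
    have e1 : f (slicePt i ⟨z.re, z.im⟩) = 0 := h z hz
    have e2 : f (slicePt i ⟨z.re, -z.im⟩) = 0 := h (star z) hz'
    rw [h1.2.1, h1.2.2.1, e2] at h2
    have h3 := h1.1
    rw [e1] at h3
    have ha : a z.re z.im = 0 := by
      have h4 : a z.re z.im + a z.re z.im = 0 := by
        rw [mul_neg, ← sub_eq_add_neg, eq_comm, sub_eq_zero] at h2
        nth_rewrite 2 [h2]
        exact h3.symm
      rw [← two_smul ℝ] at h4
      simpa using h4
    have hi : (i : ℍ) ≠ 0 := by
      intro hi; have := i.2.2; rw [hi] at this; simp at this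
    have hb : b z.re z.im = 0 := by
      rw [ha, zero_add] at h3
      exact (mul_eq_zero.1 h3.symm).resolve_left hi
    have := (hab j z.re z.im hx).1
    rw [ha, hb] at this
    simpa using this
  · exact f.eq_zero_of_notMem hx

/-- The embedding `f ↦ f|_{𝔻_i}` into `L²(dA_{α,i})`. -/
def Bergman.toL2 (hα : -1 < α) (i : ImagUnit) : Bergman hα i →+ Lp ℍ 2 (areaMeasure α) where
  toFun f := f.memLp.toLp
  map_zero' := rfl
  map_add' _ _ := rfl

theorem Bergman.toL2_injective (hα : -1 < α) (i : ImagUnit) :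
    Function.Injective (Bergman.toL2 hα i) := by
  refine (injective_iff_map_eq_zero _).2 fun f hf => f.eq_zero_of_slice ?_
  have h1 : (fun z => f (slicePt i z)) =ᵐ[areaMeasure α] fun _ => (0 : ℍ) :=
    f.memLp.coeFn_toLp.symm.trans ((Lp.eq_zero_iff_ae_eq_zero).1 hf)
  unfold areaMeasure at h1
  have hm : Measurable fun z : ℂ =>
      ENNReal.ofReal ((α + 1) / Real.pi * (1 - ‖z‖ ^ 2) ^ α) := by fun_prop
  have h2 : (fun z => f (slicePt i z)) =ᵐ[volume.restrict (Metric.ball (0 : ℂ) 1)]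
      fun _ => (0 : ℍ) := by
    have h3 := (ae_withDensity_iff hm).1 h1
    filter_upwards [h3, ae_restrict_mem Metric.isOpen_ball.measurableSet] with z hz hz1
    refine hz (ne_of_gt (ENNReal.ofReal_pos.2 ?_))
    have : ‖z‖ < 1 := by simpa using hz1
    have : 0 < 1 - ‖z‖ ^ 2 := by nlinarith [norm_nonneg z]
    have : 0 < α + 1 := by linarith
    positivity
  have h3 := Measure.eqOn_open_of_ae_eq h2 Metric.isOpen_ball f.continuousOn continuousOn_const
  exact fun z hz => h3 (by simpa using hz)

/-- The norm `‖f‖ = (∫_{𝔻_i} |f|² dA_{α,i})^{1/2}`. -/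
instance : NormedAddCommGroup (Bergman hα i) :=
  NormedAddCommGroup.induced _ _ (Bergman.toL2 hα i) (Bergman.toL2_injective hα i)

theorem Bergman.integrable_star_mul (f g : Bergman hα i) :
    Integrable (fun z => star (f (slicePt i z)) * g (slicePt i z)) (areaMeasure α) :=
  MemLp.integrable_mul (p := 2) (q := 2) f.memLp.star g.memLp

theorem Bergman.integral_normSq (f : Bergman hα i) :
    ∫ z, ‖f (slicePt i z)‖ ^ 2 ∂(areaMeasure α) = ‖f‖ ^ 2 := by
  have h : ‖f‖ = ‖f.memLp.toLp‖ := rfl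
  rw [h, ← real_inner_self_eq_norm_sq, L2.inner_def]
  refine integral_congr_ae ?_
  filter_upwards [f.memLp.coeFn_toLp] with z hz
  rw [hz, real_inner_self_eq_norm_sq]

/-- The scalar product `⟨f, g⟩ = ∫_{𝔻_i} conj(f) g dA_{α,i}`. -/
instance : QuaternionicInner (Bergman hα i) where
  qinner f g := ∫ z, star (f (slicePt i z)) * g (slicePt i z) ∂(areaMeasure α)
  qinner_self f := by
    have h : ∀ z, star (f (slicePt i z)) * f (slicePt i z) =
        (‖f (slicePt i z)‖ ^ 2) • (1 : ℍ) := fun z => by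
      rw [Quaternion.star_mul_self, normSq_eq_norm_mul_self, ← sq, ← Quaternion.coe_mul_eq_smul,
        mul_one]
    simp_rw [h]
    rw [integral_smul_const, Bergman.integral_normSq, ← Quaternion.coe_mul_eq_smul, mul_one]
  qinner_add_right f g h := by
    rw [← integral_add (f.integrable_star_mul g) (f.integrable_star_mul h)]
    refine integral_congr_ae (Filter.Eventually.of_forall fun z => ?_)
    exact mul_add _ _ _
  qinner_smul_right f g a := by
    have h := ((ContinuousLinearMap.mul ℝ ℍ).flip a).integral_comp_comm (f.integrable_star_mul g)
    simp only [ContinuousLinearMap.flip_apply, ContinuousLinearMap.mul_apply'] at h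
    rw [← h]
    refine integral_congr_ae (Filter.Eventually.of_forall fun z => ?_)
    exact (mul_assoc _ _ _).symm
  star_qinner f g := by
    let L : ℍ →ₗ[ℝ] ℍ :=
      { toFun := star, map_add' := star_add, map_smul' := fun r x => Quaternion.star_smul r x }
    have h := L.toContinuousLinearMap.integral_comp_comm (g.integrable_star_mul f)
    rw [show star (∫ z, star (g (slicePt i z)) * f (slicePt i z) ∂(areaMeasure α)) =
      L.toContinuousLinearMap (∫ z, star (g (slicePt i z)) * f (slicePt i z) ∂(areaMeasure α))
      from rfl, ← h]
    refine integral_congr_ae (Filter.Eventually.of_forall fun z => ?_)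
    change star (star (g (slicePt i z)) * f (slicePt i z)) = _
    rw [star_mul, star_star]

/-! ### The operator `J f = ext(i f_i)` -/

/-- The three quaternionic units `e₁, e₂, e₃`. -/
def stdUnit : Fin 3 → ℍ := ![⟨0, 1, 0, 0⟩, ⟨0, 0, 1, 0⟩, ⟨0, 0, 0, 1⟩]

theorem stdUnit_re (m : Fin 3) : (stdUnit m).re = 0 := by fin_cases m <;> rfl

theorem stdUnit_imI (m : Fin 3) : (stdUnit m).imI = if m = 0 then 1 else 0 := by
  fin_cases m <;> rfl

theorem stdUnit_imJ (m : Fin 3) : (stdUnit m).imJ = if m = 1 then 1 else 0 := by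
  fin_cases m <;> rfl

theorem stdUnit_imK (m : Fin 3) : (stdUnit m).imK = if m = 2 then 1 else 0 := by
  fin_cases m <;> rfl

/-- An auxiliary expression for `ext(i f_i)` from which its differentiability can be read off. -/
def auxJ (i : ImagUnit) (f : ℍ → ℍ) (x : ℍ) : ℍ :=
  let r : Fin 3 → ℍ := fun m => f (star (stdUnit m) * x * stdUnit m)
  let a : ℍ := (4⁻¹ : ℝ) • (f x + (r 0 + r 1 + r 2))
  i * a - ∑ m, stdUnit m * i * stdUnit m * ((2⁻¹ : ℝ) • ((f x - a) + (r m - a)))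

theorem star_stdUnit_mul (m : Fin 3) : star (stdUnit m) * stdUnit m = 1 := by
  fin_cases m <;> ext <;> simp [stdUnit_re, stdUnit_imI, stdUnit_imJ, stdUnit_imK]

theorem norm_stdUnit (m : Fin 3) : ‖stdUnit m‖ = 1 := by
  have h : ‖star (stdUnit m) * stdUnit m‖ = 1 := by rw [star_stdUnit_mul, norm_one]
  rw [norm_mul, Quaternion.norm_star] at h
  nlinarith [norm_nonneg (stdUnit m)]

/-- Rotated imaginary units. -/
def rotUnit (m : Fin 3) (j : ImagUnit) : ImagUnit :=
  ⟨star (stdUnit m) * j * stdUnit m, by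
    have := j.2.1
    fin_cases m <;> simp [stdUnit_re, stdUnit_imI, stdUnit_imJ, stdUnit_imK, this], by
    rw [norm_mul, norm_mul, Quaternion.norm_star, norm_stdUnit, j.2.2]; norm_num⟩

theorem slicePt_rotUnit (m : Fin 3) (j : ImagUnit) (z : ℂ) :
    slicePt (rotUnit m j) z = star (stdUnit m) * slicePt j z * stdUnit m := by
  simp only [slicePt, rotUnit, mul_add, add_mul]
  rw [Quaternion.mul_coe_eq_smul, Quaternion.mul_coe_eq_smul, Quaternion.mul_coe_eq_smul,
    smul_mul_assoc, star_stdUnit_mul, mul_smul_comm, smul_mul_assoc]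
  congr 1
  rw [← Quaternion.coe_mul_eq_smul, mul_one]

theorem auxJ_apply (i : ImagUnit) (f : ℍ → ℍ) (j : ImagUnit) (z : ℂ) (a b : ℍ)
    (h : ∀ j : ImagUnit, f (slicePt j z) = a + j * b) :
    auxJ i f (slicePt j z) = i * a + j * (i * b) := by
  have h0 := j.2.1
  have hi := i.2.1
  simp only [auxJ, ← slicePt_rotUnit, h, Fin.sum_univ_three]
  have e1 : (j : ℍ) + (rotUnit 0 j + rotUnit 1 j + rotUnit 2 j) = 0 := by
    ext <;> simp [rotUnit, stdUnit_re, stdUnit_imI, stdUnit_imJ, stdUnit_imK, h0]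
  have e2 : (4⁻¹ : ℝ) • (a + ↑j * b + (a + ↑(rotUnit 0 j) * b + (a + ↑(rotUnit 1 j) * b) +
      (a + ↑(rotUnit 2 j) * b))) = a := by
    have : a + ↑j * b + (a + ↑(rotUnit 0 j) * b + (a + ↑(rotUnit 1 j) * b) +
      (a + ↑(rotUnit 2 j) * b)) =
      (4 : ℝ) • a + ((j : ℍ) + (rotUnit 0 j + rotUnit 1 j + rotUnit 2 j)) * b := by
      have : (4 : ℝ) • a = a + a + a + a := by module
      rw [this]; noncomm_ring
    rw [this, e1, zero_mul, add_zero, smul_smul]; norm_num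
  rw [e2]
  simp only [add_sub_cancel_left, ← add_mul, ← smul_mul_assoc, ← mul_assoc]
  rw [sub_eq_add_neg, ← neg_mul]
  congr 2
  ext <;> simp [rotUnit, stdUnit_re, stdUnit_imI, stdUnit_imJ, stdUnit_imK, h0, hi] <;> ring

theorem sliceExt_apply (i : ImagUnit) (f : ℍ → ℍ) (x : ℍ) (a b : ℍ)
    (h : f (slicePt i (sliceCoord x)) = a + i * b)
    (h' : f (slicePt i (star (sliceCoord x))) = a + i * (-b)) :
    sliceExt i (fun z => i * f (slicePt i z)) x = i * a + unitOf i x * (i * b) := by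
  have hi : (i : ℍ) * i = -1 := by
    have h0 := i.2.1
    have h1 : normSq (i : ℍ) = 1 := by rw [normSq_eq_norm_mul_self, i.2.2, one_mul]
    rw [normSq_def', h0] at h1
    ext <;> simp [h0]
    · linear_combination -h1
    all_goals ring
  have h2 : (i : ℍ) * (a + i * b) = i * a - b := by
    rw [mul_add, ← mul_assoc, hi]; noncomm_ring
  have h3 : (i : ℍ) * (a + i * (-b)) = i * a + b := by
    rw [mul_add, ← mul_assoc, hi]; noncomm_ring
  simp only [sliceExt, h, h', h2, h3, ← smul_add]
  have : (1 - (unitOf i x : ℍ) * i) * (i * a - b) + (1 + (unitOf i x : ℍ) * i) * (i * a + b) =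
      (2 : ℝ) • (i * a + unitOf i x * (i * b)) := by
    rw [two_smul]; noncomm_ring
  rw [this, smul_smul]; norm_num

/-- The function `J f = ext(i f_i)` on `𝔻`, extended by zero. -/
def multFun (i : ImagUnit) (f : ℍ → ℍ) : ℍ → ℍ :=
  unitBall.indicator (sliceExt i fun z => i * f (slicePt i z))

theorem multFun_apply {f : ℍ → ℍ} {a b : ℝ → ℝ → ℍ} (i : ImagUnit)
    (h : ∀ (j : ImagUnit) (x y : ℝ), slicePt j ⟨x, y⟩ ∈ unitBall →
      f (slicePt j ⟨x, y⟩) = a x y + j * b x y ∧ a x (-y) = a x y ∧ b x (-y) = -b x y)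
    {x : ℍ} (hx : x ∈ unitBall) : multFun i f x = auxJ i f x := by
  rw [multFun, Set.indicator_of_mem hx]
  set z := sliceCoord x with hz
  have hz1 : ‖z‖ < 1 := by rw [← slicePt_unitOf i x] at hx; exact (slicePt_mem _ _).1 hx
  have hz2 : ‖star z‖ < 1 := by simpa using hz1
  have h1 := h i z.re z.im ((slicePt_mem i z).2 hz1)
  have h2 := (h i z.re (-z.im) ((slicePt_mem i (star z)).2 hz2)).1
  rw [h1.2.1, h1.2.2] at h2
  rw [sliceExt_apply i f x _ _ h1.1 h2]
  conv_rhs => rw [← slicePt_unitOf i x]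
  exact (auxJ_apply i f _ _ _ _ fun j => (h j z.re z.im ((slicePt_mem j z).2 hz1)).1).symm

theorem multFun_slice {f : ℍ → ℍ} (i : ImagUnit) (hf : IsLeftSliceHyperholomorphicOn f unitBall)
    {z : ℂ} (hz : ‖z‖ < 1) : multFun i f (slicePt i z) = i * f (slicePt i z) := by
  obtain ⟨_, a, b, h⟩ := hf
  have h' := fun (j : ImagUnit) (x y : ℝ) hxy => (⟨(h j x y hxy).1, (h j x y hxy).2.1,
    (h j x y hxy).2.2.1⟩ : _ ∧ a x (-y) = a x y ∧ b x (-y) = -b x y)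
  have h1 := fun j : ImagUnit => (h j z.re z.im ((slicePt_mem j z).2 hz)).1
  rw [multFun_apply i h' ((slicePt_mem i z).2 hz), auxJ_apply i f i z _ _ h1, ← mul_add]
  rw [← h1 i]

theorem multFun_isSlice {f : ℍ → ℍ} (i : ImagUnit)
    (hf : IsLeftSliceHyperholomorphicOn f unitBall) :
    IsLeftSliceHyperholomorphicOn (multFun i f) unitBall := by
  obtain ⟨hd, a, b, h⟩ := hf
  have h' := fun (j : ImagUnit) (x y : ℝ) hxy => (⟨(h j x y hxy).1, (h j x y hxy).2.1,
    (h j x y hxy).2.2.1⟩ : _ ∧ a x (-y) = a x y ∧ b x (-y) = -b x y)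
  refine ⟨DifferentiableOn.congr (f := auxJ i f) ?_ fun x hx => multFun_apply i h' hx,
    fun x y => i * a x y, fun x y => i * b x y, fun j x y hxy => ?_⟩
  · have hr : ∀ m, DifferentiableOn ℝ (fun x => f (star (stdUnit m) * x * stdUnit m))
        unitBall := fun m => by
      refine hd.comp (by fun_prop) fun x hx => ?_
      simp only [unitBall, Metric.mem_ball, dist_zero_right] at hx ⊢
      rwa [norm_mul, norm_mul, Quaternion.norm_star, norm_stdUnit, one_mul, mul_one]
    have ha := (hd.add (((hr 0).add (hr 1)).add (hr 2))).const_smul (4⁻¹ : ℝ)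
    exact (ha.const_mul (i : ℍ)).sub (DifferentiableOn.fun_sum fun m _ =>
      (((hd.sub ha).add ((hr m).sub ha)).const_smul (2⁻¹ : ℝ)).const_mul
        (stdUnit m * i * stdUnit m))
  · obtain ⟨_, h2, h3, c, d, h4, h5, h6, h7⟩ := h j x y hxy
    have hz := (slicePt_mem j ⟨x, y⟩).1 hxy
    refine ⟨?_, by simp only [h2], by simp only [h3, mul_neg], i * c, i * d, h4.const_mul _,
      h5.const_mul _, h6.const_mul _, ?_⟩
    · rw [multFun_apply i h' hxy]
      exact auxJ_apply i f j _ _ _ fun k => (h k x y ((slicePt_mem k _).2 hz)).1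
    · rw [← mul_neg]; exact h7.const_mul _

theorem Bergman.multFun_ae (f : Bergman hα i) :
    (fun z => (i : ℍ) * f (slicePt i z)) =ᵐ[areaMeasure α] fun z => multFun i f (slicePt i z) := by
  unfold areaMeasure
  refine (withDensity_absolutelyContinuous _ _).ae_le ?_
  filter_upwards [ae_restrict_mem Metric.isOpen_ball.measurableSet] with z hz
  exact (multFun_slice i f.slice (by simpa using hz)).symm

/-- The function `J f` as an element of the Bergman space. -/
def Bergman.mult (f : Bergman hα i) : Bergman hα i :=
  ⟨multFun i f, multFun_isSlice i f.slice, fun _ hx => Set.indicator_of_notMem hx _,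
    (memLp_congr_ae f.multFun_ae).1 (f.memLp.const_mul (i : ℍ))⟩

theorem Bergman.norm_mult (f : Bergman hα i) : ‖f.mult‖ = ‖f‖ := by
  rw [← sq_eq_sq₀ (norm_nonneg _) (norm_nonneg _), ← Bergman.integral_normSq,
    ← Bergman.integral_normSq]
  refine integral_congr_ae ?_
  filter_upwards [f.multFun_ae] with z hz
  change ‖multFun i f (slicePt i z)‖ ^ 2 = _
  rw [← hz, norm_mul, i.2.2, one_mul]

/-- The unitary and anti-selfadjoint operator `J f = ext(i f_i)` on `A²_{α,i}(𝔻)`. -/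
def bergmanJ (hα : -1 < α) (i : ImagUnit) : Bergman hα i →L[ℍᵐᵒᵖ] Bergman hα i :=
  LinearMap.mkContinuous
    { toFun := Bergman.mult
      map_add' := fun f g => Bergman.ext fun x => by
        change multFun i (f.1 + g.1) x = multFun i f x + multFun i g x
        by_cases hx : x ∈ unitBall
        · simp only [multFun, Set.indicator_of_mem hx, sliceExt, Pi.add_apply, mul_add, smul_add]
          abel
        · simp only [multFun, Set.indicator_of_notMem hx, add_zero]
      map_smul' := fun q f => Bergman.ext fun x => by
        change multFun i (q • f.1) x = multFun i f x * q.unop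
        by_cases hx : x ∈ unitBall
        · simp only [multFun, Set.indicator_of_mem hx, sliceExt, Pi.smul_apply,
            MulOpposite.smul_eq_mul_unop, add_mul, smul_mul_assoc, mul_assoc]
        · simp only [multFun, Set.indicator_of_notMem hx, zero_mul] }
    1 fun f => by
      rw [one_mul]; exact f.norm_mult.le

/-! ### The Berezin transform -/

open Classical in
/-- The reproducing kernel `K_w` at `w ∈ 𝔻`: the (unique) element of `A²_{α,i}(𝔻)` with
`f(w) = ⟨K_w, f⟩` for all `f`. -/
def bergmanKernel (hα : -1 < α) (i : ImagUnit) (w : ℍ) : Bergman hα i :=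
  if h : ∃ K : Bergman hα i, ∀ f : Bergman hα i, f w = qinner K f then h.choose else 0

/-- The normalized reproducing kernel `k_w = K_w / √K(w, w)`, where `K(q, w) = K_w(q)`. -/
def normalizedKernel (hα : -1 < α) (i : ImagUnit) (w : ℍ) : Bergman hα i :=
  MulOpposite.op (((√(bergmanKernel hα i w w).re)⁻¹ : ℝ) : ℍ) • bergmanKernel hα i w

/-- The Berezin transform `T̃(w) = ⟨k_w, T k_w⟩`, for `w = slicePt i z ∈ 𝔻_i`. -/
def berezin (T : Bergman hα i →L[ℍᵐᵒᵖ] Bergman hα i) (z : ℂ) : ℍ :=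
  qinner (normalizedKernel hα i (slicePt i z)) (T (normalizedKernel hα i (slicePt i z)))

end Bergman

end SliceBergman

end

/-! Write `K_z` for the reproducing kernel and `kernelForm T z` for `⟨K_z, T K_z⟩`. Since `K_z(z) =
(1 - |z|²)^(-(α+2))`, the Berezin transform is `(1 - |z|²)^(α+2)` times the kernel form. Integrating
it against `(α+1) dμ` is therefore the same as integrating the kernel form against `dA_α`, and both
claims become claims about that integral.

Trace class implies integrable. The singular value expansion makes `T` nuclear: `T = ∑ uₙ ⟨vₙ, ·⟩`
with `∑ ‖uₙ‖ ‖vₙ‖ < ∞`. By the reproducing property the kernel form is `∑ uₙ(z) conj(vₙ(z))`, which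
can be integrated term by term (`integrable_kernelForm`). Quaternions do not commute, but `Re(pq) =
Re(qp)`, so the real part of the integral is `∑ Re⟨vₙ, uₙ⟩`. The same number is the sum of `Re⟨e, T
e⟩` over any orthonormal basis (`QOrthonormal.hasSum_re_qinner`).

Trace formula. An orthonormal basis of `H₊` is an orthonormal basis of the whole space, and on `H₊`
the numbers `⟨e, T e⟩` lie in `ℂ_i`. An element `t` of `ℂ_i` is recovered from `Re t` and `Re(t i)`,
and `⟨e, T e⟩ i = ⟨e, T J e⟩`. Applying the real identity to both `T` and `T J` gives the full trace
(`hasTrace_of_nuclear`). The integral side obeys the same rules because `K_z` lies in `H₊` for `z ∈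
𝔻_i`.

Integrable implies trace class, for positive `T`. Let `p` be the orthogonal projection of `K_z` to
the span of a finite orthonormal family `eₙ`, and `S = ∑ ⟨eₙ, T eₙ⟩`. Positivity of `T` at `K_z - p`
gives `2 Re⟨K_z, T p⟩ ≤ Re⟨p, T p⟩ + Re⟨K_z, T K_z⟩`, and integration turns this into `2S ≤ S + ∫
Re⟨K_z, T K_z⟩` (`IsPositive.sum_re_le`). For the monomial basis the bound makes `T`
Hilbert–Schmidt, hence compact. Splitting off top eigenvectors one at a time then diagonalises `T`,
and the bound on these eigenvectors makes the eigenvalues summable.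

The kernel is computed from the monomials. They are orthogonal by rotation invariance, and their
squared norms are inverse binomial coefficients. -/

noncomputable section
namespace SliceBergman

open QuaternionicInner Filter Topology
open MulOpposite (op)

/-! ### Geometry of quaternionic right Hilbert spaces -/

section Geometry

variable {H : Type*} [NormedAddCommGroup H] [Module ℍᵐᵒᵖ H] [QuaternionicInner H]

theorem qinner_add_left (x y z : H) : qinner (x + y) z = qinner x z + qinner y z := by
  rw [← star_qinner, qinner_add_right, star_add, star_qinner, star_qinner]

theorem qinner_smul_left (x y : H) (a : ℍ) : qinner (op a • x) y = star a * qinner x y := by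
  rw [← star_qinner, qinner_smul_right, star_mul, star_qinner]

theorem re_qinner_comm (x y : H) : (qinner x y).re = (qinner y x).re := by
  rw [← star_qinner, Quaternion.re_star]

/-- The module structure comes with no norm axiom; multiplicativity of the norm is forced by the
scalar product. -/
theorem norm_op_smul (a : ℍ) (x : H) : ‖op a • x‖ = ‖a‖ * ‖x‖ := by
  have h := qinner_self (op a • x)
  rw [qinner_smul_left, qinner_smul_right, qinner_self, Quaternion.coe_mul_eq_smul,
    mul_smul_comm, Quaternion.star_mul_self, normSq_eq_norm_mul_self, ← Quaternion.coe_mul_eq_smul,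
    ← Quaternion.coe_mul, Quaternion.coe_inj] at h
  rw [← sq_eq_sq₀ (norm_nonneg _) (by positivity)]
  linear_combination -h

/-- The real Hilbert space underlying a quaternionic right Hilbert space. -/
abbrev realInnerProductSpace (H : Type*) [NormedAddCommGroup H] [Module ℍᵐᵒᵖ H]
    [QuaternionicInner H] : InnerProductSpace ℝ H where
  smul r x := op (r : ℍ) • x
  mul_smul r s x := by
    change op ((r * s : ℝ) : ℍ) • x = op (r : ℍ) • op (s : ℍ) • x
    rw [smul_smul, ← MulOpposite.op_mul, ← Quaternion.coe_mul, mul_comm]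
  one_smul x := one_smul ℍᵐᵒᵖ x
  smul_zero r := smul_zero (op (r : ℍ))
  smul_add r x y := smul_add (op (r : ℍ)) x y
  add_smul r s x := by
    change op ((r + s : ℝ) : ℍ) • x = op (r : ℍ) • x + op (s : ℍ) • x
    rw [Quaternion.coe_add, MulOpposite.op_add, add_smul]
  zero_smul x := zero_smul ℍᵐᵒᵖ x
  norm_smul_le r x := by
    change ‖op (r : ℍ) • x‖ ≤ _
    rw [norm_op_smul, Quaternion.norm_coe]
  inner x y := (qinner x y).re
  norm_sq_eq_re_inner x := by rw [qinner_self]; rfl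
  conj_inner_symm x y := re_qinner_comm y x
  add_left x y z := by rw [qinner_add_left, Quaternion.re_add]
  smul_left x y r := by
    change (qinner (op (r : ℍ) • x) y).re = r * (qinner x y).re
    rw [qinner_smul_left, Quaternion.star_coe, Quaternion.coe_mul_eq_smul, Quaternion.re_smul,
      smul_eq_mul]

attribute [local instance] realInnerProductSpace

theorem real_smul_def (r : ℝ) (x : H) : r • x = op (r : ℍ) • x := rfl

theorem real_inner_def (x y : H) : inner ℝ x y = (qinner x y).re := rfl

theorem re_qinner_self (x : H) : (qinner x x).re = ‖x‖ ^ 2 := by rw [qinner_self]; rfl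

theorem qinner_self_eq_one {x : H} : qinner x x = 1 ↔ ‖x‖ = 1 := by
  rw [qinner_self, ← Quaternion.coe_one, Quaternion.coe_inj]
  constructor
  · intro h; nlinarith [norm_nonneg x]
  · intro h; rw [h]; norm_num

theorem norm_qinner_le (x y : H) : ‖qinner x y‖ ≤ ‖x‖ * ‖y‖ := by
  by_cases h : qinner x y = 0
  · rw [h, norm_zero]; positivity
  -- The scalar `star ⟨x, y⟩` rotates the quaternion `⟨x, y⟩` to the real number `‖⟨x, y⟩‖²`, so the
  -- real Cauchy–Schwarz inequality suffices.
  have h1 := real_inner_le_norm x (op (star (qinner x y)) • y)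
  rw [real_inner_def, qinner_smul_right, norm_op_smul, Quaternion.norm_star,
    Quaternion.self_mul_star, normSq_eq_norm_mul_self, Quaternion.re_coe] at h1
  have h2 : 0 < ‖qinner x y‖ := norm_pos_iff.2 h
  nlinarith

/-- The real part of a quaternion as a continuous real linear map. -/
def reL : ℍ →L[ℝ] ℝ := innerSL ℝ (1 : ℍ)

@[simp] theorem reL_apply (q : ℍ) : reL q = q.re := by
  simp [reL, Quaternion.inner_def]

theorem abs_re_le_norm (q : ℍ) : |q.re| ≤ ‖q‖ := by
  have := abs_real_inner_le_norm q (1 : ℍ)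
  simpa [Quaternion.inner_def] using this

theorem re_sum {ι : Type*} (s : Finset ι) (f : ι → ℍ) :
    (∑ n ∈ s, f n).re = ∑ n ∈ s, (f n).re := by
  simp only [← reL_apply, map_sum]

/-- `y ↦ ⟨x, y⟩` as a continuous real linear map. -/
def qinnerL (x : H) : H →L[ℝ] ℍ :=
  LinearMap.mkContinuous
    { toFun := qinner x
      map_add' := qinner_add_right x
      map_smul' := fun r y => by
        rw [real_smul_def, qinner_smul_right, Quaternion.mul_coe_eq_smul]; rfl } ‖x‖
    (norm_qinner_le x)

@[simp] theorem qinnerL_apply (x y : H) : qinnerL x y = qinner x y := rfl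

@[simp] theorem qinner_zero_right (x : H) : qinner x 0 = 0 := map_zero (qinnerL x)

@[simp] theorem qinner_zero_left (x : H) : qinner 0 x = 0 := by
  rw [← star_qinner, qinner_zero_right, star_zero]

theorem qinner_neg_right (x y : H) : qinner x (-y) = -qinner x y := map_neg (qinnerL x) y

theorem qinner_neg_left (x y : H) : qinner (-x) y = -qinner x y := by
  rw [← star_qinner, qinner_neg_right, star_neg, star_qinner]

theorem qinner_sub_right (x y z : H) : qinner x (y - z) = qinner x y - qinner x z :=
  map_sub (qinnerL x) y z

theorem qinner_sub_left (x y z : H) : qinner (x - y) z = qinner x z - qinner y z := by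
  rw [← star_qinner, qinner_sub_right, star_sub, star_qinner, star_qinner]

theorem qinner_sum_right {ι : Type*} (s : Finset ι) (x : H) (f : ι → H) :
    qinner x (∑ n ∈ s, f n) = ∑ n ∈ s, qinner x (f n) := map_sum (qinnerL x) f s

theorem qinner_sum_left {ι : Type*} (s : Finset ι) (x : H) (f : ι → H) :
    qinner (∑ n ∈ s, f n) x = ∑ n ∈ s, qinner (f n) x := by
  rw [← star_qinner, qinner_sum_right, star_sum]
  simp only [star_qinner]

/-- `a ↦ x a` as a continuous real linear map. -/
def opSMulL (x : H) : ℍ →L[ℝ] H :=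
  LinearMap.mkContinuous
    { toFun := fun a => op a • x
      map_add' := fun a b => by rw [MulOpposite.op_add, add_smul]
      map_smul' := fun r a => by
        change op (r • a) • x = op (r : ℍ) • op a • x
        rw [smul_smul, ← MulOpposite.op_mul, Quaternion.mul_coe_eq_smul] } ‖x‖
    fun a => by
      change ‖op a • x‖ ≤ _
      rw [norm_op_smul, mul_comm]

/-- The right linear operator `x ↦ u ⟨v, x⟩`. -/
def rankOne (u v : H) : H →L[ℍᵐᵒᵖ] H :=
  { toFun := fun x => op (qinner v x) • u
    map_add' := fun x y => by rw [qinner_add_right, MulOpposite.op_add, add_smul]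
    map_smul' := fun q x => by
      have := qinner_smul_right v x q.unop
      rw [MulOpposite.op_unop] at this
      rw [this, MulOpposite.op_mul, mul_smul]; rfl
    cont := ((opSMulL u).comp (qinnerL v)).continuous }

/-- The real linear operator underlying a right linear operator. -/
def toReal (T : H →L[ℍᵐᵒᵖ] H) : H →L[ℝ] H :=
  { toFun := T
    map_add' := map_add T
    map_smul' := fun r x => map_smul T (op (r : ℍ)) x
    cont := T.continuous }

@[simp] theorem toReal_apply (T : H →L[ℍᵐᵒᵖ] H) (x : H) : toReal T x = T x := rfl

/-- The operator factors through the locally compact space `ℍ`. -/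
theorem isCompactOperator_rankOne (u v : H) : IsCompactOperator (rankOne u v) :=
  (isCompactOperator_of_locallyCompactSpace_dom (qinnerL v)).clm_comp (opSMulL u)

end Geometry

/-! ### Positive operators and singular values -/

section Positive

variable {H : Type*} [NormedAddCommGroup H] [Module ℍᵐᵒᵖ H] [QuaternionicInner H]

attribute [local instance] realInnerProductSpace

/-- Polarisation: `⟨x + y a, T(x + y a)⟩` is real for every `a`. Taking `a = 1` makes the imaginary
parts of `⟨x, T y⟩` and `⟨y, T x⟩` opposite, and `a = e₁` makes the real parts equal. -/
theorem IsPositive.selfAdjoint {T : H →L[ℍᵐᵒᵖ] H} (hT : IsPositive T) (x y : H) :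
    qinner (T x) y = qinner x (T y) := by
  have key : ∀ a : ℍ, star (qinner x (T y) * a + star a * qinner y (T x)) =
      qinner x (T y) * a + star a * qinner y (T x) := fun a => by
    obtain ⟨r, -, hr⟩ := hT (x + op a • y)
    obtain ⟨r1, -, hr1⟩ := hT x
    obtain ⟨r2, -, hr2⟩ := hT (op a • y)
    rw [map_add, qinner_add_left, qinner_add_right, qinner_add_right, hr1, hr2, map_smul,
      qinner_smul_right, qinner_smul_left] at hr
    have : qinner x (T y) * a + star a * qinner y (T x) = ((r - r1 - r2 : ℝ) : ℍ) := by
      push_cast; rw [← hr]; abel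
    rw [this, Quaternion.star_coe]
  have h1 := key 1
  have h2 := key (stdUnit 0)
  rw [← star_qinner]
  generalize qinner x (T y) = p at *
  generalize qinner y (T x) = q at *
  rw [Quaternion.ext_iff] at h1 h2
  simp [stdUnit_re, stdUnit_imI, stdUnit_imJ, stdUnit_imK] at h1 h2
  ext <;> simp <;> linarith [h1.1, h1.2.1, h1.2.2, h2.1, h2.2.1, h2.2.2]

theorem IsPositive.re_nonneg {T : H →L[ℍᵐᵒᵖ] H} (hT : IsPositive T) (x : H) :
    0 ≤ (qinner x (T x)).re := by
  obtain ⟨r, h0, hr⟩ := hT x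
  rw [hr]; exact h0

/-- The Cauchy–Schwarz inequality for the form `⟨x, T y⟩` of a positive operator. -/
theorem IsPositive.sq_re_le {T : H →L[ℍᵐᵒᵖ] H} (hT : IsPositive T) (x y : H) :
    (qinner x (T y)).re ^ 2 ≤ (qinner x (T x)).re * (qinner y (T y)).re := by
  have h : ∀ t : ℝ, 0 ≤ (qinner y (T y)).re * (t * t) + 2 * (qinner x (T y)).re * t +
      (qinner x (T x)).re := fun t => by
    have h1 := hT.re_nonneg (x + op (t : ℍ) • y)
    have h2 : (qinner y (T x)).re = (qinner x (T y)).re := by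
      rw [re_qinner_comm, hT.selfAdjoint]
    simp only [map_add, map_smul, qinner_add_left, qinner_add_right, qinner_smul_right,
      qinner_smul_left, Quaternion.star_coe, Quaternion.mul_coe_eq_smul,
      Quaternion.coe_mul_eq_smul, Quaternion.re_add, Quaternion.re_smul, h2, smul_eq_mul] at h1
    linarith
  have := discrim_le_zero h
  unfold discrim at this
  nlinarith

theorem IsPositive.isAbs {T : H →L[ℍᵐᵒᵖ] H} (hT : IsPositive T) : IsAbs T T :=
  ⟨hT, T, hT.selfAdjoint, fun _ => rfl⟩

/-- `‖P x‖² = ⟨x, P² x⟩ = ⟨x, T* T x⟩ = ‖T x‖²`. This takes the place of the polar decomposition: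
convergence statements pass from `|T|` to `T`. -/
theorem IsAbs.norm_eq {P T : H →L[ℍᵐᵒᵖ] H} (h : IsAbs P T) (x : H) : ‖P x‖ = ‖T x‖ := by
  obtain ⟨hP, A, hA, hPA⟩ := h
  rw [← sq_eq_sq₀ (norm_nonneg _) (norm_nonneg _), ← re_qinner_self, ← re_qinner_self,
    hP.selfAdjoint, hPA, re_qinner_comm, hA]

/-- An operator with singular values `s n` is a sum of operators of rank one of norm at most
`s n`. -/
theorem IsSingularValueSeq.exists_hasSum {T : H →L[ℍᵐᵒᵖ] H} {s : ℕ → ℝ}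
    (h : IsSingularValueSeq T s) :
    ∃ u v : ℕ → H, (∀ n, ‖u n‖ ≤ s n) ∧ (∀ n, ‖v n‖ ≤ 1) ∧
      ∀ x, HasSum (fun n => op (qinner (v n) x) • u n) (T x) := by
  obtain ⟨-, h0, P, hP, e, he, hs⟩ := h
  have hPe : ∀ n, s n ≠ 0 → P (e n) = op (s n : ℍ) • e n := fun n hn => by
    refine (hs (e n)).unique ?_
    have : op (s n : ℍ) • e n = op ((s n : ℍ) * qinner (e n) (e n)) • e n := by
      rw [he n n hn hn, if_pos rfl, mul_one]
    rw [this]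
    refine hasSum_single n fun m hm => ?_
    by_cases hm0 : s m = 0
    · simp [hm0]
    · rw [he m n hm0 hn, if_neg hm, mul_zero, MulOpposite.op_zero, zero_smul]
  -- The vectors `eₙ` with `sₙ = 0` are unconstrained, so these terms are replaced by zero; the
  -- others are `uₙ = T eₙ`, `vₙ = eₙ`.
  refine ⟨fun n => if s n = 0 then 0 else T (e n), fun n => if s n = 0 then 0 else e n,
    fun n => ?_, fun n => ?_, fun x => ?_⟩
  · dsimp only
    split_ifs with hn
    · rw [norm_zero, hn]
    · have h1 := he n n hn hn
      rw [if_pos rfl, qinner_self_eq_one] at h1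
      rw [← hP.norm_eq, hPe n hn, norm_op_smul, h1, mul_one, Quaternion.norm_coe,
        Real.norm_of_nonneg (h0 n)]
  · dsimp only
    split_ifs with hn
    · rw [norm_zero]; exact zero_le_one
    · have h1 := he n n hn hn
      rw [if_pos rfl, qinner_self_eq_one] at h1
      exact h1.le
  · set F : ℕ → H := fun n => if s n = 0 then 0 else op (qinner (e n) x) • e n with hF
    have e1 : ∀ n, op ((s n : ℍ) * qinner (e n) x) • e n = P (F n) := fun n => by
      simp only [hF]
      split_ifs with hn
      · simp [hn]
      · rw [map_smul, hPe n hn, smul_smul, ← MulOpposite.op_mul]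
    have e2 : ∀ n, op (qinner (if s n = 0 then 0 else e n) x) •
        (if s n = 0 then 0 else T (e n)) = T (F n) := fun n => by
      simp only [hF]
      split_ifs with hn
      · simp
      · rw [map_smul]
    -- The partial sums of `F` need not converge to `x`, but their images under `P` converge to `P
    -- x`. As `P` and `T` have equal norms on every vector, their images under `T` converge to `T
    -- x`.
    have h1 := hs x
    simp only [e1] at h1
    simp only [e2]
    unfold HasSum at h1 ⊢
    simp only [← map_sum] at h1 ⊢
    rw [tendsto_iff_norm_sub_tendsto_zero] at h1 ⊢
    refine h1.congr fun t => ?_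
    rw [← map_sub, ← map_sub, hP.norm_eq]

/-- Cauchy–Schwarz for the form of `T` at the pair `T x`, `x` reads `‖T x‖⁴ ≤ ⟨T x, T T x⟩ ⟨x, T
x⟩`, and the first factor is at most `c ‖T x‖²`. -/
theorem IsPositive.norm_sq_le {T : H →L[ℍᵐᵒᵖ] H} (hT : IsPositive T) {c : ℝ}
    (hc : ∀ x, (qinner x (T x)).re ≤ c * ‖x‖ ^ 2) (x : H) :
    ‖T x‖ ^ 2 ≤ c * (qinner x (T x)).re := by
  have h1 := hT.sq_re_le (T x) x
  rw [re_qinner_self] at h1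
  have h2 := hc (T x)
  have h3 := hT.re_nonneg x
  by_cases h4 : ‖T x‖ = 0
  · have : qinner x (T x) = 0 := by rw [norm_eq_zero.1 h4, qinner_zero_right]
    rw [h4, this]; simp
  · have h5 : 0 < ‖T x‖ ^ 2 := by positivity
    nlinarith

theorem IsPositive.norm_le {T : H →L[ℍᵐᵒᵖ] H} (hT : IsPositive T) {c : ℝ} (hc0 : 0 ≤ c)
    (hc : ∀ x, (qinner x (T x)).re ≤ c * ‖x‖ ^ 2) (x : H) : ‖T x‖ ≤ c * ‖x‖ := by
  have h1 := hT.norm_sq_le hc x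
  have h2 := hc x
  refine abs_le_of_sq_le_sq' ?_ (by positivity) |>.2
  nlinarith

/-- A compact positive operator has a largest eigenvalue, which is its norm. -/
theorem IsPositive.exists_eigenvector {T : H →L[ℍᵐᵒᵖ] H} (hT : IsPositive T)
    (hc : IsCompactOperator T) :
    ∃ (e : H) (c : ℝ), 0 ≤ c ∧ (c ≠ 0 → ‖e‖ = 1) ∧ (c = 0 → e = 0) ∧ T e = op (c : ℍ) • e ∧
      ∀ x, ‖T x‖ ≤ c * ‖x‖ := by
  -- The eigenvalue sought is the supremum of the quadratic form over the closed unit ball; it is at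
  -- least `0` because the centre belongs to the ball.
  set S : Set ℝ := (fun x => (qinner x (T x)).re) '' Metric.closedBall 0 1 with hS
  have hb : BddAbove S := by
    refine ⟨‖toReal T‖, ?_⟩
    rintro _ ⟨x, hx, rfl⟩
    have hx1 : ‖x‖ ≤ 1 := by simpa using hx
    have h1 := real_inner_le_norm x (T x)
    have h2 := (toReal T).le_opNorm x
    rw [toReal_apply] at h2
    rw [real_inner_def] at h1
    have h3 := norm_nonneg (T x)
    have h4 := norm_nonneg (toReal T)
    have h5 := norm_nonneg x
    change (qinner x (T x)).re ≤ _
    nlinarith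
  have hne : S.Nonempty := ⟨_, 0, by simp, rfl⟩
  have h0 : (0 : ℝ) ∈ S := ⟨0, by simp, by simp⟩
  set c := sSup S with hcdef
  have hc0 : 0 ≤ c := le_csSup hb h0
  have hQ : ∀ x, (qinner x (T x)).re ≤ c * ‖x‖ ^ 2 := fun x => by
    by_cases hx : x = 0
    · simp [hx]
    have hx0 : 0 < ‖x‖ := norm_pos_iff.2 hx
    have h1 : (qinner (op ((‖x‖⁻¹ : ℝ) : ℍ) • x) (T (op ((‖x‖⁻¹ : ℝ) : ℍ) • x))).re ≤ c := by
      refine le_csSup hb ⟨_, ?_, rfl⟩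
      rw [mem_closedBall_zero_iff, norm_op_smul, Quaternion.norm_coe, norm_inv, norm_norm,
        inv_mul_cancel₀ hx0.ne']
    rw [map_smul, qinner_smul_left, qinner_smul_right, Quaternion.star_coe,
      Quaternion.mul_coe_eq_smul, Quaternion.coe_mul_eq_smul, Quaternion.re_smul,
      Quaternion.re_smul, smul_eq_mul, smul_eq_mul, ← mul_assoc, ← sq, inv_pow,
      inv_mul_le_iff₀ (by positivity)] at h1
    linarith
  have hn := hT.norm_le hc0 hQ
  -- If `c = 0` then `T = 0`; the vector `0` is returned, since the space may have no unit vector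
  -- left to offer.
  by_cases hc1 : c = 0
  · refine ⟨0, c, hc0, fun h => absurd hc1 h, fun _ => rfl, by simp, hn⟩
  have hcp : 0 < c := lt_of_le_of_ne hc0 (Ne.symm hc1)
  obtain ⟨q, -, hqt, hqm⟩ := exists_seq_tendsto_sSup hne hb
  choose x hx hxq using hqm
  have hx1 : ∀ k, ‖x k‖ ≤ 1 := fun k => by simpa using hx k
  obtain ⟨K, hK, hKs⟩ := (show IsCompactOperator (toReal T : H →ₗ[ℝ] H) from hc
    ).image_closedBall_subset_compact 1
  obtain ⟨y, -, φ, hφ, hy⟩ := hK.tendsto_subseq (x := fun k => T (x k))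
    fun k => hKs ⟨x k, by simpa using hx1 k, rfl⟩
  -- A maximising sequence consists of approximate eigenvectors: with `q = ⟨x, T x⟩`, `‖T x - c x‖²
  -- ≤ c q - 2 c q + c² = c (c - q)`, which tends to `0`. The factor 2 used below is slack.
  have hd : Tendsto (fun k => T (x k) - c • x k) atTop (𝓝 0) := by
    rw [tendsto_zero_iff_norm_tendsto_zero]
    have h1 : ∀ k, ‖T (x k) - c • x k‖ ^ 2 ≤ 2 * c * (c - q k) := fun k => by
      have h2 := hT.norm_sq_le hQ (x k)
      have h3 : inner ℝ (T (x k)) (x k) = q k := by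
        rw [real_inner_comm, real_inner_def]; exact hxq k
      have h4 : (qinner (x k) (T (x k))).re = q k := hxq k
      rw [norm_sub_sq_real, real_inner_smul_right, h3, norm_smul, Real.norm_of_nonneg hc0]
      rw [h4] at h2
      have h5 : ‖x k‖ ^ 2 ≤ 1 := by nlinarith [hx1 k, norm_nonneg (x k)]
      have h6 : q k ≤ c := by rw [← h4]; nlinarith [hQ (x k)]
      nlinarith [mul_le_mul_of_nonneg_left h5 (sq_nonneg c), mul_le_mul_of_nonneg_left h6 hc0]
    have h2 : Tendsto (fun k => √(2 * c * (c - q k))) atTop (𝓝 0) := by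
      have : Tendsto (fun k => √(2 * c * (c - q k))) atTop (𝓝 √(2 * c * (c - c))) :=
        ((tendsto_const_nhds.sub hqt).const_mul _).sqrt
      simpa using this
    exact squeeze_zero (fun k => norm_nonneg _) (fun k => Real.le_sqrt_of_sq_le (h1 k)) h2
  -- Compactness makes `T x` converge along a subsequence; the previous estimate carries this over
  -- to `c x`, and then to `x` as `c ≠ 0`.
  have hcx : Tendsto (fun k => c • x (φ k)) atTop (𝓝 y) := by
    have := hy.sub (hd.comp hφ.tendsto_atTop)
    simpa using this
  have hxl : Tendsto (fun k => x (φ k)) atTop (𝓝 (c⁻¹ • y)) := by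
    have := hcx.const_smul c⁻¹
    simpa [smul_smul, inv_mul_cancel₀ hc1] using this
  set e := c⁻¹ • y with he
  have hTe : T e = c • e := by
    refine tendsto_nhds_unique ((T.continuous.tendsto e).comp hxl) ?_
    rw [he, smul_smul, mul_inv_cancel₀ hc1, one_smul]
    exact hy
  have hQe : (qinner e (T e)).re = c := by
    have h1 : Tendsto (fun k => inner ℝ (x (φ k)) (T (x (φ k)))) atTop
        (𝓝 (inner ℝ e (T e))) := hxl.inner ((T.continuous.tendsto e).comp hxl)
    refine tendsto_nhds_unique h1 ?_
    refine (hqt.comp hφ.tendsto_atTop).congr fun k => ?_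
    exact (hxq (φ k)).symm
  refine ⟨e, c, hc0, fun _ => ?_, fun h => absurd h hc1, hTe, hn⟩
  have h1 : c * ‖e‖ ^ 2 = c := by
    rw [← real_inner_def, hTe, real_inner_smul_right, real_inner_self_eq_norm_sq] at hQe
    exact hQe
  have h2 : ‖e‖ ^ 2 = 1 := by
    have : c * (‖e‖ ^ 2 - 1) = 0 := by linarith
    rcases mul_eq_zero.1 this with h | h
    · exact absurd h hc1
    · linarith
  nlinarith [norm_nonneg e]

end Positive

/-! ### Diagonalisation of compact positive operators by deflation -/

section Deflation

variable {H : Type*} [NormedAddCommGroup H] [Module ℍᵐᵒᵖ H] [QuaternionicInner H]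

attribute [local instance] realInnerProductSpace

/-- The largest eigenvalue of a compact positive operator. -/
def topValue (T : {T : H →L[ℍᵐᵒᵖ] H // IsPositive T ∧ IsCompactOperator T}) : ℝ :=
  (T.2.1.exists_eigenvector T.2.2).choose_spec.choose

/-- An eigenvector of a compact positive operator for its largest eigenvalue. -/
def topVector (T : {T : H →L[ℍᵐᵒᵖ] H // IsPositive T ∧ IsCompactOperator T}) : H :=
  (T.2.1.exists_eigenvector T.2.2).choose

theorem topVector_spec (T : {T : H →L[ℍᵐᵒᵖ] H // IsPositive T ∧ IsCompactOperator T}) :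
    0 ≤ topValue T ∧ (topValue T ≠ 0 → ‖topVector T‖ = 1) ∧
      (topValue T = 0 → topVector T = 0) ∧
      T.1 (topVector T) = op (topValue T : ℍ) • topVector T ∧
      ∀ x, ‖T.1 x‖ ≤ topValue T * ‖x‖ :=
  (T.2.1.exists_eigenvector T.2.2).choose_spec.choose_spec

theorem qinner_topVector_self
    (T : {T : H →L[ℍᵐᵒᵖ] H // IsPositive T ∧ IsCompactOperator T}) :
    qinner (topVector T) (topVector T) = 1 ∨ topVector T = 0 := by
  by_cases h : topValue T = 0
  · exact Or.inr ((topVector_spec T).2.2.1 h)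
  · exact Or.inl (qinner_self_eq_one.2 ((topVector_spec T).2.1 h))

/-- `T` with the eigenvector `topVector T` removed. -/
def deflateFun (T : {T : H →L[ℍᵐᵒᵖ] H // IsPositive T ∧ IsCompactOperator T}) :
    H →L[ℍᵐᵒᵖ] H :=
  T.1.comp (ContinuousLinearMap.id _ H - rankOne (topVector T) (topVector T))

theorem deflateFun_apply (T : {T : H →L[ℍᵐᵒᵖ] H // IsPositive T ∧ IsCompactOperator T})
    (x : H) :
    deflateFun T x = T.1 (x - op (qinner (topVector T) x) • topVector T) := rfl

/-- With `Q` the projection off the eigenvector `e`, the operator `T Q` equals `Q T Q`: since `e` is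
an eigenvector of the self-adjoint `T`, the vector `T Q x` is again orthogonal to `e`. -/
theorem isPositive_deflateFun
    (T : {T : H →L[ℍᵐᵒᵖ] H // IsPositive T ∧ IsCompactOperator T}) :
    IsPositive (deflateFun T) := by
  obtain ⟨-, -, -, he, -⟩ := topVector_spec T
  intro x
  have h1 := qinner_topVector_self T
  rw [deflateFun_apply]
  set e := topVector T
  set y := x - op (qinner e x) • e with hy
  have h2 : qinner e y = 0 := by
    rw [hy, qinner_sub_right, qinner_smul_right]
    rcases h1 with h1 | h1
    · rw [h1, one_mul, sub_self]
    · rw [h1]; simp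
  have h3 : qinner e (T.1 y) = 0 := by
    rw [← T.2.1.selfAdjoint, he, qinner_smul_left, h2, mul_zero]
  obtain ⟨r, hr0, hr⟩ := T.2.1 y
  refine ⟨r, hr0, ?_⟩
  have h4 : x = y + op (qinner e x) • e := by rw [hy, sub_add_cancel]
  rw [← hr]
  nth_rewrite 1 [h4]
  rw [qinner_add_left, qinner_smul_left, h3, mul_zero, add_zero]

/-- `T` with the eigenvector `topVector T` removed, as a compact positive operator. -/
def deflate (T : {T : H →L[ℍᵐᵒᵖ] H // IsPositive T ∧ IsCompactOperator T}) :
    {T : H →L[ℍᵐᵒᵖ] H // IsPositive T ∧ IsCompactOperator T} :=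
  ⟨deflateFun T, isPositive_deflateFun T, T.2.2.comp_clm _⟩

theorem deflate_apply (T : {T : H →L[ℍᵐᵒᵖ] H // IsPositive T ∧ IsCompactOperator T})
    (x : H) : (deflate T).1 x =
      T.1 x - op ((topValue T : ℍ) * qinner (topVector T) x) • topVector T := by
  obtain ⟨-, -, -, he, -⟩ := topVector_spec T
  change deflateFun T x = _
  rw [deflateFun_apply, map_sub, map_smul, he, smul_smul, ← MulOpposite.op_mul]

theorem deflate_topVector (T : {T : H →L[ℍᵐᵒᵖ] H // IsPositive T ∧ IsCompactOperator T}) :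
    (deflate T).1 (topVector T) = 0 := by
  change deflateFun T _ = _
  rw [deflateFun_apply]
  rcases qinner_topVector_self T with h | h
  · rw [h, MulOpposite.op_one, one_smul, sub_self, map_zero]
  · rw [h]; simp

/-- With `c` and `e` the top value and vector, `c ⟨e, x⟩ = ⟨T e, x⟩ = ⟨e, T x⟩ = 0`. This keeps
earlier eigenvectors in the kernel of later deflations and makes later eigenvectors orthogonal to
them. -/
theorem topValue_mul_qinner_of_apply_eq_zero
    (T : {T : H →L[ℍᵐᵒᵖ] H // IsPositive T ∧ IsCompactOperator T}) {x : H} (hx : T.1 x = 0) :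
    (topValue T : ℍ) * qinner (topVector T) x = 0 := by
  obtain ⟨-, -, -, he, -⟩ := topVector_spec T
  have := T.2.1.selfAdjoint (topVector T) x
  rwa [hx, qinner_zero_right, he, qinner_smul_left, Quaternion.star_coe] at this

/-- Removing the component along `e` does not increase the norm. The bound makes the sequence of
eigenvalues decreasing. -/
theorem norm_deflate_le (T : {T : H →L[ℍᵐᵒᵖ] H // IsPositive T ∧ IsCompactOperator T})
    (x : H) : ‖(deflate T).1 x‖ ≤ topValue T * ‖x‖ := by
  obtain ⟨h0, -, -, -, hn⟩ := topVector_spec T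
  refine (hn _).trans (mul_le_mul_of_nonneg_left ?_ h0)
  change ‖x - op (qinner (topVector T) x) • topVector T‖ ≤ ‖x‖
  set e := topVector T
  rcases qinner_topVector_self T with h | h
  · have h1 : ‖x - op (qinner e x) • e‖ ^ 2 = ‖x‖ ^ 2 - ‖qinner e x‖ ^ 2 := by
      rw [← re_qinner_self, ← re_qinner_self]
      simp only [qinner_sub_left, qinner_sub_right, qinner_smul_left, qinner_smul_right]
      change qinner e e = 1 at h
      rw [h, ← star_qinner x e, mul_one, Quaternion.star_mul_self,
        Quaternion.normSq_eq_norm_mul_self]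
      simp [sq]
    refine abs_le_of_sq_le_sq' ?_ (norm_nonneg _) |>.2
    rw [h1]; nlinarith [sq_nonneg ‖qinner e x‖]
  · change e = 0 at h
    rw [h]; simp

/-- A compact positive operator whose traces over finite orthonormal families are bounded has a
summable sequence of singular values. -/
theorem IsPositive.exists_singularValueSeq {T : H →L[ℍᵐᵒᵖ] H} (hT : IsPositive T)
    (hc : IsCompactOperator T) {I : ℝ}
    (hI : ∀ e : ℕ → H, (∀ m n, m ≠ n → qinner (e m) (e n) = 0) →
      (∀ n, qinner (e n) (e n) = 1 ∨ e n = 0) →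
      ∀ N, ∑ n ∈ Finset.range N, (qinner (e n) (T (e n))).re ≤ I) :
    ∃ s, IsSingularValueSeq T s ∧ Summable s := by
  set S : ℕ → {T : H →L[ℍᵐᵒᵖ] H // IsPositive T ∧ IsCompactOperator T} :=
    fun n => deflate^[n] ⟨T, hT, hc⟩ with hS
  have hS1 : ∀ n, S (n + 1) = deflate (S n) := fun n => Function.iterate_succ_apply' _ _ _
  set e : ℕ → H := fun n => topVector (S n) with he
  set s : ℕ → ℝ := fun n => topValue (S n) with hs
  have hs0 : ∀ n, 0 ≤ s n := fun n => (topVector_spec (S n)).1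
  -- Once split off, `e k` is annihilated by every later operator.
  have hker : ∀ k d, (S (k + 1 + d)).1 (e k) = 0 := fun k d => by
    induction d with
    | zero => rw [add_zero, hS1]; exact deflate_topVector _
    | succ d ih =>
      rw [← add_assoc, hS1, deflate_apply, topValue_mul_qinner_of_apply_eq_zero _ ih, ih]
      simp
  have horth : ∀ k d, qinner (e (k + 1 + d)) (e k) = 0 := fun k d => by
    rcases mul_eq_zero.1 (topValue_mul_qinner_of_apply_eq_zero _ (hker k d)) with h | h
    · have h1 := (topVector_spec (S (k + 1 + d))).2.2.1
        (by rwa [← Quaternion.coe_zero, Quaternion.coe_inj] at h)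
      change qinner (topVector _) _ = 0
      rw [h1, qinner_zero_left]
    · exact h
  have horth' : ∀ m n, m ≠ n → qinner (e m) (e n) = 0 := fun m n hmn => by
    rcases lt_or_gt_of_ne hmn with h | h
    · obtain ⟨d, rfl⟩ := Nat.exists_eq_add_of_le (Nat.succ_le_of_lt h)
      rw [← star_qinner, Nat.succ_eq_add_one, horth, star_zero]
    · obtain ⟨d, rfl⟩ := Nat.exists_eq_add_of_le (Nat.succ_le_of_lt h)
      exact horth n d
  have hself : ∀ n, qinner (e n) (e n) = 1 ∨ e n = 0 := fun n => qinner_topVector_self (S n)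
  -- The remainder `S n` will tend to zero pointwise, because its norm is controlled by `s n` and
  -- `s` is summable.
  have hexp : ∀ n x, T x = (S n).1 x +
      ∑ k ∈ Finset.range n, op ((s k : ℍ) * qinner (e k) x) • e k := fun n x => by
    induction n with
    | zero => simp [hS]
    | succ n ih =>
      rw [Finset.sum_range_succ, hS1, deflate_apply, ih]
      simp only [hs, he]; abel
  have hTe : ∀ n, T (e n) = op (s n : ℍ) • e n := fun n => by
    rw [hexp n, Finset.sum_eq_zero, add_zero]
    · exact (topVector_spec (S n)).2.2.2.1
    · intro k hk
      rw [horth' k n (by rw [Finset.mem_range] at hk; omega)]; simp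
  have hQe : ∀ n, (qinner (e n) (T (e n))).re = s n := fun n => by
    rw [hTe, qinner_smul_right]
    rcases hself n with h | h
    · rw [h]; simp
    · by_cases h1 : s n = 0
      · rw [h1]; simp
      · have h2 := (topVector_spec (S n)).2.1 h1
        change ‖e n‖ = 1 at h2
        rw [h, norm_zero] at h2
        exact absurd h2 zero_ne_one
  have hsum : Summable s := by
    refine summable_of_sum_range_le hs0 (c := I) fun n => ?_
    have := hI e horth' hself n
    simpa only [hQe] using this
  -- A positive operator is its own absolute value, so the eigenvalues of `T` are its singular
  -- values.
  refine ⟨s, ⟨antitone_nat_of_succ_le fun n => ?_, hs0, T, hT.isAbs, e, fun m n hm hn => ?_,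
    fun x => ?_⟩, hsum⟩
  · by_cases h : s (n + 1) = 0
    · rw [h]; exact hs0 n
    · obtain ⟨-, h1, -, h2, -⟩ := topVector_spec (S (n + 1))
      have h3 := norm_deflate_le (S n) (e (n + 1))
      rw [← hS1] at h3
      change (S (n + 1)).1 (e (n + 1)) = op (s (n + 1) : ℍ) • e (n + 1) at h2
      have h4 : ‖e (n + 1)‖ = 1 := h1 h
      rw [h2, norm_op_smul, h4, mul_one, mul_one, Quaternion.norm_coe,
        Real.norm_of_nonneg (hs0 _)] at h3
      exact h3
  · split_ifs with h
    · subst h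
      exact qinner_self_eq_one.2 ((topVector_spec (S m)).2.1 hm)
    · exact horth' m n h
  · have hle : ∀ n, ‖e n‖ ≤ 1 := fun n => by
      rcases hself n with h | h
      · exact (qinner_self_eq_one.1 h).le
      · rw [h]; simp
    rw [hasSum_iff_tendsto_nat_of_summable_norm]
    · have h1 : Tendsto (fun n => (S n).1 x) atTop (𝓝 0) := by
        refine squeeze_zero_norm (a := fun n => s n * ‖x‖)
          (fun n => (topVector_spec (S n)).2.2.2.2 x) ?_
        simpa using hsum.tendsto_atTop_zero.mul_const ‖x‖
      have h2 := (tendsto_const_nhds (x := T x)).sub h1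
      rw [sub_zero] at h2
      refine h2.congr fun n => ?_
      rw [hexp n x, add_sub_cancel_left]
    · refine Summable.of_nonneg_of_le (fun _ => norm_nonneg _) (fun n => ?_)
        (hsum.mul_right ‖x‖)
      rw [norm_op_smul, norm_mul, Quaternion.norm_coe, Real.norm_of_nonneg (hs0 n)]
      have h1 := norm_qinner_le (e n) x
      have h2 := hle n
      have h3 := hs0 n
      have h4 : ‖qinner (e n) x‖ ≤ ‖x‖ := by nlinarith [norm_nonneg x, norm_nonneg (e n)]
      calc s n * ‖qinner (e n) x‖ * ‖e n‖ ≤ s n * ‖x‖ * 1 := by gcongr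
        _ = _ := mul_one _

end Deflation

/-! ### Orthonormal families -/

section Orthonormal

variable {H : Type*} [NormedAddCommGroup H] [Module ℍᵐᵒᵖ H] [QuaternionicInner H]
variable {ι : Type*}

attribute [local instance] realInnerProductSpace

/-- A family that is orthonormal for the quaternionic scalar product. -/
def QOrthonormal (e : ι → H) : Prop :=
  (∀ n, qinner (e n) (e n) = 1) ∧ ∀ m n, m ≠ n → qinner (e m) (e n) = 0

theorem QOrthonormal.qinner_sum {e : ι → H} (he : QOrthonormal e) (s : Finset ι) (a : ι → ℍ)
    {n : ι} (hn : n ∈ s) : qinner (e n) (∑ m ∈ s, op (a m) • e m) = a n := by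
  rw [qinner_sum_right, Finset.sum_eq_single_of_mem n hn]
  · rw [qinner_smul_right, he.1, one_mul]
  · intro m _ hm
    rw [qinner_smul_right, he.2 n m hm.symm, zero_mul]

theorem QOrthonormal.norm_sum_sq {e : ι → H} (he : QOrthonormal e) (s : Finset ι) (a : ι → ℍ) :
    ‖∑ m ∈ s, op (a m) • e m‖ ^ 2 = ∑ m ∈ s, ‖a m‖ ^ 2 := by
  rw [← re_qinner_self, qinner_sum_left]
  have : ∀ n ∈ s, qinner (op (a n) • e n) (∑ m ∈ s, op (a m) • e m) = ((‖a n‖ ^ 2 : ℝ) : ℍ) :=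
    fun n hn => by
      rw [qinner_smul_left, he.qinner_sum s a hn, Quaternion.star_mul_self,
        normSq_eq_norm_mul_self, sq]
  rw [Finset.sum_congr rfl this, re_sum]
  exact Finset.sum_congr rfl fun n _ => Quaternion.re_coe _

/-- Bessel's inequality. -/
theorem QOrthonormal.sum_norm_sq_le {e : ι → H} (he : QOrthonormal e) (s : Finset ι) (x : H) :
    ∑ n ∈ s, ‖qinner (e n) x‖ ^ 2 ≤ ‖x‖ ^ 2 := by
  set y := ∑ n ∈ s, op (qinner (e n) x) • e n with hy
  have h1 : ‖y‖ ^ 2 = ∑ n ∈ s, ‖qinner (e n) x‖ ^ 2 := he.norm_sum_sq s _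
  have h2 : inner ℝ x y = ∑ n ∈ s, ‖qinner (e n) x‖ ^ 2 := by
    rw [real_inner_def, re_qinner_comm, hy, qinner_sum_left]
    have : ∀ n ∈ s, qinner (op (qinner (e n) x) • e n) x = ((‖qinner (e n) x‖ ^ 2 : ℝ) : ℍ) :=
      fun n _ => by
        rw [qinner_smul_left, Quaternion.star_mul_self, normSq_eq_norm_mul_self, sq]
    rw [Finset.sum_congr rfl this, re_sum]
    exact Finset.sum_congr rfl fun n _ => Quaternion.re_coe _
  have h3 := norm_sub_sq_real x y
  rw [h1, h2] at h3
  nlinarith [sq_nonneg ‖x - y‖]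

theorem QOrthonormal.summable_norm_sq {e : ι → H} (he : QOrthonormal e) (x : H) :
    Summable fun n => ‖qinner (e n) x‖ ^ 2 :=
  summable_of_sum_le (fun _ => sq_nonneg _) fun s => he.sum_norm_sq_le s x

theorem QOrthonormal.sum_mul_norm_le {e : ι → H} (he : QOrthonormal e) (s : Finset ι) (x y : H) :
    ∑ n ∈ s, ‖qinner (e n) x‖ * ‖qinner (e n) y‖ ≤ ‖x‖ * ‖y‖ := by
  refine (Real.sum_mul_le_sqrt_mul_sqrt s _ _).trans ?_
  gcongr
  · exact Real.sqrt_le_left (norm_nonneg x) |>.2 (he.sum_norm_sq_le s x)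
  · exact Real.sqrt_le_left (norm_nonneg y) |>.2 (he.sum_norm_sq_le s y)

/-- A Hilbert–Schmidt operator is compact. -/
theorem isCompactOperator_of_summable_norm_sq [CompleteSpace H] {T : H →L[ℍᵐᵒᵖ] H} {e : ℕ → H}
    (he : QOrthonormal e) (hb : ∀ x, HasSum (fun n => op (qinner (e n) x) • e n) x)
    (hs : Summable fun n => ‖T (e n)‖ ^ 2) : IsCompactOperator T := by
  set F : ℕ → H →L[ℍᵐᵒᵖ] H := fun N => ∑ n ∈ Finset.range N, rankOne (T (e n)) (e n) with hF
  have hFa : ∀ N x, F N x = ∑ n ∈ Finset.range N, op (qinner (e n) x) • T (e n) := fun N x => by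
    simp only [hF, sum_apply]; rfl
  have hFc : ∀ N, IsCompactOperator (F N) := fun N => by
    induction N with
    | zero => simp only [hF, Finset.range_zero, Finset.sum_empty]; exact isCompactOperator_zero
    | succ N ih =>
      have : F (N + 1) = F N + rankOne (T (e N)) (e N) := Finset.sum_range_succ _ _
      rw [this]
      exact ih.add (isCompactOperator_rankOne _ _)
  -- Cauchy–Schwarz and Bessel bound the tail of the expansion by the Hilbert–Schmidt tail,
  -- uniformly in `x`. Thus `T` is a norm limit of finite rank operators.
  have hbound : ∀ N x, ‖T x - F N x‖ ≤ √(∑' n, ‖T (e (n + N))‖ ^ 2) * ‖x‖ := fun N x => by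
    have h1 : HasSum (fun n => op (qinner (e n) x) • T (e n)) (T x) := by
      have := (hb x).mapL (toReal T)
      simpa only [toReal_apply, map_smul] using this
    have h2 := ((hasSum_nat_add_iff' N).2 h1).tendsto_sum_nat
    rw [← hFa] at h2
    refine le_of_tendsto h2.norm (Eventually.of_forall fun M => ?_)
    refine (norm_sum_le _ _).trans ?_
    have hs' := (summable_nat_add_iff N).2 hs
    have he' : QOrthonormal fun n => e (n + N) :=
      ⟨fun n => he.1 _, fun m n hmn => he.2 _ _ (by omega)⟩
    calc ∑ n ∈ Finset.range M, ‖op (qinner (e (n + N)) x) • T (e (n + N))‖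
        = ∑ n ∈ Finset.range M, ‖T (e (n + N))‖ * ‖qinner (e (n + N)) x‖ :=
          Finset.sum_congr rfl fun n _ => by rw [norm_op_smul, mul_comm]
      _ ≤ _ := Real.sum_mul_le_sqrt_mul_sqrt _ _ _
      _ ≤ _ := by
        gcongr
        · exact hs'.sum_le_tsum _ fun _ _ => sq_nonneg _
        · exact Real.sqrt_le_left (norm_nonneg x) |>.2 (he'.sum_norm_sq_le _ x)
  have hlim : Tendsto (fun N => toReal (F N)) atTop (𝓝 (toReal T)) := by
    rw [tendsto_iff_norm_sub_tendsto_zero]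
    have h1 : Tendsto (fun N => √(∑' n, ‖T (e (n + N))‖ ^ 2)) atTop (𝓝 0) := by
      simpa using (tendsto_sum_nat_add fun n => ‖T (e n)‖ ^ 2).sqrt
    refine squeeze_zero (fun _ => norm_nonneg _) (fun N => ?_) h1
    refine ContinuousLinearMap.opNorm_le_bound _ (Real.sqrt_nonneg _) fun x => ?_
    simpa [norm_sub_rev] using hbound N x
  exact isCompactOperator_of_tendsto hlim (Eventually.of_forall hFc)

/-- A positive operator of finite trace is compact. -/
theorem IsPositive.isCompactOperator [CompleteSpace H] {T : H →L[ℍᵐᵒᵖ] H} (hT : IsPositive T)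
    {e : ℕ → H} (he : QOrthonormal e) (hb : ∀ x, HasSum (fun n => op (qinner (e n) x) • e n) x)
    (hs : Summable fun n => (qinner (e n) (T (e n))).re) : IsCompactOperator T := by
  refine isCompactOperator_of_summable_norm_sq he hb ?_
  refine Summable.of_nonneg_of_le (fun _ => sq_nonneg _) (fun n => ?_) (hs.mul_left ‖toReal T‖)
  refine hT.norm_sq_le (fun x => ?_) _
  have h1 := real_inner_le_norm x (T x)
  have h2 := (toReal T).le_opNorm x
  rw [toReal_apply] at h2
  rw [real_inner_def] at h1
  nlinarith [norm_nonneg x]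

/-- The real part of the trace of a nuclear operator. -/
theorem QOrthonormal.hasSum_re_qinner {b : ι → H} (hb : QOrthonormal b)
    (hx : ∀ x, HasSum (fun k => op (qinner (b k) x) • b k) x) {T : H →L[ℍᵐᵒᵖ] H}
    {u v : ℕ → H} (huv : Summable fun n => ‖u n‖ * ‖v n‖)
    (hT : ∀ x, HasSum (fun n => op (qinner (v n) x) • u n) (T x)) :
    HasSum (fun k => (qinner (b k) (T (b k))).re) (∑' n, (qinner (v n) (u n)).re) := by
  -- The double family is absolutely summable: Bessel bounds the sum over the basis by `‖uₙ‖ ‖vₙ‖`.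
  -- Summing in the two orders gives the two sides.
  set g : ℕ × ι → ℝ := fun p => (qinner (v p.1) (b p.2) * qinner (b p.2) (u p.1)).re with hg
  have hle : ∀ p, ‖g p‖ ≤ ‖qinner (b p.2) (u p.1)‖ * ‖qinner (b p.2) (v p.1)‖ := fun p => by
    have h1 := abs_re_le_norm (qinner (v p.1) (b p.2) * qinner (b p.2) (u p.1))
    rw [norm_mul, ← Quaternion.norm_star (qinner (v p.1) _), star_qinner, mul_comm ‖_‖] at h1
    exact h1
  have hS : Summable g := by
    refine Summable.of_norm_bounded (g := fun p : ℕ × ι =>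
      ‖qinner (b p.2) (u p.1)‖ * ‖qinner (b p.2) (v p.1)‖) ?_ hle
    rw [summable_prod_of_nonneg fun p => by positivity]
    have h1 : ∀ n, Summable fun k => ‖qinner (b k) (u n)‖ * ‖qinner (b k) (v n)‖ := fun n =>
      summable_of_sum_le (fun _ => by positivity) fun s => hb.sum_mul_norm_le s _ _
    have h2 : ∀ n, ∑' k, ‖qinner (b k) (u n)‖ * ‖qinner (b k) (v n)‖ ≤ ‖u n‖ * ‖v n‖ := fun n =>
      (h1 n).tsum_le_of_sum_le fun s => hb.sum_mul_norm_le s (u n) (v n)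
    refine ⟨h1, ?_⟩
    refine Summable.of_nonneg_of_le (fun n => tsum_nonneg fun _ => by positivity) (fun n => h2 n) huv
  have h1 : ∀ n, HasSum (fun k => g (n, k)) (qinner (v n) (u n)).re := fun n => by
    have := ((hx (u n)).mapL (qinnerL (v n))).mapL reL
    simpa only [qinnerL_apply, qinner_smul_right, reL_apply] using this
  have h2 : ∀ k, HasSum (fun n => g (n, k)) (qinner (b k) (T (b k))).re := fun k => by
    have := ((hT (b k)).mapL (qinnerL (b k))).mapL reL
    simp only [qinnerL_apply, qinner_smul_right, reL_apply] at this
    convert this using 2 with n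
    -- The two orders of summation produce the factors in opposite order, which only the real part
    -- does not see.
    simp only [hg, Quaternion.re_mul]; ring
  rw [(hS.hasSum.prod_fiberwise h1).tsum_eq]
  have h3 := (Equiv.prodComm ι ℕ).hasSum_iff.2 hS.hasSum
  exact h3.prod_fiberwise h2

end Orthonormal

/-! ### The space `H₊^{Ji}` and the trace -/

theorem imagUnit_mul_self (i : ImagUnit) : (i : ℍ) * i = -1 := by
  have h0 := i.2.1
  have h1 : normSq (i : ℍ) = 1 := by rw [normSq_eq_norm_mul_self, i.2.2, one_mul]
  rw [normSq_def', h0] at h1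
  ext <;> simp [h0]
  · linear_combination -h1
  all_goals ring

theorem imagUnit_ne_zero (i : ImagUnit) : (i : ℍ) ≠ 0 := by
  intro h
  have := i.2.2
  rw [h, norm_zero] at this
  exact zero_ne_one this

theorem star_imagUnit (i : ImagUnit) : star (i : ℍ) = -i := by
  ext <;> simp [i.2.1]

/-- The quaternion `q + i q i` anticommutes with `i` for every `q`. If all of these vanished, `i`
would commute with every quaternion, hence be real, hence zero. -/
theorem exists_anticommute (i : ImagUnit) : ∃ a : ℍ, a ≠ 0 ∧ (i : ℍ) * a = -(a * i) := by
  by_contra! h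
  have h1 : ∀ q : ℍ, q + i * q * i = 0 := fun q => by
    by_contra h2
    refine h _ h2 ?_
    have h3 : (i : ℍ) * (q + i * q * i) = i * q + (i * i) * q * i := by noncomm_ring
    have h4 : (q + i * q * i) * i = q * i + i * q * (i * i) := by noncomm_ring
    rw [h3, h4, imagUnit_mul_self]; noncomm_ring
  have h2 : ∀ q : ℍ, q * i = i * q := fun q => by
    have h3 : (q + i * q * i) * i = q * i + i * q * (i * i) := by noncomm_ring
    rw [h1 q, imagUnit_mul_self, zero_mul] at h3
    have : q * i - i * q = 0 := by rw [h3]; noncomm_ring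
    exact sub_eq_zero.1 this
  have h3 := h2 (stdUnit 0)
  have h4 := h2 (stdUnit 1)
  rw [Quaternion.ext_iff] at h3 h4
  simp [stdUnit_re, stdUnit_imI, stdUnit_imJ, stdUnit_imK] at h3 h4
  have h5 := i.2.1
  refine imagUnit_ne_zero i ?_
  ext <;> simp <;> linarith [h3.1, h3.2, h4.1, h4.2]

/-- An element of `ℂ_i` in terms of real parts. -/
theorem eq_of_commute (i : ImagUnit) {q : ℍ} (hq : (i : ℍ) * q = q * i) :
    q = q.re • (1 : ℍ) - (q * i).re • (i : ℍ) := by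
  have h1 : star ((i : ℍ) * q) = star (q * i) := by rw [hq]
  have h2 : ∀ p : ℍ, p.re • (1 : ℍ) = (2⁻¹ : ℝ) • (p + star p) := fun p => by
    ext <;> simp; ring
  have h3 : (q * i).re • (i : ℍ) = ((q * i).re • (1 : ℍ)) * i := by rw [smul_mul_assoc, one_mul]
  rw [h3, h2, h2, ← h1, star_mul, star_imagUnit, smul_mul_assoc, ← smul_sub, add_mul, mul_assoc,
    mul_assoc, neg_mul, imagUnit_mul_self]
  have : q + star q - (q * -1 + star q * - -1) = (2 : ℝ) • q := by
    rw [two_smul]; noncomm_ring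
  rw [this, smul_smul]; norm_num

section Plus

variable {H : Type*} [NormedAddCommGroup H] [Module ℍᵐᵒᵖ H] [QuaternionicInner H]
variable {J T : H →L[ℍᵐᵒᵖ] H} {i : ImagUnit}

attribute [local instance] realInnerProductSpace

theorem IsPlusBasis.qorthonormal {b : Set H} (hb : IsPlusBasis J i b) :
    QOrthonormal fun e : b => (e : H) :=
  ⟨fun e => hb.2.1 e e.2, fun e e' h => hb.2.2.1 e e.2 e' e'.2 fun h' => h (Subtype.ext h')⟩

/-- An orthonormal basis of `H₊^{Ji}` is an orthonormal basis of `H`. -/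
theorem IsPlusBasis.hasSum {b : Set H} (hb : IsPlusBasis J i b) (hJ : ∀ x, J (J x) = -x)
    (x : H) : HasSum (fun e : b => op (qinner (e : H) x) • (e : H)) x := by
  -- The vectors with a convergent expansion form a right subspace, so it is enough to generate `x`
  -- from `H₊`.
  have hadd : ∀ x y : H, HasSum (fun e : b => op (qinner (e : H) x) • (e : H)) x →
      HasSum (fun e : b => op (qinner (e : H) y) • (e : H)) y →
      HasSum (fun e : b => op (qinner (e : H) (x + y)) • (e : H)) (x + y) := fun x y hx hy => by
    simpa only [qinner_add_right, MulOpposite.op_add, add_smul] using hx.add hy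
  have hsmul : ∀ (a : ℍ) (x : H), HasSum (fun e : b => op (qinner (e : H) x) • (e : H)) x →
      HasSum (fun e : b => op (qinner (e : H) (op a • x)) • (e : H)) (op a • x) :=
    fun a x hx => by
      have h1 : Continuous fun y : H => op a • y := by
        have h2 : ∀ y z : H, dist (op a • y) (op a • z) = ‖a‖ * dist y z := fun y z => by
          rw [dist_eq_norm, ← smul_sub, norm_op_smul, dist_eq_norm]
        exact (LipschitzWith.of_dist_le_mul (K := ‖a‖₊) fun y z => (h2 y z).le).continuous
      have h2 := hx.map (AddMonoidHom.mk' (fun y : H => op a • y) (smul_add (op a))) h1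
      simpa only [Function.comp_def, AddMonoidHom.mk'_apply, smul_smul, ← MulOpposite.op_mul,
        ← qinner_smul_right] using h2
  -- Here `x = (p + m)/2` with `J p = p i` and `J m = -m i`; right multiplication by an `a` that
  -- anticommutes with `i` moves `m` into `H₊`.
  set p : H := x - op (i : ℍ) • J x with hp
  set m : H := x + op (i : ℍ) • J x with hm
  have hii : ∀ y : H, op (i : ℍ) • op (i : ℍ) • y = -y := fun y => by
    rw [smul_smul, ← MulOpposite.op_mul, imagUnit_mul_self, MulOpposite.op_neg,
      MulOpposite.op_one, neg_smul, one_smul]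
  have h1 : p ∈ plusSpace J i := by
    change J p = op (i : ℍ) • p
    rw [hp, map_sub, map_smul, hJ, smul_sub, hii, smul_neg]; abel
  obtain ⟨a, ha0, ha⟩ := exists_anticommute i
  have h2 : op a • m ∈ plusSpace J i := by
    change J (op a • m) = op (i : ℍ) • op a • m
    have h3 : J m = -(op (i : ℍ) • m) := by
      rw [hm, map_add, map_smul, hJ, smul_add, hii, smul_neg]; abel
    rw [map_smul, h3, smul_neg, smul_smul, smul_smul, ← MulOpposite.op_mul, ← MulOpposite.op_mul,
      ha, MulOpposite.op_neg, neg_smul, neg_neg]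
  have h3 := hsmul (2⁻¹ : ℝ) _ (hb.2.2.2 p h1)
  have h4 := hsmul (2⁻¹ : ℝ) _ (hsmul a⁻¹ _ (hb.2.2.2 _ h2))
  have h5 : op a⁻¹ • op a • m = m := by
    rw [smul_smul, ← MulOpposite.op_mul, mul_inv_cancel₀ ha0, MulOpposite.op_one, one_smul]
  rw [h5] at h4
  have h6 := hadd _ _ h3 h4
  have h7 : op (((2⁻¹ : ℝ)) : ℍ) • p + op (((2⁻¹ : ℝ)) : ℍ) • m = x := by
    rw [← smul_add, hp, hm, sub_add_add_cancel, ← two_smul ℝ x, real_smul_def, smul_smul,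
      ← MulOpposite.op_mul, ← Quaternion.coe_mul]
    norm_num
  rwa [h7] at h6

/-- Moving `J` across the scalar product moves `i` from one side of `⟨x, y⟩` to the other. So scalar
products on `H₊` take values in `ℂ_i`. -/
theorem qinner_commute_of_mem_plusSpace (hJ : IsAntiSelfAdjoint J) {x y : H}
    (hx : x ∈ plusSpace J i) (hy : y ∈ plusSpace J i) :
    (i : ℍ) * qinner x y = qinner x y * i := by
  have h := hJ x y
  rw [show J x = _ from hx, show J y = _ from hy, qinner_neg_left, qinner_smul_left,
    qinner_smul_right, star_imagUnit, neg_mul, neg_neg] at h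
  exact h

/-- The trace of a nuclear operator `∑ uₙ ⟨vₙ, ·⟩` that commutes with `J`. -/
theorem hasTrace_of_nuclear (hJ : ∀ x, J (J x) = -x) (hJa : IsAntiSelfAdjoint J)
    (hTJ : CommutesWith J T) (hb : ∃ b : Set H, IsPlusBasis J i b) {u v : ℕ → H}
    (huv : Summable fun n => ‖u n‖ * ‖v n‖)
    (hT : ∀ x, HasSum (fun n => op (qinner (v n) x) • u n) (T x)) {w : ℕ → H}
    (huw : Summable fun n => ‖u n‖ * ‖w n‖)
    (hT' : ∀ x, HasSum (fun n => op (qinner (w n) x) • u n) (T (J x))) {t : ℍ}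
    (ht : (i : ℍ) * t = t * i) (h1 : ∑' n, (qinner (v n) (u n)).re = t.re)
    (h2 : ∑' n, (qinner (w n) (u n)).re = (t * i).re) : HasTrace J i T t := by
  refine ⟨hb, fun b hb => ?_⟩
  have s1 := hb.qorthonormal.hasSum_re_qinner (hb.hasSum hJ) huv hT
  have s2 := hb.qorthonormal.hasSum_re_qinner (hb.hasSum hJ) (T := T.comp J) huw hT'
  -- `⟨e, T e⟩` lies in `ℂ_i`, and `⟨e, T J e⟩ = ⟨e, T e⟩ i`, so its two real coordinates are real
  -- parts of diagonal entries of `T` and `T J`.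
  have e1 : ∀ e : b, qinner (e : H) (T e) =
      (qinner (e : H) (T e)).re • (1 : ℍ) - (qinner (e : H) (T (J e))).re • (i : ℍ) := fun e => by
    have he := hb.1 e.2
    have hTe : T e ∈ plusSpace J i := by
      change J (T e) = op (i : ℍ) • T e
      rw [← hTJ, show J e = _ from he, map_smul]
    rw [show J e = _ from he, map_smul, qinner_smul_right]
    exact eq_of_commute i (qinner_commute_of_mem_plusSpace hJa he hTe)
  rw [h1] at s1
  rw [h2] at s2
  rw [eq_of_commute i ht]
  rw [show (fun e : b => qinner (e : H) (T e)) = _ from funext e1]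
  exact (s1.smul_const (1 : ℍ)).sub (s2.smul_const (i : ℍ))

end Plus

/-! ### Power series on a slice -/

/-- The identification of `ℂ` with `ℂ_i` as a ring homomorphism. -/
def sliceHom (i : ImagUnit) : ℂ →+* ℍ where
  toFun := slicePt i
  map_one' := by simp [slicePt]
  map_zero' := by simp [slicePt]
  map_add' z w := by simp [slicePt, mul_add]; abel
  map_mul' z w := by
    have e : slicePt i (z * w) = ((z.re * w.re : ℝ) : ℍ) + ((i : ℍ) * i) * ((z.im * w.im : ℝ) : ℍ) +
        (i : ℍ) * ((z.re * w.im + z.im * w.re : ℝ) : ℍ) := by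
      rw [imagUnit_mul_self]
      simp only [slicePt, Complex.mul_re, Complex.mul_im]
      push_cast; noncomm_ring
    rw [e]
    simp only [slicePt, Quaternion.mul_coe_eq_smul, add_mul, mul_add, smul_mul_assoc,
      mul_smul_comm, smul_smul, add_smul, Quaternion.coe_mul, Quaternion.coe_mul_eq_smul]
    module

theorem sliceHom_apply (i : ImagUnit) (z : ℂ) : sliceHom i z = slicePt i z := rfl

theorem slicePt_mul (i : ImagUnit) (z w : ℂ) : slicePt i (z * w) = slicePt i z * slicePt i w :=
  map_mul (sliceHom i) z w

theorem slicePt_pow (i : ImagUnit) (z : ℂ) (n : ℕ) : slicePt i (z ^ n) = slicePt i z ^ n :=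
  map_pow (sliceHom i) z n

theorem slicePt_add (i : ImagUnit) (z w : ℂ) : slicePt i (z + w) = slicePt i z + slicePt i w :=
  map_add (sliceHom i) z w

theorem slicePt_ofReal (i : ImagUnit) (r : ℝ) : slicePt i (r : ℂ) = (r : ℍ) := by
  simp [slicePt]

theorem star_slicePt (i : ImagUnit) (z : ℂ) : star (slicePt i z) = slicePt i (star z) := by
  simp only [slicePt, star_add, star_mul, star_imagUnit, Quaternion.star_coe, Complex.star_def,
    Complex.conj_re, Complex.conj_im, Quaternion.coe_neg, Quaternion.coe_mul_eq_smul]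
  rw [← neg_mul_comm, Quaternion.mul_coe_eq_smul]

theorem norm_slicePt (i : ImagUnit) (z : ℂ) : ‖slicePt i z‖ = ‖z‖ := by
  have h1 : ((‖slicePt i z‖ ^ 2 : ℝ) : ℍ) = ((‖z‖ ^ 2 : ℝ) : ℍ) := by
    rw [sq, ← normSq_eq_norm_mul_self, ← Quaternion.self_mul_star, star_slicePt, ← slicePt_mul,
      Complex.star_def, Complex.mul_conj, slicePt_ofReal, Complex.normSq_eq_norm_sq]
  rw [Quaternion.coe_inj, sq_eq_sq₀ (norm_nonneg _) (norm_nonneg _)] at h1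
  exact h1

theorem slicePt_comm (i : ImagUnit) (z w : ℂ) :
    slicePt i z * slicePt i w = slicePt i w * slicePt i z := by
  rw [← slicePt_mul, mul_comm, slicePt_mul]

theorem slicePt_I (i : ImagUnit) : slicePt i Complex.I = i := by simp [slicePt]

/-- The identification of `ℂ` with `ℂ_i` as a real linear map. -/
def slicePtL (i : ImagUnit) : ℂ →L[ℝ] ℍ where
  toFun := slicePt i
  map_add' := slicePt_add i
  map_smul' r z := by
    rw [Complex.real_smul, slicePt_mul, slicePt_ofReal, Quaternion.coe_mul_eq_smul]; rfl
  cont := continuous_slicePt i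

/-- The quaternions as a complex vector space, by left multiplication with `ℂ_i`. -/
def SliceSpace (_i : ImagUnit) : Type := ℍ

instance (i : ImagUnit) : NormedAddCommGroup (SliceSpace i) :=
  inferInstanceAs (NormedAddCommGroup ℍ)

instance (i : ImagUnit) : CompleteSpace (SliceSpace i) := inferInstanceAs (CompleteSpace ℍ)

/-- A quaternion as an element of `SliceSpace i`. -/
def SliceSpace.mk (i : ImagUnit) (q : ℍ) : SliceSpace i := q

/-- An element of `SliceSpace i` as a quaternion. -/
def SliceSpace.val {i : ImagUnit} (q : SliceSpace i) : ℍ := q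

instance (i : ImagUnit) : NormedSpace ℂ (SliceSpace i) where
  smul z q := SliceSpace.mk i (slicePt i z * q.val)
  mul_smul z w q := by
    change slicePt i (z * w) * q.val = slicePt i z * (slicePt i w * q.val)
    rw [slicePt_mul, mul_assoc]
  one_smul q := by
    change sliceHom i 1 * q.val = q.val
    rw [map_one, one_mul]
  smul_zero z := mul_zero (slicePt i z)
  smul_add z q p := mul_add (slicePt i z) q.val p.val
  add_smul z w q := by
    change slicePt i (z + w) * q.val = slicePt i z * q.val + slicePt i w * q.val
    rw [slicePt_add, add_mul]
  zero_smul q := by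
    change sliceHom i 0 * q.val = 0
    rw [map_zero, zero_mul]
  norm_smul_le z q := by
    change ‖slicePt i z * q.val‖ ≤ ‖z‖ * ‖q.val‖
    rw [norm_mul, norm_slicePt]

/-- The identity map from `SliceSpace i` to `ℍ`. -/
def SliceSpace.toQuat (i : ImagUnit) : SliceSpace i →L[ℝ] ℍ where
  toFun q := q.val
  map_add' _ _ := rfl
  map_smul' r q := by
    change slicePt i (r : ℂ) * q.val = r • q.val
    rw [slicePt_ofReal, Quaternion.coe_mul_eq_smul]
  cont := continuous_id

/-- The Cauchy–Riemann system for `a`, `b` says `∂_y f = i ∂_x f` on the slice. The real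
differential is thus `h ↦ h ∂_x f` with `h ∈ ℂ_i` on the left, which is complex linear in
`SliceSpace i`. -/
theorem differentiableOn_slice {f : ℍ → ℍ} (hf : IsLeftSliceHyperholomorphicOn f unitBall)
    (i : ImagUnit) :
    DifferentiableOn ℂ (fun z => SliceSpace.mk i (f (slicePt i z))) (Metric.ball 0 1) := by
  intro z hz
  refine DifferentiableAt.differentiableWithinAt ?_
  have hz1 : ‖z‖ < 1 := by simpa using hz
  obtain ⟨hd, a, b, hab⟩ := hf
  have hzU := (slicePt_mem i z).2 hz1
  have hU : unitBall ∈ 𝓝 (slicePt i z) := Metric.isOpen_ball.mem_nhds hzU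
  obtain ⟨D, hD⟩ := (hd.differentiableAt hU).comp z (slicePtL i).differentiableAt
  obtain ⟨-, -, -, c, d, h1, h2, h3, h4⟩ := hab i z.re z.im hzU
  have hx : HasDerivAt (fun s : ℝ => f (slicePt i ⟨s, z.im⟩)) (D 1) z.re := by
    have e1 : HasDerivAt (fun s : ℝ => (⟨s, z.im⟩ : ℂ)) 1 z.re := by
      have := (Complex.ofRealCLM.hasDerivAt (x := z.re)).add_const ((z.im : ℂ) * Complex.I)
      refine this.congr_of_eventuallyEq (Eventually.of_forall fun s => ?_) |>.congr_deriv (by simp)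
      exact (Complex.mk_eq_add_mul_I s z.im)
    exact HasFDerivAt.comp_hasDerivAt (f := fun s : ℝ => (⟨s, z.im⟩ : ℂ)) z.re hD e1
  have hy : HasDerivAt (fun t : ℝ => f (slicePt i ⟨z.re, t⟩)) (D Complex.I) z.im := by
    have e1 : HasDerivAt (fun t : ℝ => (⟨z.re, t⟩ : ℂ)) Complex.I z.im := by
      have := ((Complex.ofRealCLM.hasDerivAt (x := z.im)).mul_const Complex.I).const_add (z.re : ℂ)
      refine this.congr_of_eventuallyEq (Eventually.of_forall fun s => ?_) |>.congr_deriv (by simp)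
      exact (Complex.mk_eq_add_mul_I z.re s)
    exact HasFDerivAt.comp_hasDerivAt (f := fun t : ℝ => (⟨z.re, t⟩ : ℂ)) z.im hD e1
  have hx' : HasDerivAt (fun s : ℝ => f (slicePt i ⟨s, z.im⟩)) (c + i * d) z.re := by
    refine (h1.add (h3.const_mul (i : ℍ))).congr_of_eventuallyEq ?_
    have hc : ContinuousAt (fun s : ℝ => slicePt i ⟨s, z.im⟩) z.re := by
      have : Continuous fun s : ℝ => slicePt i ⟨s, z.im⟩ := by
        have := Quaternion.continuous_coe
        unfold slicePt; fun_prop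
      exact this.continuousAt
    filter_upwards [hc.preimage_mem_nhds hU] with s hs
    exact (hab i s z.im hs).1
  have hy' : HasDerivAt (fun t : ℝ => f (slicePt i ⟨z.re, t⟩)) (-d + i * c) z.im := by
    refine (h4.add (h2.const_mul (i : ℍ))).congr_of_eventuallyEq ?_
    have hc : ContinuousAt (fun t : ℝ => slicePt i ⟨z.re, t⟩) z.im := by
      have : Continuous fun t : ℝ => slicePt i ⟨z.re, t⟩ := by
        have := Quaternion.continuous_coe
        unfold slicePt; fun_prop
      exact this.continuousAt
    filter_upwards [hc.preimage_mem_nhds hU] with s hs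
    exact (hab i z.re s hs).1
  have hDI : D Complex.I = i * D 1 := by
    rw [hx.unique hx', hy.unique hy', mul_add, ← mul_assoc, imagUnit_mul_self]
    noncomm_ring
  have hDh : ∀ h : ℂ, D h = slicePt i h * D 1 := fun h => by
    have : h = h.re • (1 : ℂ) + h.im • Complex.I := by
      simp [Complex.re_add_im]
    conv_lhs => rw [this]
    rw [map_add, map_smul, map_smul, hDI, slicePt, add_mul, Quaternion.coe_mul_eq_smul,
      Quaternion.mul_coe_eq_smul, smul_mul_assoc]
  have hlo := hD.isLittleO
  refine HasDerivAt.differentiableAt (f' := SliceSpace.mk i (D 1)) ?_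
  rw [hasDerivAt_iff_isLittleO]
  refine Asymptotics.IsLittleO.congr_left (f₁ := fun x' =>
    (f ∘ slicePtL i) x' - (f ∘ slicePtL i) z - D (x' - z)) hlo fun w => ?_
  rw [hDh]; rfl

/-- A slice hyperholomorphic function on the unit ball is given by a power series on `𝔻_i`. -/
theorem exists_hasSum_slice {f : ℍ → ℍ} (hf : IsLeftSliceHyperholomorphicOn f unitBall)
    (i : ImagUnit) : ∃ a : ℕ → ℍ, ∀ z : ℂ, ‖z‖ < 1 →
      HasSum (fun n => slicePt i z ^ n * a n) (f (slicePt i z)) := by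
  refine ⟨fun n => ((n.factorial : ℂ)⁻¹ •
    iteratedDeriv n (fun z => SliceSpace.mk i (f (slicePt i z))) 0).val, fun z hz => ?_⟩
  have h := (Complex.hasSum_taylorSeries_on_ball (differentiableOn_slice hf i)
    (show z ∈ Metric.ball (0 : ℂ) 1 by simpa using hz)).mapL (SliceSpace.toQuat i)
  convert h using 2 with n
  · rw [sub_zero, smul_comm, ← slicePt_pow]; rfl
  · rfl

/-- The function `∑ xⁿ bₙ` on the unit ball, extended by zero. -/
def seriesFun (b : ℕ → ℍ) : ℍ → ℍ :=
  unitBall.indicator fun x => ∑' n, x ^ n * b n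

theorem seriesFun_of_notMem (b : ℕ → ℍ) {x : ℍ} (hx : x ∉ unitBall) : seriesFun b x = 0 :=
  Set.indicator_of_notMem hx _

theorem hasSum_seriesFun {b : ℕ → ℍ} (hb : ∀ r : ℝ, 0 ≤ r → r < 1 → Summable fun n => r ^ n * ‖b n‖)
    {x : ℍ} (hx : x ∈ unitBall) : HasSum (fun n => x ^ n * b n) (seriesFun b x) := by
  rw [seriesFun, Set.indicator_of_mem hx]
  refine (Summable.of_norm ?_).hasSum
  have := hb ‖x‖ (norm_nonneg x) (by simpa [unitBall] using hx)
  simpa only [norm_mul, norm_pow] using this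

/-- The terms `xⁿ bₙ` are continuous homogeneous polynomials of norm at most `‖bₙ‖` on the real
algebra `ℍ`, so the series is real analytic with radius at least 1. -/
theorem differentiableOn_seriesFun {b : ℕ → ℍ}
    (hb : ∀ r : ℝ, 0 ≤ r → r < 1 → Summable fun n => r ^ n * ‖b n‖) :
    DifferentiableOn ℝ (seriesFun b) unitBall := by
  set p : FormalMultilinearSeries ℝ ℍ ℍ := fun n =>
    ((ContinuousLinearMap.mul ℝ ℍ).flip (b n)).compContinuousMultilinearMap
      (ContinuousMultilinearMap.mkPiAlgebraFin ℝ n ℍ) with hp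
  have hpn : ∀ n, ‖p n‖ ≤ ‖b n‖ := fun n => by
    refine ContinuousMultilinearMap.opNorm_le_bound (norm_nonneg _) fun m => ?_
    change ‖(List.ofFn m).prod * b n‖ ≤ _
    rw [norm_mul, mul_comm]
    gcongr
    have := (ContinuousMultilinearMap.mkPiAlgebraFin ℝ n ℍ).le_opNorm m
    simpa using this
  have hr : 1 ≤ p.radius := by
    refine ENNReal.le_of_forall_nnreal_lt fun r hr => ?_
    refine p.le_radius_of_summable_norm ?_
    refine Summable.of_nonneg_of_le (fun n => by positivity) (fun n => ?_)
      (hb r r.2 (by exact_mod_cast hr))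
    rw [mul_comm]
    gcongr
    exact hpn n
  have h1 := p.hasFPowerSeriesOnBall (lt_of_lt_of_le one_pos hr)
  have h2 := (h1.differentiableOn).mono (Metric.eball_subset_eball hr)
  have h3 : Metric.eball (0 : ℍ) 1 = unitBall := by
    rw [unitBall, ← Metric.eball_ofReal]; simp
  rw [h3] at h2
  refine h2.congr fun x hx => ?_
  rw [seriesFun, Set.indicator_of_mem hx, FormalMultilinearSeries.sum]
  refine tsum_congr fun n => ?_
  change _ = (List.ofFn fun _ : Fin n => x).prod * b n
  rw [List.ofFn_const, List.prod_replicate]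

/-- The sum of a power series with coefficients in `SliceSpace i` has a complex derivative. -/
theorem hasDerivAt_tsum_pow (i : ImagUnit) {b : ℕ → ℍ}
    (hb : ∀ r : ℝ, 0 ≤ r → r < 1 → Summable fun n => r ^ n * ‖b n‖) {z : ℂ} (hz : ‖z‖ < 1) :
    DifferentiableAt ℂ (fun w : ℂ => ∑' n, w ^ n • SliceSpace.mk i (b n)) z := by
  obtain ⟨r, hzr, hr1⟩ := exists_between hz
  have hr0 : 0 ≤ r := (norm_nonneg z).trans hzr.le
  have h := Complex.differentiableOn_tsum_of_summable_norm
    (F := fun n (w : ℂ) => w ^ n • SliceSpace.mk i (b n)) (U := Metric.ball 0 r) (hb r hr0 hr1)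
    (fun n => by fun_prop) Metric.isOpen_ball fun n w hw => by
      have h1 : ‖w‖ < r := by simpa using hw
      rw [norm_smul, norm_pow]
      change _ * ‖b n‖ ≤ _
      gcongr
  exact h.differentiableAt (Metric.isOpen_ball.mem_nhds (by simpa using hzr))

/-- The components `a`, `b` are read off one auxiliary slice as the even part of `g` in `y` and `-i`
times its odd part. They serve every slice because the real coordinates of `(x + j y)ⁿ` do not
depend on `j`; their Cauchy–Riemann equations come from holomorphy of `g`. -/
theorem isLeftSliceHyperholomorphicOn_seriesFun {b : ℕ → ℍ}
    (hb : ∀ r : ℝ, 0 ≤ r → r < 1 → Summable fun n => r ^ n * ‖b n‖) :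
    IsLeftSliceHyperholomorphicOn (seriesFun b) unitBall := by
  let i : ImagUnit := ⟨stdUnit 0, stdUnit_re 0, norm_stdUnit 0⟩
  set g : ℂ → ℍ := fun w => seriesFun b (slicePt i w) with hg
  have hsum : ∀ (j : ImagUnit) (w : ℂ), ‖w‖ < 1 →
      HasSum (fun n => slicePt j (w ^ n) * b n) (seriesFun b (slicePt j w)) := fun j w hw => by
    have := hasSum_seriesFun hb ((slicePt_mem j w).2 hw)
    simpa only [slicePt_pow] using this
  have hdiff : ∀ w : ℂ, ‖w‖ < 1 → ∃ c : ℍ, ∀ (γ : ℝ → ℂ) (γ' : ℂ) (t : ℝ), γ t = w →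
      HasDerivAt γ γ' t → HasDerivAt (fun s => g (γ s)) (slicePt i γ' * c) t := fun w hw => by
    have h1 := (hasDerivAt_tsum_pow i hb hw).hasDerivAt
    set c := deriv (fun w : ℂ => ∑' n, w ^ n • SliceSpace.mk i (b n)) w
    refine ⟨c.val, fun γ γ' t ht hγ => ?_⟩
    subst ht
    have h2 := (SliceSpace.toQuat i).hasFDerivAt.comp_hasDerivAt t (h1.scomp t hγ)
    refine h2.congr_of_eventuallyEq ?_
    have h3 : ∀ᶠ s in 𝓝 t, ‖γ s‖ < 1 := hγ.continuousAt.norm.eventually (gt_mem_nhds hw)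
    filter_upwards [h3] with s hs
    refine (hsum i (γ s) hs).unique ?_
    have h4 : Summable fun n => γ s ^ n • SliceSpace.mk i (b n) := by
      refine Summable.of_norm ?_
      refine (hb ‖γ s‖ (norm_nonneg _) hs).congr fun n => ?_
      rw [norm_smul, norm_pow]; rfl
    exact h4.hasSum.mapL (SliceSpace.toQuat i)
  refine ⟨differentiableOn_seriesFun hb,
    fun x y => (2⁻¹ : ℝ) • (g ⟨x, y⟩ + g ⟨x, -y⟩),
    fun x y => -i * ((2⁻¹ : ℝ) • (g ⟨x, y⟩ - g ⟨x, -y⟩)), fun j x y hxy => ?_⟩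
  have hz := (slicePt_mem j ⟨x, y⟩).1 hxy
  have hz' : ‖(⟨x, -y⟩ : ℂ)‖ < 1 := by
    have : (⟨x, -y⟩ : ℂ) = star (⟨x, y⟩ : ℂ) := rfl
    rw [this, _root_.norm_star]; exact hz
  obtain ⟨c1, hc1⟩ := hdiff _ hz
  obtain ⟨c2, hc2⟩ := hdiff _ hz'
  have d1 : HasDerivAt (fun s : ℝ => g ⟨s, y⟩) c1 x := by
    have := hc1 (fun s => ⟨s, y⟩) 1 x rfl (by
      have := (Complex.ofRealCLM.hasDerivAt (x := x)).add_const ((y : ℂ) * Complex.I)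
      refine this.congr_of_eventuallyEq (Eventually.of_forall fun s => ?_) |>.congr_deriv (by simp)
      exact (Complex.mk_eq_add_mul_I s y))
    rwa [← sliceHom_apply, map_one, one_mul] at this
  have d2 : HasDerivAt (fun s : ℝ => g ⟨s, -y⟩) c2 x := by
    have := hc2 (fun s => ⟨s, -y⟩) 1 x rfl (by
      have := (Complex.ofRealCLM.hasDerivAt (x := x)).add_const (((-y : ℝ) : ℂ) * Complex.I)
      refine this.congr_of_eventuallyEq (Eventually.of_forall fun s => ?_) |>.congr_deriv (by simp)
      exact (Complex.mk_eq_add_mul_I s (-y)))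
    rwa [← sliceHom_apply, map_one, one_mul] at this
  have d3 : HasDerivAt (fun t : ℝ => g ⟨x, t⟩) (i * c1) y := by
    have := hc1 (fun t => ⟨x, t⟩) Complex.I y rfl (by
      have := ((Complex.ofRealCLM.hasDerivAt (x := y)).mul_const Complex.I).const_add (x : ℂ)
      refine this.congr_of_eventuallyEq (Eventually.of_forall fun s => ?_) |>.congr_deriv (by simp)
      exact (Complex.mk_eq_add_mul_I x s))
    rwa [slicePt_I] at this
  have d4 : HasDerivAt (fun t : ℝ => g ⟨x, -t⟩) (-i * c2) y := by
    have := hc2 (fun t => ⟨x, -t⟩) (-Complex.I) y rfl (by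
      have := ((Complex.ofRealCLM.hasDerivAt (x := y)).mul_const (-Complex.I)).const_add (x : ℂ)
      refine this.congr_of_eventuallyEq (Eventually.of_forall fun s => ?_) |>.congr_deriv (by simp)
      rw [Complex.mk_eq_add_mul_I]
      push_cast; simp)
    rwa [← sliceHom_apply, map_neg, sliceHom_apply, slicePt_I] at this
  have hii : ∀ q : ℍ, (i : ℍ) * (i * q) = -q := fun q => by
    rw [← mul_assoc, imagUnit_mul_self, neg_one_mul]
  refine ⟨?_, by simp only [neg_neg, add_comm], ?_, (2⁻¹ : ℝ) • (c1 + c2),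
    -i * ((2⁻¹ : ℝ) • (c1 - c2)), (d1.fun_add d2).fun_const_smul (2⁻¹ : ℝ), ?_,
    ((d1.fun_sub d2).fun_const_smul (2⁻¹ : ℝ)).const_mul (-(i : ℍ)), ?_⟩
  · refine (hsum j ⟨x, y⟩ hz).unique ?_
    have s1 := hsum i ⟨x, y⟩ hz
    have s2 := hsum i ⟨x, -y⟩ hz'
    have s3 := ((s1.add s2).const_smul (2⁻¹ : ℝ)).add
      ((((s1.sub s2).const_smul (2⁻¹ : ℝ)).mul_left (-(i : ℍ))).mul_left (j : ℍ))
    convert s3 using 2 with n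
    have e1 : ((⟨x, -y⟩ : ℂ) ^ n) = star ((⟨x, y⟩ : ℂ) ^ n) := by
      rw [star_pow]; rfl
    rw [e1]
    generalize (⟨x, y⟩ : ℂ) ^ n = w
    rw [← add_mul, ← sub_mul]
    have e2 : slicePt i w + slicePt i (star w) = (2 : ℝ) • (w.re : ℍ) := by
      simp only [slicePt, Complex.star_def, Complex.conj_re, Complex.conj_im, Quaternion.coe_neg]
      rw [two_smul]; noncomm_ring
    have e3 : slicePt i w - slicePt i (star w) = (2 : ℝ) • (i * (w.im : ℍ)) := by
      simp only [slicePt, Complex.star_def, Complex.conj_re, Complex.conj_im, Quaternion.coe_neg]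
      rw [two_smul]; noncomm_ring
    rw [e2, e3, smul_mul_assoc, smul_mul_assoc, smul_smul, smul_smul, mul_assoc, neg_mul,
      inv_mul_cancel₀ two_ne_zero, one_smul, one_smul, hii, neg_neg, slicePt, add_mul, mul_assoc]
  · dsimp only
    rw [neg_neg, ← mul_neg, ← smul_neg, neg_sub]
  · have := ((d3.fun_sub d4).fun_const_smul (2⁻¹ : ℝ)).const_mul (-(i : ℍ))
    refine this.congr_deriv ?_
    rw [neg_mul, neg_mul, sub_neg_eq_add, ← mul_add, mul_smul_comm, hii, smul_neg, neg_neg]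
  · have := (d3.fun_add d4).fun_const_smul (2⁻¹ : ℝ)
    refine this.congr_deriv ?_
    rw [neg_mul, neg_mul, neg_neg, ← sub_eq_add_neg, ← mul_sub, mul_smul_comm]

/-! ### Moments of the measure `dA_α` -/

section Radial

variable {α : ℝ}

theorem hasDerivAt_one_sub_sq_rpow {y : ℝ} (hy : y ∈ Set.Ioo (0 : ℝ) 1) :
    HasDerivAt (fun y : ℝ => (1 - y ^ 2) ^ (α + 1)) (-(2 * (α + 1) * y * (1 - y ^ 2) ^ α)) y := by
  have h1 : (1 - y ^ 2) ≠ 0 := by nlinarith [hy.1, hy.2]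
  have h2 : HasDerivAt (fun y : ℝ => 1 - y ^ 2) (-(2 * y)) y := by
    simpa using (hasDerivAt_pow 2 y).const_sub 1
  refine (h2.rpow_const (p := α + 1) (Or.inl h1)).congr_deriv ?_
  rw [add_sub_cancel_right]; ring

theorem continuousOn_one_sub_sq_rpow (hα : -1 < α) :
    Continuous (fun y : ℝ => (1 - y ^ 2) ^ (α + 1)) := by
  refine Continuous.rpow_const (by fun_prop) fun y => Or.inr (by linarith)

/-- For `α < 0` the integrand is unbounded at `1`. Integrability holds because `2(α+1) y (1-y²)^α`
is the nonnegative derivative of the continuous function `-(1-y²)^(α+1)`. -/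
theorem intervalIntegrable_radial (hα : -1 < α) (n : ℕ) :
    IntervalIntegrable (fun y : ℝ => y ^ (2 * n + 1) * (1 - y ^ 2) ^ α) volume 0 1 := by
  have h0 : IntervalIntegrable (fun y : ℝ => 2 * (α + 1) * y * (1 - y ^ 2) ^ α) volume 0 1 := by
    rw [intervalIntegrable_iff_integrableOn_Ioc_of_le zero_le_one]
    refine intervalIntegral.integrableOn_deriv_of_nonneg
      (g := fun y => -(1 - y ^ 2) ^ (α + 1)) (continuousOn_one_sub_sq_rpow hα).neg.continuousOn
      (fun y hy => by simpa using (hasDerivAt_one_sub_sq_rpow hy).fun_neg) fun y hy => ?_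
    have h1 : 0 ≤ 1 - y ^ 2 := by nlinarith [hy.1, hy.2]
    have h2 : 0 < α + 1 := by linarith
    have h3 := hy.1
    positivity
  have h1 := h0.continuousOn_mul (g := fun y : ℝ => (2 * (α + 1))⁻¹ * y ^ (2 * n)) (by fun_prop)
  refine h1.congr fun y _ => ?_
  have h2 : α + 1 ≠ 0 := by linarith
  field_simp
  ring

theorem integral_radial_zero (hα : -1 < α) :
    2 * (α + 1) * ∫ y in (0 : ℝ)..1, y ^ (2 * 0 + 1) * (1 - y ^ 2) ^ α = 1 := by
  have h1 := intervalIntegral.integral_eq_sub_of_hasDerivAt_of_le zero_le_one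
    (f := fun y => (1 - y ^ 2) ^ (α + 1)) (continuousOn_one_sub_sq_rpow hα).continuousOn
    (fun y hy => hasDerivAt_one_sub_sq_rpow hy)
    (((intervalIntegrable_radial hα 0).const_mul (-(2 * (α + 1)))).congr fun y _ => by
      ring)
  have h2 : (0 : ℝ) ^ (α + 1) = 0 := Real.zero_rpow (by linarith)
  simp only [one_pow, sub_self, h2, ne_eq, OfNat.ofNat_ne_zero, not_false_eq_true, zero_pow,
    sub_zero, Real.one_rpow, zero_sub] at h1
  rw [← intervalIntegral.integral_const_mul]
  rw [intervalIntegral.integral_neg, neg_inj] at h1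
  exact Eq.trans (intervalIntegral.integral_congr fun y _ => by ring) h1

/-- The function `y^(2n+2) (1-y²)^(α+1)` vanishes at both endpoints, so its derivative integrates to
zero. -/
theorem integral_radial_succ (hα : -1 < α) (n : ℕ) :
    ((n : ℝ) + α + 2) * ∫ y in (0 : ℝ)..1, y ^ (2 * (n + 1) + 1) * (1 - y ^ 2) ^ α =
      (n + 1) * ∫ y in (0 : ℝ)..1, y ^ (2 * n + 1) * (1 - y ^ 2) ^ α := by
  set A := ∫ y in (0 : ℝ)..1, y ^ (2 * n + 1) * (1 - y ^ 2) ^ α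
  set B := ∫ y in (0 : ℝ)..1, y ^ (2 * (n + 1) + 1) * (1 - y ^ 2) ^ α
  have hi : IntervalIntegrable (fun y : ℝ => (2 * n + 2) * (y ^ (2 * n + 1) * (1 - y ^ 2) ^ α) -
      (2 * n + 2 * α + 4) * (y ^ (2 * (n + 1) + 1) * (1 - y ^ 2) ^ α)) volume 0 1 :=
    ((intervalIntegrable_radial hα n).const_mul _).sub
      ((intervalIntegrable_radial hα (n + 1)).const_mul _)
  have h1 := intervalIntegral.integral_eq_sub_of_hasDerivAt_of_le zero_le_one
    (f := fun y => y ^ (2 * n + 2) * (1 - y ^ 2) ^ (α + 1))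
    ((continuous_pow _).mul (continuousOn_one_sub_sq_rpow hα)).continuousOn
    (fun y hy => by
      refine ((hasDerivAt_pow (2 * n + 2) y).mul (hasDerivAt_one_sub_sq_rpow hy)).congr_deriv ?_
      have h2 : 0 < 1 - y ^ 2 := by nlinarith [hy.1, hy.2]
      rw [Real.rpow_add_one h2.ne']
      push_cast
      ring) hi
  have h2 : (0 : ℝ) ^ (α + 1) = 0 := Real.zero_rpow (by linarith)
  rw [intervalIntegral.integral_sub ((intervalIntegrable_radial hα n).const_mul _)
      ((intervalIntegrable_radial hα (n + 1)).const_mul _),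
    intervalIntegral.integral_const_mul, intervalIntegral.integral_const_mul] at h1
  simp only [one_pow, sub_self, h2, mul_zero, ne_eq, Nat.add_eq_zero_iff, OfNat.ofNat_ne_zero,
    and_false, not_false_eq_true, zero_pow, zero_mul] at h1
  change (2 * n + 2) * A - (2 * n + 2 * α + 4) * B = 0 at h1
  linarith

end Radial

/-- The density of `dA_α` is invariant under rotations. -/
theorem measurePreserving_rotation (α : ℝ) (c : Circle) :
    MeasurePreserving (rotation c) (areaMeasure α) (areaMeasure α) := by
  have hm : Measurable (rotation c) := (rotation c).continuous.measurable
  have hpre : rotation c ⁻¹' Metric.ball (0 : ℂ) 1 = Metric.ball 0 1 := by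
    ext z; simp only [Set.mem_preimage, mem_ball_zero_iff, LinearIsometryEquiv.norm_map]
  have h1 : MeasurePreserving (rotation c) (volume.restrict (Metric.ball (0 : ℂ) 1))
      (volume.restrict (Metric.ball (0 : ℂ) 1)) := by
    have := (LinearIsometryEquiv.measurePreserving (rotation c)).restrict_preimage
      (s := Metric.ball (0 : ℂ) 1) measurableSet_ball
    rwa [hpre] at this
  refine ⟨hm, Measure.ext fun S hS => ?_⟩
  rw [Measure.map_apply hm hS, areaMeasure, withDensity_apply _ hS, withDensity_apply _ (hm hS)]
  rw [← h1.setLIntegral_comp_preimage hS (by fun_prop)]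
  simp only [LinearIsometryEquiv.norm_map]

theorem integral_areaMeasure {E : Type*} [NormedAddCommGroup E] [NormedSpace ℝ E] {α : ℝ}
    (hα : -1 < α) (f : ℂ → E) :
    ∫ z, f z ∂(areaMeasure α) =
      ∫ z in Metric.ball (0 : ℂ) 1, ((α + 1) / Real.pi * (1 - ‖z‖ ^ 2) ^ α) • f z := by
  rw [areaMeasure, integral_withDensity_eq_integral_toReal_smul (by fun_prop)
    (Eventually.of_forall fun _ => ENNReal.ofReal_lt_top)]
  refine setIntegral_congr_fun measurableSet_ball fun z hz => ?_
  have h1 : ‖z‖ < 1 := by simpa using hz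
  have h2 : 0 ≤ 1 - ‖z‖ ^ 2 := by nlinarith [norm_nonneg z]
  have h3 : 0 < α + 1 := by linarith
  rw [ENNReal.toReal_ofReal (by positivity)]

theorem integrable_areaMeasure_iff {E : Type*} [NormedAddCommGroup E] [NormedSpace ℝ E] {α : ℝ}
    (hα : -1 < α) (f : ℂ → E) :
    Integrable f (areaMeasure α) ↔
      IntegrableOn (fun z => ((α + 1) / Real.pi * (1 - ‖z‖ ^ 2) ^ α) • f z)
        (Metric.ball (0 : ℂ) 1) := by
  rw [areaMeasure, integrable_withDensity_iff_integrable_smul' (by fun_prop)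
    (Eventually.of_forall fun _ => ENNReal.ofReal_lt_top)]
  refine integrableOn_congr_fun (fun z hz => ?_) measurableSet_ball
  have h1 : ‖z‖ < 1 := by simpa using hz
  have h2 : 0 ≤ 1 - ‖z‖ ^ 2 := by nlinarith [norm_nonneg z]
  have h3 : 0 < α + 1 := by linarith
  rw [ENNReal.toReal_ofReal (by positivity)]

theorem ae_areaMeasure_norm_lt (α : ℝ) : ∀ᵐ z ∂(areaMeasure α), ‖z‖ < 1 := by
  refine (withDensity_absolutelyContinuous _ _).ae_le ?_
  filter_upwards [ae_restrict_mem Metric.isOpen_ball.measurableSet] with z hz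
  simpa using hz

/-- The moments `∫ |z|²ⁿ dA_α`. -/
def moment (α : ℝ) (n : ℕ) : ℝ := ∫ z, ‖z‖ ^ (2 * n) ∂(areaMeasure α)

theorem isFiniteMeasure_areaMeasure {α : ℝ} (hα : -1 < α) : IsFiniteMeasure (areaMeasure α) := by
  have h : Integrable (fun _ : ℂ => (1 : ℝ)) (areaMeasure α) := by
    rw [integrable_areaMeasure_iff hα]
    have h1 := (integrableOn_fun_norm_addHaar (volume : Measure ℂ) (r := 1)
      (f := fun y : ℝ => ((α + 1) / Real.pi * (1 - y ^ 2) ^ α) • (1 : ℝ))).2 ?_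
    · exact h1
    · have h2 := (intervalIntegrable_radial hα 0).const_mul ((α + 1) / Real.pi)
      rw [intervalIntegrable_iff_integrableOn_Ioo_of_le zero_le_one] at h2
      refine h2.congr_fun (fun y _ => ?_) measurableSet_Ioo
      simp only [Complex.finrank_real_complex, smul_eq_mul]
      ring
  rcases (integrable_const_iff).1 h with h | h
  · exact absurd h one_ne_zero
  · exact h

theorem moment_eq {α : ℝ} (hα : -1 < α) (n : ℕ) :
    moment α n = 2 * (α + 1) * ∫ y in (0 : ℝ)..1, y ^ (2 * n + 1) * (1 - y ^ 2) ^ α := by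
  rw [moment, integral_areaMeasure hα]
  have h1 := integral_fun_norm_addHaar (volume : Measure ℂ)
    ((Set.Iio 1).indicator fun y : ℝ => ((α + 1) / Real.pi * (1 - y ^ 2) ^ α) • y ^ (2 * n))
  have h2 : ∀ z : ℂ, ((Set.Iio 1).indicator
      fun y : ℝ => ((α + 1) / Real.pi * (1 - y ^ 2) ^ α) • y ^ (2 * n)) ‖z‖ =
      (Metric.ball (0 : ℂ) 1).indicator
        (fun z => ((α + 1) / Real.pi * (1 - ‖z‖ ^ 2) ^ α) • ‖z‖ ^ (2 * n)) z := fun z => by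
    simp only [Set.indicator, Set.mem_Iio, mem_ball_zero_iff]
  simp only [h2] at h1
  rw [integral_indicator measurableSet_ball] at h1
  have h3 : ∀ y : ℝ, y ^ (Module.finrank ℝ ℂ - 1) • ((Set.Iio 1).indicator
      fun y : ℝ => ((α + 1) / Real.pi * (1 - y ^ 2) ^ α) • y ^ (2 * n)) y =
      (Set.Iio 1).indicator (fun y : ℝ => (α + 1) / Real.pi *
        (y ^ (2 * n + 1) * (1 - y ^ 2) ^ α)) y := fun y => by
    simp only [Set.indicator_apply, Complex.finrank_real_complex, smul_eq_mul]
    split_ifs <;> ring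
  have h4 : volume.real (Metric.ball (0 : ℂ) 1) = Real.pi := by
    simp [Measure.real, Complex.volume_ball]
  simp only [h3] at h1
  rw [h1, setIntegral_indicator measurableSet_Iio, Set.Ioi_inter_Iio, h4,
    intervalIntegral.integral_of_le zero_le_one, integral_Ioc_eq_integral_Ioo,
    integral_const_mul, Complex.finrank_real_complex]
  simp only [smul_eq_mul, nsmul_eq_mul]
  field_simp
  push_cast; ring

theorem moment_zero {α : ℝ} (hα : -1 < α) : moment α 0 = 1 := by
  rw [moment_eq hα, integral_radial_zero hα]

theorem moment_succ {α : ℝ} (hα : -1 < α) (n : ℕ) :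
    (n + α + 2) * moment α (n + 1) = (n + 1) * moment α n := by
  have := integral_radial_succ hα n
  rw [moment_eq hα, moment_eq hα]
  linear_combination (2 * (α + 1)) * this

theorem moment_pos {α : ℝ} (hα : -1 < α) (n : ℕ) : 0 < moment α n := by
  induction n with
  | zero => rw [moment_zero hα]; exact one_pos
  | succ n ih =>
    have h1 := moment_succ hα n
    have h2 : (0 : ℝ) < n + α + 2 := by
      have : (0 : ℝ) ≤ n := Nat.cast_nonneg n
      linarith
    have h3 : 0 < (n + α + 2) * moment α (n + 1) := by rw [h1]; positivity
    exact (pos_iff_pos_of_mul_pos h3).1 h2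

/-- Both sides start at 1 and satisfy `(n+1) c_{n+1} = (n+α+2) c_n`. -/
theorem ringChoose_eq_inv_moment {α : ℝ} (hα : -1 < α) (n : ℕ) :
    Ring.choose (α + 2 + n - 1) n = (moment α n)⁻¹ := by
  induction n with
  | zero => rw [moment_zero hα, Ring.choose_zero_right, inv_one]
  | succ n ih =>
    have h1 := moment_succ hα n
    have h0 := moment_pos hα n
    have h0' := moment_pos hα (n + 1)
    have h2 : (n + 1 : ℝ) * Ring.choose (α + 2 + (n + 1 : ℕ) - 1) (n + 1) =
        (n + α + 2) * Ring.choose (α + 2 + n - 1) n := by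
      have e1 := Ring.factorial_nsmul_multichoose_eq_ascPochhammer (α + 2) n
      have e2 := Ring.factorial_nsmul_multichoose_eq_ascPochhammer (α + 2) (n + 1)
      rw [Polynomial.ascPochhammer_smeval_eq_eval] at e1 e2
      rw [ascPochhammer_succ_eval, ← e1, Ring.multichoose_eq, Ring.multichoose_eq,
        Nat.factorial_succ, nsmul_eq_mul, nsmul_eq_mul] at e2
      have h3 : (n.factorial : ℝ) ≠ 0 := by positivity
      refine mul_left_cancel₀ h3 ?_
      push_cast at e2 ⊢
      linear_combination e2
    rw [ih] at h2
    have h3 : (n + 1 : ℝ) ≠ 0 := by positivity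
    refine mul_left_cancel₀ h3 (h2.trans ?_)
    field_simp
    linear_combination h1

/-- This is the binomial series. At `x = |z|²` it evaluates the reproducing kernel on the diagonal.
-/
theorem hasSum_inv_moment {α : ℝ} (hα : -1 < α) {x : ℝ} (hx0 : 0 ≤ x) (hx : x < 1) :
    HasSum (fun n => (moment α n)⁻¹ * x ^ n) ((1 - x) ^ (-(α + 2))) := by
  have h := (Real.one_div_one_sub_rpow_hasFPowerSeriesOnBall_zero (α + 2)).hasSum (y := x)
    (by
      rw [← ENNReal.ofReal_one, Metric.eball_ofReal, mem_ball_zero_iff, Real.norm_of_nonneg hx0]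
      exact hx)
  simp only [FormalMultilinearSeries.ofScalars_apply_eq, ringChoose_eq_inv_moment hα, zero_add,
    smul_eq_mul] at h
  rwa [one_div, ← Real.rpow_neg (by linarith)] at h


/-! ### Taylor coefficients as integrals -/

/-- Rotation by the angle `π/(m-n)` preserves the measure and the disc and changes the sign of the
integrand. -/
theorem setIntegral_conj_pow_mul_pow {α : ℝ} {m n : ℕ} (hmn : m ≠ n) (r : ℝ) :
    ∫ z in Metric.ball (0 : ℂ) r, star z ^ n * z ^ m ∂(areaMeasure α) = 0 := by
  have hd : ((m : ℝ) - n) ≠ 0 := sub_ne_zero.2 (by exact_mod_cast hmn)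
  set c : Circle := Circle.exp (Real.pi / (m - n)) with hc
  have hpre : rotation c ⁻¹' Metric.ball (0 : ℂ) r = Metric.ball 0 r := by
    ext z; simp only [Set.mem_preimage, mem_ball_zero_iff, LinearIsometryEquiv.norm_map]
  have h1 := (measurePreserving_rotation α c).setIntegral_preimage_emb
    (rotation c).toHomeomorph.measurableEmbedding (fun z => star z ^ n * z ^ m)
    (Metric.ball (0 : ℂ) r)
  rw [hpre] at h1
  have hcm : star (c : ℂ) ^ n * (c : ℂ) ^ m = -1 := by
    rw [hc, Circle.coe_exp, Complex.star_def, ← Complex.exp_conj, ← Complex.exp_nat_mul,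
      ← Complex.exp_nat_mul, ← Complex.exp_add, ← Complex.exp_pi_mul_I]
    congr 1
    rw [map_mul, Complex.conj_I, Complex.conj_ofReal]
    have hd' : ((m : ℂ) - n) ≠ 0 := by exact_mod_cast hd
    push_cast
    field_simp
    ring
  have h2 : ∀ z : ℂ, star (rotation c z) ^ n * (rotation c z) ^ m = -(star z ^ n * z ^ m) :=
    fun z => by
      rw [rotation_apply, star_mul', mul_pow, mul_pow]
      linear_combination (star z ^ n * z ^ m) * hcm
  simp only [h2] at h1
  rw [integral_neg] at h1
  have h3 : (2 : ℂ) * ∫ z in Metric.ball (0 : ℂ) r, star z ^ n * z ^ m ∂(areaMeasure α) = 0 := by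
    linear_combination -h1
  exact (mul_eq_zero.1 h3).resolve_left two_ne_zero

theorem summable_pow_mul_norm_of_hasSum {i : ImagUnit} {a : ℕ → ℍ} {g : ℂ → ℍ}
    (h : ∀ z : ℂ, ‖z‖ < 1 → HasSum (fun n => slicePt i z ^ n * a n) (g z)) (r : ℝ) (hr0 : 0 ≤ r)
    (hr : r < 1) : Summable fun n => r ^ n * ‖a n‖ := by
  have h1 := (h r (by rwa [Complex.norm_real, Real.norm_of_nonneg hr0])).summable.norm
  refine h1.congr fun n => ?_
  rw [norm_mul, norm_pow, norm_slicePt, Complex.norm_real, Real.norm_of_nonneg hr0]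

theorem star_mul_self_pow (z : ℂ) (n : ℕ) : star z ^ n * z ^ n = ((‖z‖ ^ (2 * n) : ℝ) : ℂ) := by
  rw [← mul_pow, Complex.star_def, mul_comm, Complex.mul_conj, Complex.normSq_eq_norm_sq,
    pow_mul]
  push_cast; rfl

/-- The Taylor coefficients of a function on `𝔻_i` in terms of its moments, over a smaller disc. -/
theorem setIntegral_star_pow_mul {α : ℝ} (hα : -1 < α) {i : ImagUnit} {a : ℕ → ℍ} {g : ℂ → ℍ}
    (h : ∀ z : ℂ, ‖z‖ < 1 → HasSum (fun n => slicePt i z ^ n * a n) (g z)) {r : ℝ}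
    (hr0 : 0 ≤ r) (hr : r < 1) (n : ℕ) :
    ∫ z in Metric.ball (0 : ℂ) r, star (slicePt i z ^ n) * g z ∂(areaMeasure α) =
      (∫ z in Metric.ball (0 : ℂ) r, ‖z‖ ^ (2 * n) ∂(areaMeasure α)) • a n := by
  have := isFiniteMeasure_areaMeasure hα
  have hr' := summable_pow_mul_norm_of_hasSum h r hr0 hr
  have hF : ∀ m, (fun z : ℂ => star (slicePt i z ^ n) * (slicePt i z ^ m * a m)) =
      fun z => ((ContinuousLinearMap.mul ℝ ℍ).flip (a m)).comp (slicePtL i)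
        (star z ^ n * z ^ m) := fun m => by
    funext z
    change _ = slicePt i (star z ^ n * z ^ m) * a m
    rw [slicePt_mul, slicePt_pow, slicePt_pow, ← star_slicePt, star_pow, mul_assoc]
  have hball : ∀ᵐ z ∂((areaMeasure α).restrict (Metric.ball (0 : ℂ) r)), ‖z‖ < r := by
    filter_upwards [ae_restrict_mem measurableSet_ball] with z hz
    simpa using hz
  -- On the disc of radius `r < 1` the terms are dominated by the summable constants `r ^ m * ‖a
  -- m‖`; no such bound is available on the whole unit disc.
  have h1 := hasSum_integral_of_dominated_convergence
    (μ := (areaMeasure α).restrict (Metric.ball (0 : ℂ) r))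
    (F := fun m z => star (slicePt i z ^ n) * (slicePt i z ^ m * a m))
    (f := fun z => star (slicePt i z ^ n) * g z)
    (fun m _ => r ^ m * ‖a m‖) (fun m => by
      rw [hF]
      exact Continuous.aestronglyMeasurable (by fun_prop))
    (fun m => by
      filter_upwards [hball] with z hz
      rw [norm_mul, norm_mul, Quaternion.norm_star, norm_pow, norm_pow, norm_slicePt]
      have e1 : ‖z‖ ^ n ≤ 1 := pow_le_one₀ (norm_nonneg z) (hz.le.trans hr.le)
      calc ‖z‖ ^ n * (‖z‖ ^ m * ‖a m‖) ≤ 1 * (r ^ m * ‖a m‖) := by gcongr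
        _ = _ := one_mul _)
    (Eventually.of_forall fun _ => hr') (integrable_const _)
    (by
      filter_upwards [hball] with z hz
      exact (h z (hz.trans hr)).mul_left _)
  have h2 : ∀ m, ∫ z in Metric.ball (0 : ℂ) r, star (slicePt i z ^ n) *
      (slicePt i z ^ m * a m) ∂(areaMeasure α) =
      slicePt i (∫ z in Metric.ball (0 : ℂ) r, star z ^ n * z ^ m ∂(areaMeasure α)) * a m :=
    fun m => by
      have hint : Integrable (fun z : ℂ => star z ^ n * z ^ m)
          ((areaMeasure α).restrict (Metric.ball (0 : ℂ) r)) := by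
        refine Integrable.of_bound (C := 1) (Continuous.aestronglyMeasurable (by fun_prop)) ?_
        filter_upwards [hball] with z hz
        rw [norm_mul, norm_pow, norm_pow, _root_.norm_star]
        have e1 := pow_le_one₀ (n := n) (norm_nonneg z) (hz.le.trans hr.le)
        have e2 := pow_le_one₀ (n := m) (norm_nonneg z) (hz.le.trans hr.le)
        exact mul_le_one₀ e1 (by positivity) e2
      rw [hF]
      rw [ContinuousLinearMap.integral_comp_comm _ hint]
      rfl
  simp only [h2] at h1
  refine h1.unique ?_
  have h3 : slicePt i (∫ z in Metric.ball (0 : ℂ) r, star z ^ n * z ^ n ∂(areaMeasure α)) * a n =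
      (∫ z in Metric.ball (0 : ℂ) r, ‖z‖ ^ (2 * n) ∂(areaMeasure α)) • a n := by
    simp only [star_mul_self_pow]
    rw [integral_complex_ofReal, slicePt_ofReal, Quaternion.coe_mul_eq_smul]
  rw [← h3]
  refine hasSum_single n fun m hm => ?_
  rw [setIntegral_conj_pow_mul_pow hm, ← sliceHom_apply, map_zero, zero_mul]

theorem areaMeasure_restrict_ball (α : ℝ) :
    (areaMeasure α).restrict (Metric.ball (0 : ℂ) 1) = areaMeasure α := by
  refine Measure.restrict_eq_self_of_ae_mem ?_
  filter_upwards [ae_areaMeasure_norm_lt α] with z hz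
  simpa using hz

theorem tendsto_setIntegral_ball {E : Type*} [NormedAddCommGroup E] [NormedSpace ℝ E] {α : ℝ}
    {f : ℂ → E} (hf : Integrable f (areaMeasure α)) :
    Tendsto (fun k : ℕ => ∫ z in Metric.ball (0 : ℂ) (1 - 1 / ((k : ℝ) + 1)), f z ∂(areaMeasure α))
      atTop (𝓝 (∫ z, f z ∂(areaMeasure α))) := by
  have hU : ⋃ k : ℕ, Metric.ball (0 : ℂ) (1 - 1 / ((k : ℝ) + 1)) = Metric.ball 0 1 := by
    ext z
    simp only [Set.mem_iUnion, mem_ball_zero_iff]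
    constructor
    · rintro ⟨k, hk⟩
      have : (0 : ℝ) < 1 / ((k : ℝ) + 1) := by positivity
      linarith
    · intro hz
      obtain ⟨k, hk⟩ := exists_nat_one_div_lt (sub_pos.2 hz)
      exact ⟨k, by linarith⟩
  have h := tendsto_setIntegral_of_monotone (μ := areaMeasure α) (f := f)
    (s := fun k : ℕ => Metric.ball (0 : ℂ) (1 - 1 / ((k : ℝ) + 1)))
    (fun k => measurableSet_ball) (fun k l hkl => Metric.ball_subset_ball (by
      have : (k : ℝ) ≤ l := by exact_mod_cast hkl
      gcongr)) hf.integrableOn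
  rw [hU, areaMeasure_restrict_ball] at h
  exact h

/-- The Taylor coefficients of a function on `𝔻_i` in terms of its moments. -/
theorem integral_star_pow_mul {α : ℝ} (hα : -1 < α) {i : ImagUnit} {a : ℕ → ℍ} {g : ℂ → ℍ}
    (h : ∀ z : ℂ, ‖z‖ < 1 → HasSum (fun n => slicePt i z ^ n * a n) (g z)) (n : ℕ)
    (hg : Integrable (fun z => star (slicePt i z ^ n) * g z) (areaMeasure α)) :
    ∫ z, star (slicePt i z ^ n) * g z ∂(areaMeasure α) = moment α n • a n := by
  have := isFiniteMeasure_areaMeasure hα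
  have h1 := tendsto_setIntegral_ball hg
  have h2 : Integrable (fun z : ℂ => ‖z‖ ^ (2 * n)) (areaMeasure α) := by
    refine Integrable.of_bound (C := 1) (Continuous.aestronglyMeasurable (by fun_prop)) ?_
    filter_upwards [ae_areaMeasure_norm_lt α] with z hz
    rw [norm_pow, norm_norm]
    exact pow_le_one₀ (norm_nonneg z) hz.le
  refine tendsto_nhds_unique h1 (((tendsto_setIntegral_ball h2).smul_const (a n)).congr fun k => ?_)
  have hk : (0 : ℝ) < 1 / ((k : ℝ) + 1) := by positivity
  have hk' : 1 / ((k : ℝ) + 1) ≤ 1 := by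
    rw [div_le_one (by positivity)]
    have : (0 : ℝ) ≤ k := Nat.cast_nonneg k
    linarith
  exact (setIntegral_star_pow_mul hα h (by linarith) (by linarith) n).symm

/-! ### The monomial basis of the Bergman space -/

section Basis

variable {α : ℝ} {hα : -1 < α} {i : ImagUnit}

attribute [local instance] realInnerProductSpace

theorem Bergman.smul_apply (f : Bergman hα i) (a : ℍ) (x : ℍ) : (op a • f) x = f x * a := rfl

theorem Bergman.add_apply (f g : Bergman hα i) (x : ℍ) : (f + g) x = f x + g x := rfl

theorem Bergman.sum_apply {ι : Type*} (s : Finset ι) (f : ι → Bergman hα i) (x : ℍ) :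
    (∑ n ∈ s, f n) x = ∑ n ∈ s, f n x := by
  classical
  induction s using Finset.induction_on with
  | empty => rfl
  | insert n s hn ih => rw [Finset.sum_insert hn, Finset.sum_insert hn, Bergman.add_apply, ih]

theorem Bergman.qinner_def (f g : Bergman hα i) :
    qinner f g = ∫ z, star (f (slicePt i z)) * g (slicePt i z) ∂(areaMeasure α) := rfl

/-- A power series with square integrable restriction to `𝔻_i`, as an element of the Bergman
space. -/
def Bergman.ofSeries (hα : -1 < α) (i : ImagUnit) (b : ℕ → ℍ)
    (hb : ∀ r : ℝ, 0 ≤ r → r < 1 → Summable fun n => r ^ n * ‖b n‖)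
    (hm : MemLp (fun z => seriesFun b (slicePt i z)) 2 (areaMeasure α)) : Bergman hα i :=
  ⟨seriesFun b, isLeftSliceHyperholomorphicOn_seriesFun hb, fun _ => seriesFun_of_notMem b, hm⟩

theorem aestronglyMeasurable_seriesFun (α : ℝ) (i : ImagUnit) {b : ℕ → ℍ}
    (hb : ∀ r : ℝ, 0 ≤ r → r < 1 → Summable fun n => r ^ n * ‖b n‖) :
    AEStronglyMeasurable (fun z => seriesFun b (slicePt i z)) (areaMeasure α) := by
  rw [← areaMeasure_restrict_ball]
  refine ContinuousOn.aestronglyMeasurable ?_ measurableSet_ball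
  exact (differentiableOn_seriesFun hb).continuousOn.comp (continuous_slicePt i).continuousOn
    fun z hz => (slicePt_mem i z).2 (by simpa using hz)

theorem summable_single (n : ℕ) (c : ℍ) (r : ℝ) :
    Summable fun m => r ^ m * ‖(Pi.single n c : ℕ → ℍ) m‖ :=
  summable_of_ne_finset_zero (s := {n}) fun m hm => by
    rw [Pi.single_eq_of_ne (by simpa using hm), norm_zero, mul_zero]

theorem seriesFun_single (n : ℕ) (c : ℍ) {x : ℍ} (hx : x ∈ unitBall) :
    seriesFun (Pi.single n c) x = x ^ n * c := by
  refine (hasSum_seriesFun (fun r _ _ => summable_single n c r) hx).unique ?_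
  convert hasSum_single n fun m hm => ?_ using 1
  · rw [Pi.single_eq_same]
  · rw [Pi.single_eq_of_ne hm, mul_zero]

/-- The normalized monomials `zⁿ / ‖zⁿ‖`. -/
def monomial (hα : -1 < α) (i : ImagUnit) (n : ℕ) : Bergman hα i :=
  Bergman.ofSeries hα i (Pi.single n (((√(moment α n))⁻¹ : ℝ) : ℍ))
    (fun r _ _ => summable_single n _ r) (by
      have := isFiniteMeasure_areaMeasure hα
      refine MemLp.of_bound (aestronglyMeasurable_seriesFun α i
        fun r _ _ => summable_single n _ r) (‖((√(moment α n))⁻¹ : ℝ)‖) ?_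
      filter_upwards [ae_areaMeasure_norm_lt α] with z hz
      rw [seriesFun_single n _ ((slicePt_mem i z).2 hz), norm_mul, norm_pow, norm_slicePt,
        Quaternion.norm_coe]
      exact mul_le_of_le_one_left (norm_nonneg _) (pow_le_one₀ (norm_nonneg z) hz.le))

theorem monomial_apply (n : ℕ) {z : ℂ} (hz : ‖z‖ < 1) :
    monomial hα i n (slicePt i z) = (√(moment α n))⁻¹ • slicePt i z ^ n := by
  change seriesFun _ _ = _
  rw [seriesFun_single n _ ((slicePt_mem i z).2 hz), Quaternion.mul_coe_eq_smul]

/-- This links the Hilbert space coefficients with the Taylor coefficients: the integral against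
`zⁿ` is `moment α n • a n`, and the normalisation divides by the square root of the moment. -/
theorem qinner_monomial {f : Bergman hα i} {a : ℕ → ℍ}
    (h : ∀ z : ℂ, ‖z‖ < 1 → HasSum (fun n => slicePt i z ^ n * a n) (f (slicePt i z))) (n : ℕ) :
    qinner (monomial hα i n) f = √(moment α n) • a n := by
  have h0 := moment_pos hα n
  have h1 := integral_star_pow_mul hα h n
  have e1 : (fun z => star (monomial hα i n (slicePt i z)) * f (slicePt i z))
      =ᵐ[areaMeasure α] fun z =>
        (√(moment α n))⁻¹ • (star (slicePt i z ^ n) * f (slicePt i z)) := by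
    filter_upwards [ae_areaMeasure_norm_lt α] with z hz
    rw [monomial_apply n hz, Quaternion.star_smul, smul_mul_assoc]
  have h2 : Integrable (fun z => star (slicePt i z ^ n) * f (slicePt i z)) (areaMeasure α) := by
    have := ((Bergman.integrable_star_mul (monomial hα i n) f).congr e1).smul (√(moment α n))
    refine this.congr (Eventually.of_forall fun z => ?_)
    simp only [Pi.smul_apply]
    rw [smul_inv_smul₀ (Real.sqrt_ne_zero'.2 h0)]
  rw [Bergman.qinner_def, integral_congr_ae e1, integral_smul, h1 h2, smul_smul]
  congr 1
  rw [inv_mul_eq_iff_eq_mul₀ (Real.sqrt_ne_zero'.2 h0), Real.mul_self_sqrt h0.le]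

/-- Functions in the Bergman space are determined by their coefficients. -/
theorem hasSum_monomial_apply (f : Bergman hα i) {z : ℂ} (hz : ‖z‖ < 1) :
    HasSum (fun n => monomial hα i n (slicePt i z) * qinner (monomial hα i n) f)
      (f (slicePt i z)) := by
  obtain ⟨a, ha⟩ := exists_hasSum_slice f.slice i
  convert ha z hz using 2 with n
  rw [monomial_apply n hz, qinner_monomial ha, smul_mul_assoc, mul_smul_comm, smul_smul,
    inv_mul_cancel₀ (Real.sqrt_ne_zero'.2 (moment_pos hα n)), one_smul]

theorem qorthonormal_monomial : QOrthonormal (monomial hα i) := by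
  have h : ∀ m n, qinner (monomial hα i m) (monomial hα i n) =
      √(moment α m) • (Pi.single n (((√(moment α n))⁻¹ : ℝ) : ℍ) : ℕ → ℍ) m := fun m n =>
    qinner_monomial (fun z hz => hasSum_seriesFun (fun r _ _ => summable_single n _ r)
      ((slicePt_mem i z).2 hz)) m
  refine ⟨fun n => ?_, fun m n hmn => ?_⟩
  · rw [h, Pi.single_eq_same, ← Quaternion.coe_mul_eq_smul, ← Quaternion.coe_mul,
      mul_inv_cancel₀ (Real.sqrt_ne_zero'.2 (moment_pos hα n)), Quaternion.coe_one]
  · rw [h, Pi.single_eq_of_ne hmn, smul_zero]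

theorem eq_of_qinner_monomial {f g : Bergman hα i}
    (h : ∀ n, qinner (monomial hα i n) f = qinner (monomial hα i n) g) : f = g := by
  rw [← sub_eq_zero]
  refine Bergman.eq_zero_of_slice _ fun z hz => ?_
  refine (hasSum_monomial_apply (f - g) hz).unique ?_
  simp only [qinner_sub_right, h, sub_self, mul_zero]
  exact hasSum_zero

theorem isometry_toL2 : Isometry (Bergman.toL2 hα i) :=
  AddMonoidHomClass.isometry_of_norm _ fun _ => rfl

/-- Square summable coefficients define an element of the Bergman space. -/
theorem exists_hasSum_monomial {a : ℕ → ℍ} (ha : Summable fun n => ‖a n‖ ^ 2) :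
    ∃ f : Bergman hα i, HasSum (fun n => op (a n) • monomial hα i n) f := by
  set b : ℕ → ℍ := fun n => (√(moment α n))⁻¹ • a n with hbdef
  have hb : ∀ r : ℝ, 0 ≤ r → r < 1 → Summable fun n => r ^ n * ‖b n‖ := fun r hr0 hr => by
    have h1 := (hasSum_inv_moment hα (sq_nonneg r) (by nlinarith)).summable
    refine Summable.of_nonneg_of_le (fun n => by positivity) (fun n => ?_) (h1.add ha)
    have h2 : (moment α n)⁻¹ * (r ^ 2) ^ n = ((√(moment α n))⁻¹ * r ^ n) ^ 2 := by
      rw [mul_pow, inv_pow, Real.sq_sqrt (moment_pos hα n).le, ← pow_mul, ← pow_mul, mul_comm n]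
    rw [h2, hbdef, norm_smul, norm_inv, Real.norm_of_nonneg (Real.sqrt_nonneg _)]
    -- Writing `u` for the monomial factor and `v = ‖a n‖`, this is `u v ≤ u² + v²`.
    nlinarith [sq_nonneg ((√(moment α n))⁻¹ * r ^ n - ‖a n‖),
      sq_nonneg ((√(moment α n))⁻¹ * r ^ n + ‖a n‖)]
  -- The sum is formed in `L²`, which is complete; completeness of the Bergman space is deduced from
  -- this lemma later.
  have hs : Summable fun n => Bergman.toL2 hα i (op (a n) • monomial hα i n) := by
    rw [summable_iff_vanishing_norm]
    intro ε hε
    obtain ⟨s, hs⟩ := summable_iff_vanishing_norm.1 ha (ε ^ 2) (by positivity)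
    refine ⟨s, fun t ht => ?_⟩
    have h1 := hs t ht
    rw [← map_sum]
    change ‖∑ n ∈ t, op (a n) • monomial hα i n‖ < ε
    rw [Real.norm_of_nonneg (by positivity), 
      ← (qorthonormal_monomial (hα := hα) (i := i)).norm_sum_sq] at h1
    exact lt_of_pow_lt_pow_left₀ 2 hε.le h1
  obtain ⟨G, hG⟩ := hs
  have hpt : ∀ z : ℂ, ‖z‖ < 1 → Tendsto
      (fun N => (∑ n ∈ Finset.range N, op (a n) • monomial hα i n) (slicePt i z)) atTop
      (𝓝 (seriesFun b (slicePt i z))) := fun z hz => by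
    refine (hasSum_seriesFun hb ((slicePt_mem i z).2 hz)).tendsto_sum_nat.congr fun N => ?_
    rw [Bergman.sum_apply]
    refine Finset.sum_congr rfl fun n _ => ?_
    rw [Bergman.smul_apply, monomial_apply n hz, hbdef, smul_mul_assoc, mul_smul_comm]
  -- A subsequence of the partial sums converges almost everywhere to the `L²` limit, while all of
  -- them converge pointwise to the power series.
  have hGe : G =ᵐ[areaMeasure α] fun z => seriesFun b (slicePt i z) := by
    have h1 : Tendsto (fun N => Bergman.toL2 hα i
        (∑ n ∈ Finset.range N, op (a n) • monomial hα i n)) atTop (𝓝 G) := by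
      simpa only [map_sum] using hG.tendsto_sum_nat
    obtain ⟨φ, hφ, hae⟩ := (tendstoInMeasure_of_tendsto_Lp h1).exists_seq_tendsto_ae
    have h2 : ∀ᵐ z ∂(areaMeasure α), ∀ N, (Bergman.toL2 hα i
        (∑ n ∈ Finset.range N, op (a n) • monomial hα i n) : ℂ → ℍ) z =
        (∑ n ∈ Finset.range N, op (a n) • monomial hα i n) (slicePt i z) :=
      ae_all_iff.2 fun N => (Bergman.memLp _).coeFn_toLp
    filter_upwards [hae, h2, ae_areaMeasure_norm_lt α] with z hz1 hz2 hz3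
    refine tendsto_nhds_unique hz1 ?_
    simp only [hz2]
    exact (hpt z hz3).comp hφ.tendsto_atTop
  have hm : MemLp (fun z => seriesFun b (slicePt i z)) 2 (areaMeasure α) :=
    (memLp_congr_ae hGe).1 (Lp.memLp G)
  refine ⟨Bergman.ofSeries hα i b hb hm, ?_⟩
  refine (Topology.IsInducing.hasSum_iff (g := Bergman.toL2 hα i)
    isometry_toL2.isUniformInducing.isInducing _ _).1 ?_
  have : Bergman.toL2 hα i (Bergman.ofSeries hα i b hb hm) = G :=
    Lp.ext ((MemLp.coeFn_toLp hm).trans hGe.symm)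
  rw [this]
  exact hG

/-- The normalized monomials are an orthonormal basis of the Bergman space. -/
theorem hasSum_monomial (f : Bergman hα i) :
    HasSum (fun n => op (qinner (monomial hα i n) f) • monomial hα i n) f := by
  obtain ⟨g, hg⟩ := exists_hasSum_monomial (hα := hα) (i := i)
    (qorthonormal_monomial.summable_norm_sq f)
  suffices g = f by rwa [this] at hg
  refine eq_of_qinner_monomial fun n => ?_
  refine (hg.mapL (qinnerL (monomial hα i n))).unique ?_
  convert hasSum_single n fun m hm => ?_ using 1
  · rw [qinnerL_apply, qinner_smul_right, qorthonormal_monomial.1, one_mul]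
  · rw [qinnerL_apply, qinner_smul_right, qorthonormal_monomial.2 n m hm.symm, zero_mul]

end Basis

/-! ### Parseval's identity and completeness -/

section Complete

variable {α : ℝ} {hα : -1 < α} {i : ImagUnit}

attribute [local instance] realInnerProductSpace

/-- Parseval's identity. -/
theorem hasSum_norm_sq_qinner_monomial (f : Bergman hα i) :
    HasSum (fun n => ‖qinner (monomial hα i n) f‖ ^ 2) (‖f‖ ^ 2) := by
  have h1 := (hasSum_monomial f)
  unfold HasSum at h1 ⊢
  refine (h1.norm.pow 2).congr fun s => ?_
  exact qorthonormal_monomial.norm_sum_sq s _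

/-- The coefficients with respect to the monomials give an isometry onto `ℓ²`. -/
theorem completeSpace_bergman (hα : -1 < α) (i : ImagUnit) : CompleteSpace (Bergman hα i) := by
  have hmem : ∀ f : Bergman hα i, Memℓp (fun n => qinner (monomial hα i n) f) 2 := fun f => by
    refine memℓp_gen ?_
    simpa using (hasSum_norm_sq_qinner_monomial f).summable
  set Ψ : Bergman hα i →+ lp (fun _ : ℕ => ℍ) 2 :=
    { toFun := fun f => ⟨fun n => qinner (monomial hα i n) f, hmem f⟩
      map_zero' := by ext n : 2; exact qinner_zero_right _
      map_add' := fun f g => by ext n : 2; exact qinner_add_right _ _ _ } with hΨ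
  have hiso : Isometry Ψ := by
    refine AddMonoidHomClass.isometry_of_norm _ fun f => ?_
    have h1 := lp.norm_rpow_eq_tsum (p := 2) (by norm_num) (Ψ f)
    have h2 := (hasSum_norm_sq_qinner_monomial f).tsum_eq
    rw [← sq_eq_sq₀ (norm_nonneg _) (norm_nonneg _), ← h2]
    have h3 : ‖Ψ f‖ ^ 2 = ∑' n, ‖Ψ f n‖ ^ 2 := by simpa using h1
    exact h3
  have hsurj : Function.Surjective Ψ := fun a => by
    have h1 := (lp.memℓp a).summable (by norm_num)
    obtain ⟨f, hf⟩ := exists_hasSum_monomial (hα := hα) (i := i) (a := a) (by simpa using h1)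
    refine ⟨f, ?_⟩
    ext n : 2
    refine (hf.mapL (qinnerL (monomial hα i n))).unique ?_
    convert hasSum_single n fun m hm => ?_ using 1
    · rw [qinnerL_apply, qinner_smul_right, qorthonormal_monomial.1, one_mul]
    · rw [qinnerL_apply, qinner_smul_right, qorthonormal_monomial.2 n m hm.symm, zero_mul]
  rw [completeSpace_iff_isComplete_range hiso.isUniformInducing, hsurj.range_eq]
  exact isComplete_univ

end Complete

/-! ### The reproducing kernel -/

section Kernel

variable {α : ℝ} {hα : -1 < α} {i : ImagUnit}

attribute [local instance] realInnerProductSpace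

theorem norm_monomial_apply_sq (n : ℕ) {z : ℂ} (hz : ‖z‖ < 1) :
    ‖monomial hα i n (slicePt i z)‖ ^ 2 = (moment α n)⁻¹ * (‖z‖ ^ 2) ^ n := by
  rw [monomial_apply n hz, norm_smul, norm_pow, norm_slicePt, norm_inv,
    Real.norm_of_nonneg (Real.sqrt_nonneg _), mul_pow, inv_pow, Real.sq_sqrt (moment_pos hα n).le,
    ← pow_mul, ← pow_mul, mul_comm 2]

theorem hasSum_norm_monomial_apply_sq {z : ℂ} (hz : ‖z‖ < 1) :
    HasSum (fun n => ‖monomial hα i n (slicePt i z)‖ ^ 2) ((1 - ‖z‖ ^ 2) ^ (-(α + 2))) := by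
  simp only [norm_monomial_apply_sq _ hz]
  exact hasSum_inv_moment hα (sq_nonneg _) (by nlinarith [norm_nonneg z])

/-- The reproducing property. -/
theorem qinner_bergmanKernel {z : ℂ} (hz : ‖z‖ < 1) (f : Bergman hα i) :
    qinner (bergmanKernel hα i (slicePt i z)) f = f (slicePt i z) := by
  have hex : ∃ K : Bergman hα i, ∀ f : Bergman hα i, f (slicePt i z) = qinner K f := by
    -- The kernel is `K_z = ∑ eₙ conj(eₙ(z))` over the normalised monomials.
    obtain ⟨K, hK⟩ := exists_hasSum_monomial (hα := hα) (i := i)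
      (a := fun n => star (monomial hα i n (slicePt i z))) (by
        simpa only [Quaternion.norm_star] using (hasSum_norm_monomial_apply_sq hz).summable)
    refine ⟨K, fun f => (hasSum_monomial_apply f hz).unique ?_⟩
    have h1 := (hK.mapL (qinnerL f)).star
    simp only [qinnerL_apply, qinner_smul_right, star_mul, star_star, star_qinner] at h1
    exact h1
  unfold bergmanKernel
  rw [dif_pos hex]
  exact (hex.choose_spec f).symm

theorem norm_bergmanKernel_sq {z : ℂ} (hz : ‖z‖ < 1) :
    ‖bergmanKernel hα i (slicePt i z)‖ ^ 2 = (1 - ‖z‖ ^ 2) ^ (-(α + 2)) := by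
  refine (hasSum_norm_sq_qinner_monomial _).unique ?_
  convert hasSum_norm_monomial_apply_sq (hα := hα) (i := i) hz using 3 with n
  rw [← star_qinner, Quaternion.norm_star, qinner_bergmanKernel hz]

theorem re_bergmanKernel_self {z : ℂ} (hz : ‖z‖ < 1) :
    (bergmanKernel hα i (slicePt i z) (slicePt i z)).re = (1 - ‖z‖ ^ 2) ^ (-(α + 2)) := by
  rw [← norm_bergmanKernel_sq hz, ← qinner_bergmanKernel hz, re_qinner_self]

theorem bergmanJ_apply (f : Bergman hα i) {z : ℂ} (hz : ‖z‖ < 1) :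
    bergmanJ hα i f (slicePt i z) = i * f (slicePt i z) :=
  multFun_slice i f.slice hz

theorem Bergman.ext_slice {f g : Bergman hα i}
    (h : ∀ z : ℂ, ‖z‖ < 1 → f (slicePt i z) = g (slicePt i z)) : f = g := by
  rw [← sub_eq_zero]
  refine Bergman.eq_zero_of_slice _ fun z hz => ?_
  change f (slicePt i z) - g (slicePt i z) = 0
  rw [h z hz, sub_self]

theorem bergmanJ_bergmanJ (f : Bergman hα i) : bergmanJ hα i (bergmanJ hα i f) = -f := by
  refine Bergman.ext_slice fun z hz => ?_
  rw [bergmanJ_apply _ hz, bergmanJ_apply _ hz, ← mul_assoc, imagUnit_mul_self, neg_one_mul]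
  rfl

theorem isAntiSelfAdjoint_bergmanJ (hα : -1 < α) (i : ImagUnit) :
    IsAntiSelfAdjoint (bergmanJ hα i) := fun f g => by
  rw [Bergman.qinner_def, Bergman.qinner_def]
  refine integral_congr_ae ?_
  filter_upwards [ae_areaMeasure_norm_lt α] with z hz
  rw [bergmanJ_apply g hz]
  change star (-(bergmanJ hα i f (slicePt i z))) * _ = _
  rw [bergmanJ_apply f hz, star_neg, star_mul, star_imagUnit, mul_neg, neg_neg, mul_assoc]

theorem monomial_mem_plusSpace (n : ℕ) : monomial hα i n ∈ plusSpace (bergmanJ hα i) i := by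
  refine Bergman.ext_slice fun z hz => ?_
  rw [bergmanJ_apply _ hz, Bergman.smul_apply, monomial_apply n hz, mul_smul_comm,
    smul_mul_assoc, ← slicePt_pow]
  nth_rewrite 1 [← slicePt_I i]
  rw [slicePt_comm, slicePt_I]

/-- For `z ∈ 𝔻_i` the coefficients `conj(eₙ(z))` lie in `ℂ_i` and commute with `i`, and the
monomials themselves lie in `H₊`. -/
theorem bergmanKernel_mem_plusSpace {z : ℂ} (hz : ‖z‖ < 1) :
    bergmanKernel hα i (slicePt i z) ∈ plusSpace (bergmanJ hα i) i := by
  refine eq_of_qinner_monomial fun n => ?_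
  have h1 := isAntiSelfAdjoint_bergmanJ hα i (monomial hα i n) (bergmanKernel hα i (slicePt i z))
  rw [← h1, monomial_mem_plusSpace n, qinner_neg_left, qinner_smul_left, star_imagUnit,
    neg_mul, neg_neg, qinner_smul_right, ← star_qinner, qinner_bergmanKernel hz,
    monomial_apply n hz, Quaternion.star_smul, ← slicePt_pow, star_slicePt, mul_smul_comm,
    smul_mul_assoc, ← slicePt_I i, slicePt_comm]

theorem isPlusBasis_monomial (hα : -1 < α) (i : ImagUnit) :
    IsPlusBasis (bergmanJ hα i) i (Set.range (monomial hα i)) := by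
  have hinj : Function.Injective (monomial hα i) := fun m n hmn => by
    by_contra h
    have h1 := (qorthonormal_monomial (hα := hα) (i := i)).2 m n h
    rw [hmn, (qorthonormal_monomial (hα := hα) (i := i)).1] at h1
    exact one_ne_zero h1
  refine ⟨?_, ?_, ?_, fun x _ => ?_⟩
  · rintro _ ⟨n, rfl⟩
    exact monomial_mem_plusSpace n
  · rintro _ ⟨n, rfl⟩
    exact qorthonormal_monomial.1 n
  · rintro _ ⟨m, rfl⟩ _ ⟨n, rfl⟩ h
    exact qorthonormal_monomial.2 m n fun h' => h (by rw [h'])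
  · exact (hinj.hasSum_range_iff (f := fun e => op (qinner e x) • e)).2 (hasSum_monomial x)

end Kernel

/-! ### The Berezin transform -/

section Berezin

variable {α : ℝ} {hα : -1 < α} {i : ImagUnit}

attribute [local instance] realInnerProductSpace

/-- The function `z ↦ ⟨K_z, T K_z⟩`. -/
def kernelForm (T : Bergman hα i →L[ℍᵐᵒᵖ] Bergman hα i) (z : ℂ) : ℍ :=
  qinner (bergmanKernel hα i (slicePt i z)) (T (bergmanKernel hα i (slicePt i z)))

theorem berezin_eq (T : Bergman hα i →L[ℍᵐᵒᵖ] Bergman hα i) {z : ℂ} (hz : ‖z‖ < 1) :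
    berezin T z = ((1 - ‖z‖ ^ 2) ^ (α + 2)) • kernelForm T z := by
  have h1 : 0 < 1 - ‖z‖ ^ 2 := by nlinarith [norm_nonneg z]
  rw [berezin, normalizedKernel, map_smul, qinner_smul_left, qinner_smul_right,
    Quaternion.star_coe, Quaternion.mul_coe_eq_smul, Quaternion.coe_mul_eq_smul, smul_smul,
    re_bergmanKernel_self hz, ← mul_inv, Real.mul_self_sqrt (by positivity),
    Real.rpow_neg h1.le, inv_inv]
  rfl

/-- The normalisation contributes the exponent `α + 2` and the invariant measure `-2`, which leaves
the weight of `dA_α`. -/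
theorem density_smul_berezin (T : Bergman hα i →L[ℍᵐᵒᵖ] Bergman hα i) {z : ℂ} (hz : ‖z‖ < 1) :
    (α + 1) • (1 / (Real.pi * (1 - ‖z‖ ^ 2) ^ 2)) • berezin T z =
      ((α + 1) / Real.pi * (1 - ‖z‖ ^ 2) ^ α) • kernelForm T z := by
  have h1 : 0 < 1 - ‖z‖ ^ 2 := by nlinarith [norm_nonneg z]
  rw [berezin_eq T hz, smul_smul, smul_smul, Real.rpow_add h1]
  congr 1
  norm_cast
  field_simp

theorem integrable_berezin_iff (T : Bergman hα i →L[ℍᵐᵒᵖ] Bergman hα i) :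
    Integrable (berezin T) invMeasure ↔ Integrable (kernelForm T) (areaMeasure α) := by
  have hα1 : α + 1 ≠ 0 := by linarith
  rw [invMeasure, integrable_withDensity_iff_integrable_smul' (by fun_prop)
    (Eventually.of_forall fun _ => ENNReal.ofReal_lt_top), integrable_areaMeasure_iff hα,
    ← integrable_smul_iff hα1]
  refine integrableOn_congr_fun (fun z hz => ?_) measurableSet_ball
  have hz1 : ‖z‖ < 1 := by simpa using hz
  rw [← density_smul_berezin T hz1, Pi.smul_apply, ENNReal.toReal_ofReal (by positivity)]

theorem integral_berezin (T : Bergman hα i →L[ℍᵐᵒᵖ] Bergman hα i) :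
    (α + 1) • ∫ z, berezin T z ∂invMeasure = ∫ z, kernelForm T z ∂(areaMeasure α) := by
  rw [invMeasure, integral_withDensity_eq_integral_toReal_smul (by fun_prop)
    (Eventually.of_forall fun _ => ENNReal.ofReal_lt_top), integral_areaMeasure hα,
    ← integral_smul]
  refine setIntegral_congr_fun measurableSet_ball fun z hz => ?_
  have hz1 : ‖z‖ < 1 := by simpa using hz
  rw [← density_smul_berezin T hz1, ENNReal.toReal_ofReal (by positivity)]

end Berezin

/-! ### Termwise integration -/

section Series

/-- Termwise integration of an almost everywhere convergent series. -/
theorem integrable_and_hasSum_integral {X E : Type*} [MeasurableSpace X] {μ : Measure X}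
    [NormedAddCommGroup E] [NormedSpace ℝ E] [CompleteSpace E] {F : ℕ → X → E} {f : X → E}
    (hF : ∀ n, Integrable (F n) μ) (hs : Summable fun n => ∫ x, ‖F n x‖ ∂μ)
    (hf : ∀ᵐ x ∂μ, HasSum (fun n => F n x) (f x)) :
    Integrable f μ ∧ HasSum (fun n => ∫ x, F n x ∂μ) (∫ x, f x ∂μ) := by
  have hm : AEStronglyMeasurable f μ := by
    refine aestronglyMeasurable_of_tendsto_ae atTop
      (f := fun N x => ∑ n ∈ Finset.range N, F n x) (fun N => ?_) ?_
    · exact (integrable_finsetSum _ fun n _ => hF n).aestronglyMeasurable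
    · filter_upwards [hf] with x hx using hx.tendsto_sum_nat
  have hfin : ∑' n, ∫⁻ x, ‖F n x‖ₑ ∂μ ≠ ⊤ := by
    have h1 : ∀ n, ∫⁻ x, ‖F n x‖ₑ ∂μ = ENNReal.ofReal (∫ x, ‖F n x‖ ∂μ) := fun n => by
      rw [ofReal_integral_norm_eq_lintegral_enorm (hF n)]
    simp_rw [h1]
    exact hs.tsum_ofReal_ne_top
  refine ⟨⟨hm, ?_⟩, ?_⟩
  · refine lt_of_le_of_lt (lintegral_mono_ae (g := fun x => ∑' n, ‖F n x‖ₑ) ?_) ?_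
    · filter_upwards [hf] with x hx
      rw [← hx.tsum_eq]
      exact enorm_tsum_le_tsum_enorm
    · rw [lintegral_tsum fun n => (hF n).aestronglyMeasurable.enorm]
      exact hfin.lt_top
  · have h := hasSum_integral_of_summable_integral_norm hF hs
    rwa [integral_congr_ae (g := f) (by filter_upwards [hf] with x hx using hx.tsum_eq)] at h

end Series

/-! ### Trace class and integrability of the Berezin transform -/

section Trace

variable {α : ℝ} {hα : -1 < α} {i : ImagUnit}

attribute [local instance] realInnerProductSpace

theorem re_mul_comm (p q : ℍ) : (p * q).re = (q * p).re := by
  rw [Quaternion.re_mul, Quaternion.re_mul]; ring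

theorem Bergman.integrable_mul_star (f g : Bergman hα i) :
    Integrable (fun z => f (slicePt i z) * star (g (slicePt i z))) (areaMeasure α) :=
  MemLp.integrable_mul (p := 2) (q := 2) f.memLp g.memLp.star

theorem Bergman.integral_norm_mul_star_le (f g : Bergman hα i) :
    ∫ z, ‖f (slicePt i z) * star (g (slicePt i z))‖ ∂(areaMeasure α) ≤ ‖f‖ * ‖g‖ := by
  have h := integral_mul_norm_le_Lp_mul_Lq (μ := areaMeasure α) (p := 2) (q := 2)
    Real.HolderConjugate.two_two (f := fun z => f (slicePt i z)) (g := fun z => g (slicePt i z))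
    (by simpa using f.memLp) (by simpa using g.memLp)
  simp only [Real.rpow_two, Bergman.integral_normSq, ← Real.sqrt_eq_rpow,
    Real.sqrt_sq (norm_nonneg _)] at h
  simpa only [norm_mul, Quaternion.norm_star] using h

/-- The integrand has its factors in the opposite order to the scalar product, so only the real
parts can be compared. -/
theorem Bergman.re_integral_mul_star (f g : Bergman hα i) :
    (∫ z, f (slicePt i z) * star (g (slicePt i z)) ∂(areaMeasure α)).re = (qinner g f).re := by
  rw [Bergman.qinner_def, ← reL_apply, ← reL_apply,
    ← reL.integral_comp_comm (f.integrable_mul_star g),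
    ← reL.integral_comp_comm (g.integrable_star_mul f)]
  simp only [reL_apply]
  congr 1 with z
  exact re_mul_comm _ _

theorem qinner_bergmanKernel_right {z : ℂ} (hz : ‖z‖ < 1) (f : Bergman hα i) :
    qinner f (bergmanKernel hα i (slicePt i z)) = star (f (slicePt i z)) := by
  rw [← star_qinner, qinner_bergmanKernel hz]

section Nuclear

variable {T : Bergman hα i →L[ℍᵐᵒᵖ] Bergman hα i} {u v : ℕ → Bergman hα i}

/-- Pairing with `K_z` on the left evaluates `uₙ` at `z`, and the coefficient `⟨vₙ, K_z⟩` is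
`conj(vₙ(z))`. -/
theorem hasSum_kernelForm (hT : ∀ x, HasSum (fun n => op (qinner (v n) x) • u n) (T x))
    {z : ℂ} (hz : ‖z‖ < 1) :
    HasSum (fun n => u n (slicePt i z) * star (v n (slicePt i z))) (kernelForm T z) := by
  have h := (hT (bergmanKernel hα i (slicePt i z))).mapL
    (qinnerL (bergmanKernel hα i (slicePt i z)))
  simpa only [qinnerL_apply, qinner_bergmanKernel hz, Bergman.smul_apply,
    qinner_bergmanKernel_right hz, kernelForm] using h

/-- The trace of a nuclear operator is the integral of its kernel form. -/
theorem integrable_kernelForm (huv : Summable fun n => ‖u n‖ * ‖v n‖)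
    (hT : ∀ x, HasSum (fun n => op (qinner (v n) x) • u n) (T x)) :
    Integrable (kernelForm T) (areaMeasure α) ∧
      ∑' n, (qinner (v n) (u n)).re = (∫ z, kernelForm T z ∂(areaMeasure α)).re := by
  obtain ⟨h1, h2⟩ := integrable_and_hasSum_integral (μ := areaMeasure α) (f := kernelForm T)
    (fun n => (u n).integrable_mul_star (v n))
    (Summable.of_nonneg_of_le (fun n => integral_nonneg fun _ => norm_nonneg _)
      (fun n => (u n).integral_norm_mul_star_le (v n)) huv)
    (by filter_upwards [ae_areaMeasure_norm_lt α] with z hz using hasSum_kernelForm hT hz)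
  refine ⟨h1, ?_⟩
  have h3 := (h2.mapL reL).tsum_eq
  simpa only [reL_apply, Bergman.re_integral_mul_star] using h3

end Nuclear

theorem MemTraceClass.exists_nuclear {J T : Bergman hα i →L[ℍᵐᵒᵖ] Bergman hα i}
    (h : MemTraceClass J T) : ∃ u v : ℕ → Bergman hα i, (Summable fun n => ‖u n‖ * ‖v n‖) ∧
      ∀ x, HasSum (fun n => op (qinner (v n) x) • u n) (T x) := by
  obtain ⟨-, -, s, hs, hsum⟩ := h
  obtain ⟨u, v, hu, hv, hT⟩ := hs.exists_hasSum
  refine ⟨u, v, Summable.of_nonneg_of_le (fun n => by positivity) (fun n => ?_) hsum, hT⟩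
  exact (mul_le_of_le_one_right (norm_nonneg _) (hv n)).trans (hu n)

theorem MemTraceClass.integrable_berezin {J T : Bergman hα i →L[ℍᵐᵒᵖ] Bergman hα i}
    (h : MemTraceClass J T) : Integrable (berezin T) invMeasure := by
  obtain ⟨u, v, huv, hT⟩ := h.exists_nuclear
  exact (integrable_berezin_iff T).2 (integrable_kernelForm huv hT).1

theorem MemTraceClass.hasTrace {T : Bergman hα i →L[ℍᵐᵒᵖ] Bergman hα i}
    (h : MemTraceClass (bergmanJ hα i) T) :
    HasTrace (bergmanJ hα i) i T (∫ z, kernelForm T z ∂(areaMeasure α)) := by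
  obtain ⟨u, v, huv, hT⟩ := h.exists_nuclear
  have hJ := isAntiSelfAdjoint_bergmanJ hα i
  obtain ⟨hint, hre⟩ := integrable_kernelForm huv hT
  have huw : Summable fun n => ‖u n‖ * ‖-(bergmanJ hα i (v n))‖ := by
    have h1 : ∀ n, ‖bergmanJ hα i (v n)‖ = ‖v n‖ := fun n => (v n).norm_mult
    simpa only [norm_neg, h1] using huv
  -- As `J* = -J`, the operator `T J` has the nuclear expansion with `vₙ` replaced by `-J vₙ`, of
  -- the same norm.
  have hT' : ∀ x, HasSum (fun n => op (qinner (-(bergmanJ hα i (v n))) x) • u n)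
      (T.comp (bergmanJ hα i) x) := fun x => by
    simp only [hJ _ x]
    exact hT (bergmanJ hα i x)
  -- Since `J K_z = K_z i`, composing `T` with `J` multiplies the kernel form by `i` on the right,
  -- just as it does the diagonal entries over a basis of `H₊`.
  have hk : ∀ z : ℂ, ‖z‖ < 1 → kernelForm (T.comp (bergmanJ hα i)) z = kernelForm T z * i :=
    fun z hz => by
      rw [kernelForm, ContinuousLinearMap.comp_apply, bergmanKernel_mem_plusSpace hz, map_smul,
        qinner_smul_right]
      rfl
  have hc : ∀ z : ℂ, ‖z‖ < 1 → (i : ℍ) * kernelForm T z = kernelForm T z * i := fun z hz => by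
    refine qinner_commute_of_mem_plusSpace hJ (bergmanKernel_mem_plusSpace hz) ?_
    change bergmanJ hα i _ = op (i : ℍ) • _
    rw [← h.2.1, bergmanKernel_mem_plusSpace hz, map_smul]
  have hi1 : ∫ z, kernelForm T z * (i : ℍ) ∂(areaMeasure α) =
      (∫ z, kernelForm T z ∂(areaMeasure α)) * i :=
    ((ContinuousLinearMap.mul ℝ ℍ).flip i).integral_comp_comm hint
  have hi2 : ∫ z, (i : ℍ) * kernelForm T z ∂(areaMeasure α) =
      i * ∫ z, kernelForm T z ∂(areaMeasure α) :=
    (ContinuousLinearMap.mul ℝ ℍ i).integral_comp_comm hint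
  refine hasTrace_of_nuclear bergmanJ_bergmanJ hJ h.2.1 ⟨_, isPlusBasis_monomial hα i⟩ huv hT huw
    hT' ?_ hre ?_
  · rw [← hi1, ← hi2]
    refine integral_congr_ae ?_
    filter_upwards [ae_areaMeasure_norm_lt α] with z hz using hc z hz
  · have hi3 : ∫ z, kernelForm (T.comp (bergmanJ hα i)) z ∂(areaMeasure α) =
        ∫ z, kernelForm T z * (i : ℍ) ∂(areaMeasure α) := by
      refine integral_congr_ae ?_
      filter_upwards [ae_areaMeasure_norm_lt α] with z hz using hk z hz
    rw [(integrable_kernelForm huw hT').2, hi3, hi1]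

/-- This is positivity of `T` at `K_z - p`, expanded; the two mixed terms have equal real parts. -/
theorem IsPositive.re_kernelForm_le {T : Bergman hα i →L[ℍᵐᵒᵖ] Bergman hα i} (hT : IsPositive T)
    {z : ℂ} (p : Bergman hα i) :
    2 * (qinner (bergmanKernel hα i (slicePt i z)) (T p)).re ≤
      (qinner p (T p)).re + (kernelForm T z).re := by
  set K := bergmanKernel hα i (slicePt i z)
  have h1 := hT.re_nonneg (K - p)
  have h2 : (qinner p (T K)).re = (qinner K (T p)).re := by
    rw [← hT.selfAdjoint, re_qinner_comm]
  rw [map_sub, qinner_sub_right, qinner_sub_left, qinner_sub_left, Quaternion.re_sub,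
    Quaternion.re_sub, Quaternion.re_sub, h2] at h1
  have h3 : kernelForm T z = qinner K (T K) := rfl
  rw [h3]
  linarith

/-- Partial traces of a positive operator are bounded by the integral of its kernel form. -/
theorem IsPositive.sum_re_le {T : Bergman hα i →L[ℍᵐᵒᵖ] Bergman hα i} (hT : IsPositive T)
    (hint : Integrable (kernelForm T) (areaMeasure α)) {e : ℕ → Bergman hα i}
    (ho : ∀ m n, m ≠ n → qinner (e m) (e n) = 0) (h1 : ∀ n, qinner (e n) (e n) = 1 ∨ e n = 0)
    (N : ℕ) : ∑ n ∈ Finset.range N, (qinner (e n) (T (e n))).re ≤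
      (∫ z, kernelForm T z ∂(areaMeasure α)).re := by
  set S := ∑ n ∈ Finset.range N, (qinner (e n) (T (e n))).re with hS
  set A : ℂ → ℍ := fun z => ∑ n ∈ Finset.range N, T (e n) (slicePt i z) * star (e n (slicePt i z))
    with hA
  set B : ℂ → ℍ := fun z => ∑ m ∈ Finset.range N, ∑ n ∈ Finset.range N,
    (op (qinner (e m) (T (e n))) • e m) (slicePt i z) * star (e n (slicePt i z)) with hB
  have hAi : Integrable A (areaMeasure α) :=
    integrable_finsetSum _ fun n _ => Bergman.integrable_mul_star _ _
  have hBi : Integrable B (areaMeasure α) :=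
    integrable_finsetSum _ fun m _ => integrable_finsetSum _ fun n _ =>
      Bergman.integrable_mul_star _ _
  have hAS : (∫ z, A z ∂(areaMeasure α)).re = S := by
    rw [integral_finsetSum _ fun n _ => Bergman.integrable_mul_star _ _, re_sum]
    exact Finset.sum_congr rfl fun n _ => Bergman.re_integral_mul_star _ _
  -- Integration pairs `eₙ` with `eₘ ⟨eₘ, T eₙ⟩`. Orthogonality leaves the diagonal, and where `eₙ =
  -- 0` both sides are zero.
  have hBS : (∫ z, B z ∂(areaMeasure α)).re = S := by
    rw [integral_finsetSum _ fun m _ => integrable_finsetSum _ fun n _ =>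
      Bergman.integrable_mul_star _ _, re_sum]
    refine Finset.sum_congr rfl fun m hm => ?_
    rw [integral_finsetSum _ fun n _ => Bergman.integrable_mul_star _ _, re_sum,
      Finset.sum_eq_single_of_mem m hm fun n _ hnm => ?_]
    · rw [Bergman.re_integral_mul_star, qinner_smul_right]
      rcases h1 m with h | h
      · rw [h, one_mul]
      · simp [h]
    · rw [Bergman.re_integral_mul_star, qinner_smul_right, ho n m hnm, zero_mul]
      rfl
  have hle : ∀ᵐ z ∂(areaMeasure α), 2 * (A z).re ≤ (B z).re + (kernelForm T z).re := by
    filter_upwards [ae_areaMeasure_norm_lt α] with z hz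
    -- Since `⟨eₙ, K_z⟩ = conj(eₙ(z))`, this is the orthogonal projection of `K_z` to the span of
    -- the `eₙ`. Then `A = ⟨K_z, T p⟩` and `B = ⟨p, T p⟩`.
    set p : Bergman hα i := ∑ n ∈ Finset.range N, op (star (e n (slicePt i z))) • e n with hp
    have hTp : T p = ∑ n ∈ Finset.range N, op (star (e n (slicePt i z))) • T (e n) := by
      rw [hp, map_sum]
      exact Finset.sum_congr rfl fun n _ => map_smul _ _ _
    have e1 : qinner (bergmanKernel hα i (slicePt i z)) (T p) = A z := by
      rw [hTp, qinner_sum_right]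
      refine Finset.sum_congr rfl fun n _ => ?_
      rw [qinner_smul_right, qinner_bergmanKernel hz]
    have e2 : qinner p (T p) = B z := by
      rw [hTp, hp, qinner_sum_left]
      refine Finset.sum_congr rfl fun m _ => ?_
      rw [qinner_sum_right]
      refine Finset.sum_congr rfl fun n _ => ?_
      rw [qinner_smul_left, star_star, qinner_smul_right, Bergman.smul_apply, mul_assoc]
    rw [← e1, ← e2]
    exact hT.re_kernelForm_le p
  have hfin := integral_mono_ae ((reL.integrable_comp hAi).const_mul 2)
    ((reL.integrable_comp hBi).add (reL.integrable_comp hint)) (by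
      filter_upwards [hle] with z hz
      simpa only [Pi.add_apply, reL_apply] using hz)
  rw [integral_const_mul, integral_add' (reL.integrable_comp hBi) (reL.integrable_comp hint),
    reL.integral_comp_comm hAi, reL.integral_comp_comm hBi, reL.integral_comp_comm hint,
    reL_apply, reL_apply, reL_apply, hAS, hBS] at hfin
  linarith

/-- A positive operator with integrable Berezin transform is of trace class. -/
theorem IsPositive.memTraceClass {J T : Bergman hα i →L[ℍᵐᵒᵖ] Bergman hα i} (hT : IsPositive T)
    (hJ : CommutesWith J T) (hint : Integrable (berezin T) invMeasure) : MemTraceClass J T := by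
  have hint' := (integrable_berezin_iff T).1 hint
  have := completeSpace_bergman hα i
  have hc : IsCompactOperator T := by
    -- The bound on partial traces is used twice: on the monomials for compactness, then on the
    -- eigenvectors for summability of the singular values.
    refine hT.isCompactOperator (e := monomial hα i) qorthonormal_monomial hasSum_monomial ?_
    exact summable_of_sum_range_le (fun n => hT.re_nonneg _) (hT.sum_re_le hint'
      qorthonormal_monomial.2 fun n => Or.inl (qorthonormal_monomial.1 n))
  exact ⟨hc, hJ, hT.exists_singularValueSeq hc fun e ho h1 N => hT.sum_re_le hint' ho h1 N⟩

end Trace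

end SliceBergman
end

open SliceBergman in
theorem mainTheorem4 {α : ℝ} (hα : -1 < α) (i : ImagUnit) :
    (∀ J : Bergman hα i →L[ℍᵐᵒᵖ] Bergman hα i, IsUnitary J → IsAntiSelfAdjoint J →
      ∀ T : Bergman hα i →L[ℍᵐᵒᵖ] Bergman hα i, CommutesWith J T → IsPositive T →
        (MemTraceClass J T ↔ Integrable (berezin T) invMeasure)) ∧
    (∀ T : Bergman hα i →L[ℍᵐᵒᵖ] Bergman hα i, MemTraceClass (bergmanJ hα i) T →
      Integrable (berezin T) invMeasure ∧
      HasTrace (bergmanJ hα i) i T ((α + 1) • ∫ z, berezin T z ∂invMeasure)) := by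
  refine ⟨fun J _ _ T hJ hT => ⟨fun h => h.integrable_berezin, hT.memTraceClass hJ⟩,
    fun T hT => ⟨hT.integrable_berezin, ?_⟩⟩
  rw [integral_berezin]
  exact hT.hasTrace
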